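/- Let $\tau\in\mathbb{C}$ with $\operatorname{Im}\tau>0$, let $n\ge 1$ be an integer, and put $r=(2\pi/\operatorname{Im}\tau)^{1/2}$. Identify $x=(x_1,x_2)\in\mathbb{R}^2$ with $x_1+ix_2\in\mathbb{C}$, let $\mathcal{L}^\tau$ be the lattice spanned by $r$ and $r\tau$, and let $\Omega^\tau=\{sr+tr\tau: 0\le s,t<1\}$ be its primitive cell. A function $\psi:\mathbb{R}^2\to\mathbb{C}$ is called quasi-periodic if $$\psi(x+t)=e^{\frac{in}{2}\,t\wedge x}\,\psi(x)\qquad\text{for } t=r,\ r\tau,\qquad t\wedge x=t_1x_2-t_2x_1 .$$ Let $\mathscr{L}^2_n(\tau)$ be the closure in $L^2(\Omega^\tau)$ of the (restrictions to $\Omega^\tau$ of) smooth quasi-periodic functions; an element of $L^2(\Omega^\tau)$ is identified with its quasi-periodic extension to $\mathbb{R}^2$. Let $\mathscr{H}^2_n(\tau)$ be the subspace of those elements whose quasi-periodic extension has weak partial derivatives on $\mathbb{R}^2$ up to order $2$ and lies, together with these derivatives, in $L^2_{loc}(\mathbb{R}^2)$. Let $A_0^n(x)=\frac n2(-x_2,x_1)$,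 $\nabla_A=\nabla-iA$, $\nabla_A^*F=-\operatorname{div}F+iA\cdot F$, and let $L^n=-\Delta_{A_0^n}=\nabla_{A_0^n}^*\nabla_{A_0^n}$ be the operator in $\mathscr{L}^2_n(\tau)$ with domain $\mathscr{H}^2_n(\tau)$. Then: 1. $\mathscr{L}^2_n(\tau)=L^2(\Omega^\tau)$, and $L^n$ is a self-adjoint operator. 2. Its spectrum is $\sigma(L^n)=\{(2k+1)n : k=0,1,2,\dots\}$. 3. $\dim_{\mathbb{C}}\operatorname{null}(L^n-n)=n$. 4. $\operatorname{null}(L^n-n)$ consists exactly of the functions $$e^{\frac{in}{2}x_2(x_1+ix_2)}\sum_{k=-\infty}^{\infty}c_k\,e^{ki\sqrt{2\pi\operatorname{Im}\tau}\,(x_1+ix_2)},\qquad c_{k+n}=e^{in\pi\tau}e^{2ki\pi\tau}c_k\quad(k\in\mathbb{Z});$$ for every sequence $(c_k)_{k\in\mathbb{Z}}$ with this relation the series converges absolutely at every point of $\mathbb{R}^2$ and the function it defines is quasi-periodic. -/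

import Mathlib

open MeasureTheory Complex
open scoped ContDiff UpperHalfPlane ENNReal

namespace MagneticLattice

noncomputable section

/-! The plane `ℝ²` is identified with `ℂ` through `z = x₁ + i x₂`; `volume` on `ℂ` is the
two-dimensional Lebesgue measure. -/

/-! ### The lattice, its cell and the quasi-periodic boundary condition -/

/-- `t ∧ x = t₁ x₂ - t₂ x₁`. -/
def wedge (t x : ℂ) : ℝ := t.re * x.im - t.im * x.re

/-- The length `r = (2π / Im τ)^{1/2}`; the lattice is spanned by `r` and `r τ`. -/
def scale (τ : ℍ) : ℝ := √(2 * Real.pi / τ.im)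

/-- The first basis vector of the lattice. -/
def basis₁ (τ : ℍ) : ℂ := (scale τ : ℂ)

/-- The second basis vector of the lattice. -/
def basis₂ (τ : ℍ) : ℂ := (scale τ : ℂ) * (τ : ℂ)

/-- The first coordinate of `x` in the basis `r, r τ`. -/
def coord₁ (τ : ℍ) (x : ℂ) : ℝ := (x.re - x.im / τ.im * τ.re) / scale τ

/-- The second coordinate of `x` in the basis `r, r τ`. -/
def coord₂ (τ : ℍ) (x : ℂ) : ℝ := x.im / (scale τ * τ.im)

/-- The primitive cell: the half-open parallelogram spanned by `r` and `r τ`. -/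
def cell (τ : ℍ) : Set ℂ :=
  {x | ∃ s ∈ Set.Ico (0 : ℝ) 1, ∃ t ∈ Set.Ico (0 : ℝ) 1, x = s * basis₁ τ + t * basis₂ τ}

/-- The boundary condition `ψ(x + t) = exp((i n / 2) t ∧ x) ψ(x)` for `t = r` and `t = r τ`. -/
def IsQuasiPeriodic (τ : ℍ) (n : ℕ) (ψ : ℂ → ℂ) : Prop :=
  ∀ t ∈ ({basis₁ τ, basis₂ τ} : Set ℂ), ∀ x : ℂ,
    ψ (x + t) = Complex.exp (I * (n / 2 : ℂ) * (wedge t x : ℂ)) * ψ x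

/-- The lattice vector `T` for which `x - T` lies in the cell. -/
def latticePart (τ : ℍ) (x : ℂ) : ℂ :=
  (⌊coord₁ τ x⌋ : ℂ) * basis₁ τ + (⌊coord₂ τ x⌋ : ℂ) * basis₂ τ

/-- The quasi-periodic extension to the plane of (the restriction to the cell of) `f`; see
`qpExt_isQuasiPeriodic` and `qpExt_eq`. -/
def qpExt (τ : ℍ) (n : ℕ) (f : ℂ → ℂ) (x : ℂ) : ℂ :=
  Complex.exp (I * ((n / 2 : ℂ) * (wedge (latticePart τ x) x : ℂ)
    + Real.pi * n * ⌊coord₁ τ x⌋ * ⌊coord₂ τ x⌋)) * f (x - latticePart τ x)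

lemma scale_pos (τ : ℍ) : 0 < scale τ :=
  Real.sqrt_pos.2 (div_pos (by positivity) τ.im_pos)

lemma scale_sq (τ : ℍ) : scale τ ^ 2 * τ.im = 2 * Real.pi := by
  have h := τ.im_pos
  unfold scale
  rw [Real.sq_sqrt (by positivity)]
  field_simp

lemma eq_coord (τ : ℍ) (x : ℂ) :
    x = (coord₁ τ x : ℂ) * basis₁ τ + (coord₂ τ x : ℂ) * basis₂ τ := by
  have h := τ.im_pos.ne'
  have h' := (scale_pos τ).ne'
  apply Complex.ext
  · simp [basis₁, basis₂]
    unfold coord₁ coord₂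
    field_simp
    ring
  · simp [basis₁, basis₂]
    unfold coord₂
    field_simp

lemma coord₁_lin (τ : ℍ) (s t : ℝ) : coord₁ τ (s * basis₁ τ + t * basis₂ τ) = s := by
  have h := τ.im_pos.ne'
  have h' := (scale_pos τ).ne'
  simp [coord₁, basis₁, basis₂]
  field_simp
  ring

lemma coord₂_lin (τ : ℍ) (s t : ℝ) : coord₂ τ (s * basis₁ τ + t * basis₂ τ) = t := by
  have h := τ.im_pos.ne'
  have h' := (scale_pos τ).ne'
  simp [coord₂, basis₁, basis₂]
  field_simp

lemma mem_cell_iff (τ : ℍ) (x : ℂ) :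
    x ∈ cell τ ↔ coord₁ τ x ∈ Set.Ico (0 : ℝ) 1 ∧ coord₂ τ x ∈ Set.Ico (0 : ℝ) 1 := by
  constructor
  · rintro ⟨s, hs, t, ht, rfl⟩
    rw [coord₁_lin, coord₂_lin]
    exact ⟨hs, ht⟩
  · rintro ⟨h1, h2⟩
    exact ⟨_, h1, _, h2, eq_coord τ x⟩

lemma measurableSet_cell (τ : ℍ) : MeasurableSet (cell τ) := by
  have h : cell τ = coord₁ τ ⁻¹' Set.Ico (0 : ℝ) 1 ∩ coord₂ τ ⁻¹' Set.Ico (0 : ℝ) 1 := by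
    ext x; exact mem_cell_iff τ x
  rw [h]
  have h1 : Continuous (coord₁ τ) := by unfold coord₁; fun_prop
  have h2 : Continuous (coord₂ τ) := by unfold coord₂; fun_prop
  exact (h1.measurable measurableSet_Ico).inter (h2.measurable measurableSet_Ico)

lemma sub_latticePart_mem (τ : ℍ) (x : ℂ) : x - latticePart τ x ∈ cell τ := by
  refine ⟨Int.fract (coord₁ τ x), ⟨Int.fract_nonneg _, Int.fract_lt_one _⟩,
    Int.fract (coord₂ τ x), ⟨Int.fract_nonneg _, Int.fract_lt_one _⟩, ?_⟩
  have h := eq_coord τ x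
  simp only [Int.fract, latticePart]
  push_cast
  linear_combination h

/-- On the cell the extension is the given function. -/
theorem qpExt_eq (τ : ℍ) (n : ℕ) (f : ℂ → ℂ) {x : ℂ} (hx : x ∈ cell τ) :
    qpExt τ n f x = f x := by
  obtain ⟨h1, h2⟩ := (mem_cell_iff τ x).1 hx
  have e1 : ⌊coord₁ τ x⌋ = 0 := Int.floor_eq_zero_iff.2 h1
  have e2 : ⌊coord₂ τ x⌋ = 0 := Int.floor_eq_zero_iff.2 h2
  simp [qpExt, latticePart, e1, e2, wedge]

lemma wedge_basis (τ : ℍ) : wedge (basis₁ τ) (basis₂ τ) = 2 * Real.pi := by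
  rw [← scale_sq τ]
  simp [wedge, basis₁, basis₂]
  ring

/-- The extension satisfies the quasi-periodic boundary condition. -/
theorem qpExt_isQuasiPeriodic (τ : ℍ) (n : ℕ) (f : ℂ → ℂ) :
    IsQuasiPeriodic τ n (qpExt τ n f) := by
  have hw : ∀ s t s' t' : ℝ, wedge (s * basis₁ τ + t * basis₂ τ) (s' * basis₁ τ + t' * basis₂ τ)
      = (s * t' - t * s') * (2 * Real.pi) := by
    intro s t s' t'
    rw [← wedge_basis τ]
    simp [wedge, basis₁, basis₂]
    ring
  intro t ht x
  obtain ⟨s, u, hx⟩ : ∃ s u : ℝ, x = s * basis₁ τ + u * basis₂ τ := ⟨_, _, eq_coord τ x⟩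
  have key : ∀ a b : ℤ, ∀ s u : ℝ, ⌊s⌋ = a → ⌊u⌋ = b →
      qpExt τ n f (s * basis₁ τ + u * basis₂ τ) =
      Complex.exp (I * (n * Real.pi * (a * u - b * s + a * b))) *
        f ((s - a : ℝ) * basis₁ τ + (u - b : ℝ) * basis₂ τ) := by
    intro a b s u ha hb
    have := hw a b s u
    simp only [qpExt, latticePart, coord₁_lin, coord₂_lin, ha, hb]
    push_cast at this ⊢
    rw [this]
    push_cast
    congr 2
    · ring
    · ring
  rcases ht with rfl | ht
  · have e : x + basis₁ τ = ((s + 1 : ℝ) : ℂ) * basis₁ τ + (u : ℂ) * basis₂ τ := by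
      rw [hx]; push_cast; ring
    have w := hw 1 0 s u
    rw [e, key (⌊s⌋ + 1) ⌊u⌋ _ _ (by simp) rfl, hx, key ⌊s⌋ ⌊u⌋ s u rfl rfl]
    conv_rhs => rw [← mul_assoc]
    simp only [ofReal_one, one_mul, ofReal_zero, zero_mul, add_zero] at w
    rw [w, ← Complex.exp_add]
    congr 2
    · push_cast; ring
    · push_cast; ring
  · rw [Set.mem_singleton_iff] at ht
    subst ht
    have e : x + basis₂ τ = (s : ℂ) * basis₁ τ + ((u + 1 : ℝ) : ℂ) * basis₂ τ := by
      rw [hx]; push_cast; ring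
    have w := hw 0 1 s u
    rw [e, key ⌊s⌋ (⌊u⌋ + 1) _ _ rfl (by simp), hx, key ⌊s⌋ ⌊u⌋ s u rfl rfl]
    conv_rhs => rw [← mul_assoc]
    simp only [ofReal_one, one_mul, ofReal_zero, zero_mul, zero_add] at w
    rw [w, ← Complex.exp_add]
    congr 1
    · apply Complex.exp_eq_exp_iff_exists_int.2
      refine ⟨n * ⌊s⌋, ?_⟩
      push_cast; ring
    · push_cast; congr 2; ring

/-- The extension only depends on the almost everywhere class on the cell. -/
lemma qpExt_congr (τ : ℍ) (n : ℕ) {f g : ℂ → ℂ}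
    (h : f =ᵐ[volume.restrict (cell τ)] g) : qpExt τ n f =ᵐ[volume] qpExt τ n g := by
  rw [Filter.EventuallyEq, ae_restrict_iff' (measurableSet_cell τ)] at h
  have h' : ∀ᵐ x : ℂ, ∀ p : ℤ × ℤ,
      x - ((p.1 : ℂ) * basis₁ τ + (p.2 : ℂ) * basis₂ τ) ∈ cell τ →
      f (x - ((p.1 : ℂ) * basis₁ τ + (p.2 : ℂ) * basis₂ τ)) =
      g (x - ((p.1 : ℂ) * basis₁ τ + (p.2 : ℂ) * basis₂ τ)) := by
    rw [ae_all_iff]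
    intro p
    exact (measurePreserving_sub_right volume _).quasiMeasurePreserving.ae h
  filter_upwards [h'] with x hx
  have := hx (⌊coord₁ τ x⌋, ⌊coord₂ τ x⌋) (sub_latticePart_mem τ x)
  simp only [qpExt]
  congr 1

lemma qpExt_add (τ : ℍ) (n : ℕ) (f g : ℂ → ℂ) :
    qpExt τ n (f + g) = qpExt τ n f + qpExt τ n g := by
  ext x; simp [qpExt, mul_add]

lemma qpExt_smul (τ : ℍ) (n : ℕ) (c : ℂ) (f : ℂ → ℂ) :
    qpExt τ n (c • f) = c • qpExt τ n f := by
  ext x; simp [qpExt]; ring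

/-! ### Weak derivatives, `H²_loc` -/

/-- `g` is the weak derivative of `f` on the plane in the direction `v`. -/
def HasWeakDeriv (v : ℂ) (f g : ℂ → ℂ) : Prop :=
  LocallyIntegrable f ∧ LocallyIntegrable g ∧
    ∀ φ : ℂ → ℝ, ContDiff ℝ ∞ φ → HasCompactSupport φ →
      ∫ x, fderiv ℝ φ x v • f x = -∫ x, φ x • g x

/-- The coordinate directions. -/
def dir : Fin 2 → ℂ := ![1, I]

open Classical in
/-- The weak partial derivative `∂f/∂x_j` (zero if there is none). -/
def weakDeriv (j : Fin 2) (f : ℂ → ℂ) : ℂ → ℂ :=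
  if h : ∃ g, HasWeakDeriv (dir j) f g then h.choose else 0

/-- `f ∈ L²_loc`. -/
def MemL2Loc (f : ℂ → ℂ) : Prop := ∀ K : Set ℂ, IsCompact K → MemLp f 2 (volume.restrict K)

/-- `f ∈ H²_loc`: `f` and its weak partial derivatives of order one and two are in `L²_loc`. -/
def MemH2Loc (f : ℂ → ℂ) : Prop :=
  MemL2Loc f ∧ ∃ g : Fin 2 → ℂ → ℂ, ∃ h : Fin 2 → Fin 2 → ℂ → ℂ,
    (∀ j, MemL2Loc (g j) ∧ HasWeakDeriv (dir j) f (g j)) ∧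
    ∀ j k, MemL2Loc (h j k) ∧ HasWeakDeriv (dir k) (g j) (h j k)

/-! ### The magnetic Laplacian on functions -/

/-- The vector potential `A(x) = (n/2) (-x₂, x₁)`. -/
def potential (n : ℕ) : Fin 2 → ℂ → ℝ := ![fun x => -(n / 2 : ℝ) * x.im, fun x => (n / 2 : ℝ) * x.re]

/-- The covariant gradient `∇_A f = ∇f - i A f`. -/
def covGrad (n : ℕ) (f : ℂ → ℂ) (j : Fin 2) (x : ℂ) : ℂ :=
  weakDeriv j f x - I * potential n j x * f x

/-- The formal adjoint `∇_A^* F = -div F + i A · F`. -/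
def covGradAdjoint (n : ℕ) (F : Fin 2 → ℂ → ℂ) (x : ℂ) : ℂ :=
  -(∑ j, weakDeriv j (F j) x) + I * ∑ j, potential n j x * F j x

/-- `-Δ_A f = ∇_A^* ∇_A f`. -/
def negMagneticLaplacian (n : ℕ) (f : ℂ → ℂ) : ℂ → ℂ := covGradAdjoint n (covGrad n f)

lemma HasWeakDeriv.congr {v : ℂ} {f f' g g' : ℂ → ℂ} (h : HasWeakDeriv v f g)
    (hf : f =ᵐ[volume] f') (hg : g =ᵐ[volume] g') : HasWeakDeriv v f' g' := by
  refine ⟨h.1.congr hf, h.2.1.congr hg, fun φ h1 h2 => ?_⟩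
  have e1 : ∫ x, fderiv ℝ φ x v • f' x = ∫ x, fderiv ℝ φ x v • f x :=
    integral_congr_ae (by filter_upwards [hf] with x hx; rw [hx])
  have e2 : ∫ x, φ x • g' x = ∫ x, φ x • g x :=
    integral_congr_ae (by filter_upwards [hg] with x hx; rw [hx])
  rw [e1, e2, h.2.2 φ h1 h2]

lemma integrable_test {φ : ℂ → ℝ} (h1 : Continuous φ) (h2 : HasCompactSupport φ) {f : ℂ → ℂ}
    (hf : LocallyIntegrable f) : Integrable (fun x => φ x • f x) :=
  hf.integrable_smul_left_of_hasCompactSupport h1 h2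

lemma continuous_dtest {φ : ℂ → ℝ} (h1 : ContDiff ℝ ∞ φ) (v : ℂ) :
    Continuous fun x => fderiv ℝ φ x v :=
  (h1.continuous_fderiv (by simp)).clm_apply continuous_const

lemma compact_dtest {φ : ℂ → ℝ} (h2 : HasCompactSupport φ) (v : ℂ) :
    HasCompactSupport fun x => fderiv ℝ φ x v :=
  h2.fderiv_apply (𝕜 := ℝ) v

lemma HasWeakDeriv.add {v : ℂ} {f f' g g' : ℂ → ℂ} (h : HasWeakDeriv v f g)
    (h' : HasWeakDeriv v f' g') : HasWeakDeriv v (f + f') (g + g') := by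
  refine ⟨h.1.add h'.1, h.2.1.add h'.2.1, fun φ h1 h2 => ?_⟩
  have c1 := continuous_dtest h1 v
  have c2 := compact_dtest h2 v
  simp only [Pi.add_apply, smul_add]
  rw [integral_add (integrable_test c1 c2 h.1) (integrable_test c1 c2 h'.1),
    integral_add (integrable_test h1.continuous h2 h.2.1)
      (integrable_test h1.continuous h2 h'.2.1), h.2.2 φ h1 h2, h'.2.2 φ h1 h2]
  ring

lemma HasWeakDeriv.const_smul {v : ℂ} {f g : ℂ → ℂ} (h : HasWeakDeriv v f g) (c : ℂ) :
    HasWeakDeriv v (c • f) (c • g) := by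
  refine ⟨h.1.smul c, h.2.1.smul c, fun φ h1 h2 => ?_⟩
  simp only [Pi.smul_apply, smul_comm _ c]
  rw [integral_smul, integral_smul, h.2.2 φ h1 h2, smul_neg]

lemma HasWeakDeriv.unique {v : ℂ} {f g g' : ℂ → ℂ} (h : HasWeakDeriv v f g)
    (h' : HasWeakDeriv v f g') : g =ᵐ[volume] g' := by
  have := ae_eq_zero_of_integral_contDiff_smul_eq_zero (μ := volume) (h.2.1.sub h'.2.1) (by
    intro φ h1 h2
    simp only [Pi.sub_apply, smul_sub]
    rw [integral_sub (integrable_test h1.continuous h2 h.2.1)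
      (integrable_test h1.continuous h2 h'.2.1), sub_eq_zero, ← neg_inj,
      ← h.2.2 φ h1 h2, ← h'.2.2 φ h1 h2])
  filter_upwards [this] with x hx
  exact sub_eq_zero.1 hx

lemma locallyIntegrable_mul {a : ℂ → ℝ} (ha : Continuous a) {f : ℂ → ℂ}
    (hf : LocallyIntegrable f) : LocallyIntegrable (fun x => (a x : ℂ) * f x) := by
  rw [locallyIntegrable_iff] at hf ⊢
  intro K hK
  exact (hf K hK).continuousOn_mul (continuous_ofReal.comp ha).continuousOn hK

lemma HasWeakDeriv.mul {v : ℂ} {f g : ℂ → ℂ} (h : HasWeakDeriv v f g) {a : ℂ → ℝ}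
    (ha : ContDiff ℝ ∞ a) :
    HasWeakDeriv v (fun x => (a x : ℂ) * f x)
      ((fun x => (a x : ℂ) * g x) + fun x => (fderiv ℝ a x v : ℂ) * f x) := by
  have ha' := continuous_dtest ha v
  refine ⟨locallyIntegrable_mul ha.continuous h.1,
    (locallyIntegrable_mul ha.continuous h.2.1).add (locallyIntegrable_mul ha' h.1),
    fun φ h1 h2 => ?_⟩
  have key := h.2.2 (fun x => φ x * a x) (h1.mul ha) h2.mul_right
  have e : ∀ x, fderiv ℝ (fun x => φ x * a x) x v = φ x * fderiv ℝ a x v + a x * fderiv ℝ φ x v := by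
    intro x
    rw [fderiv_fun_mul (h1.differentiable (by simp) x) (ha.differentiable (by simp) x)]
    simp
  simp only [e, Pi.add_apply, smul_add, add_smul] at key ⊢
  have i1 : Integrable fun x => (φ x * fderiv ℝ a x v) • f x :=
    integrable_test (h1.continuous.mul ha') h2.mul_right h.1
  have i2 : Integrable fun x => (a x * fderiv ℝ φ x v) • f x :=
    integrable_test (ha.continuous.mul (continuous_dtest h1 v)) (compact_dtest h2 v).mul_left h.1
  rw [integral_add i1 i2] at key
  rw [integral_add (integrable_test h1.continuous h2 (locallyIntegrable_mul ha.continuous h.2.1))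
    (integrable_test h1.continuous h2 (locallyIntegrable_mul ha' h.1))]
  have e1 : ∀ x, fderiv ℝ φ x v • ((a x : ℂ) * f x) = (a x * fderiv ℝ φ x v) • f x := by
    intro x; simp only [real_smul]; push_cast; ring
  have e2 : ∀ x, φ x • ((a x : ℂ) * g x) = (φ x * a x) • g x := by
    intro x; simp only [real_smul]; push_cast; ring
  have e3 : ∀ x, φ x • ((fderiv ℝ a x v : ℂ) * f x) = (φ x * fderiv ℝ a x v) • f x := by
    intro x; simp only [real_smul]; push_cast; ring
  simp only [e1, e2, e3]
  rw [← eq_sub_iff_add_eq'] at key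
  rw [key]
  ring

/-- `weakDeriv` is the weak derivative whenever there is one. -/
lemma HasWeakDeriv.weakDeriv_ae {j : Fin 2} {f g : ℂ → ℂ} (h : HasWeakDeriv (dir j) f g) :
    weakDeriv j f =ᵐ[volume] g := by
  have h' : ∃ g, HasWeakDeriv (dir j) f g := ⟨g, h⟩
  rw [weakDeriv, dif_pos h']
  exact h'.choose_spec.unique h

lemma contDiff_potential (n : ℕ) (j : Fin 2) : ContDiff ℝ ∞ (potential n j) := by
  fin_cases j
  · exact contDiff_const.mul imCLM.contDiff
  · exact contDiff_const.mul reCLM.contDiff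

lemma fderiv_potential (n : ℕ) (j : Fin 2) (x : ℂ) : fderiv ℝ (potential n j) x (dir j) = 0 := by
  fin_cases j
  · have : HasFDerivAt (potential n 0) (-(n / 2 : ℝ) • imCLM) x :=
      (imCLM.hasFDerivAt (x := x)).const_mul (-(n / 2 : ℝ))
    simp [this.fderiv, dir]
  · have : HasFDerivAt (potential n 1) ((n / 2 : ℝ) • reCLM) x :=
      (reCLM.hasFDerivAt (x := x)).const_mul (n / 2 : ℝ)
    simp [this.fderiv, dir]

/-- The expanded form of `-Δ_A`. -/
lemma negMagneticLaplacian_ae (n : ℕ) {f : ℂ → ℂ} {g : Fin 2 → ℂ → ℂ} {h : Fin 2 → ℂ → ℂ}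
    (hg : ∀ j, HasWeakDeriv (dir j) f (g j)) (hh : ∀ j, HasWeakDeriv (dir j) (g j) (h j)) :
    negMagneticLaplacian n f =ᵐ[volume] fun x =>
      ∑ j, (-h j x + 2 * I * ((potential n j x : ℂ) * g j x)
        + (potential n j x : ℂ) * ((potential n j x : ℂ) * f x)) := by
  have hc : ∀ j, covGrad n f j =ᵐ[volume]
      (g j + (-I) • fun x => (potential n j x : ℂ) * f x) := by
    intro j
    filter_upwards [(hg j).weakDeriv_ae] with x hx
    simp only [covGrad, hx, Pi.add_apply, Pi.smul_apply, smul_eq_mul]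
    ring
  have hd : ∀ j, weakDeriv j (covGrad n f j) =ᵐ[volume]
      (h j + (-I) • ((fun x => (potential n j x : ℂ) * g j x)
        + fun x => (fderiv ℝ (potential n j) x (dir j) : ℂ) * f x)) := by
    intro j
    refine HasWeakDeriv.weakDeriv_ae ?_
    exact ((hh j).add (((hg j).mul (contDiff_potential n j)).const_smul (-I))).congr
      (hc j).symm (Filter.EventuallyEq.refl _ _)
  filter_upwards [hc 0, hc 1, hd 0, hd 1] with x c0 c1 d0 d1
  simp only [negMagneticLaplacian, covGradAdjoint, Fin.sum_univ_two, c0, c1, d0, d1]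
  simp only [Pi.add_apply, Pi.smul_apply, smul_eq_mul, fderiv_potential, ofReal_zero]
  ring_nf
  simp only [I_sq]
  ring

lemma MemL2Loc.congr {f g : ℂ → ℂ} (h : MemL2Loc f) (e : f =ᵐ[volume] g) : MemL2Loc g :=
  fun K hK => (h K hK).ae_eq (ae_restrict_of_ae e)

lemma MemL2Loc.add {f g : ℂ → ℂ} (h : MemL2Loc f) (h' : MemL2Loc g) : MemL2Loc (f + g) :=
  fun K hK => (h K hK).add (h' K hK)

lemma MemL2Loc.const_smul {f : ℂ → ℂ} (h : MemL2Loc f) (c : ℂ) : MemL2Loc (c • f) :=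
  fun K hK => (h K hK).const_smul c

lemma MemL2Loc.mul {a : ℂ → ℝ} (ha : Continuous a) {f : ℂ → ℂ} (h : MemL2Loc f) :
    MemL2Loc fun x => (a x : ℂ) * f x := by
  intro K hK
  obtain ⟨C, hC⟩ := hK.exists_bound_of_continuousOn ha.continuousOn
  refine (h K hK).of_le_mul (c := C)
    ((continuous_ofReal.comp ha).aestronglyMeasurable.mul (h K hK).1) ?_
  filter_upwards [ae_restrict_mem hK.measurableSet] with x hx
  rw [norm_mul, norm_real]
  exact mul_le_mul_of_nonneg_right (hC x hx) (norm_nonneg _)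

lemma MemH2Loc.congr {f f' : ℂ → ℂ} (h : MemH2Loc f) (e : f =ᵐ[volume] f') : MemH2Loc f' := by
  obtain ⟨h0, g, k, hg, hk⟩ := h
  exact ⟨h0.congr e, g, k, fun j => ⟨(hg j).1, (hg j).2.congr e (Filter.EventuallyEq.refl _ _)⟩, hk⟩

lemma MemH2Loc.add {f f' : ℂ → ℂ} (h : MemH2Loc f) (h' : MemH2Loc f') : MemH2Loc (f + f') := by
  obtain ⟨h0, g, k, hg, hk⟩ := h
  obtain ⟨h0', g', k', hg', hk'⟩ := h'
  exact ⟨h0.add h0', fun j => g j + g' j, fun j l => k j l + k' j l,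
    fun j => ⟨(hg j).1.add (hg' j).1, (hg j).2.add (hg' j).2⟩,
    fun j l => ⟨(hk j l).1.add (hk' j l).1, (hk j l).2.add (hk' j l).2⟩⟩

lemma MemH2Loc.const_smul {f : ℂ → ℂ} (h : MemH2Loc f) (c : ℂ) : MemH2Loc (c • f) := by
  obtain ⟨h0, g, k, hg, hk⟩ := h
  exact ⟨h0.const_smul c, fun j => c • g j, fun j l => c • k j l,
    fun j => ⟨(hg j).1.const_smul c, (hg j).2.const_smul c⟩,
    fun j l => ⟨(hk j l).1.const_smul c, (hk j l).2.const_smul c⟩⟩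

lemma hasWeakDeriv_zero (v : ℂ) : HasWeakDeriv v 0 0 :=
  ⟨locallyIntegrable_zero, locallyIntegrable_zero, fun φ _ _ => by simp⟩

lemma memL2Loc_zero : MemL2Loc 0 := fun _ _ => MemLp.zero

lemma memH2Loc_zero : MemH2Loc 0 :=
  ⟨memL2Loc_zero, 0, 0, fun _ => ⟨memL2Loc_zero, hasWeakDeriv_zero _⟩,
    fun _ _ => ⟨memL2Loc_zero, hasWeakDeriv_zero _⟩⟩

lemma negMagneticLaplacian_congr (n : ℕ) {f f' : ℂ → ℂ} (h : MemH2Loc f)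
    (e : f =ᵐ[volume] f') : negMagneticLaplacian n f =ᵐ[volume] negMagneticLaplacian n f' := by
  obtain ⟨h0, g, k, hg, hk⟩ := h
  refine (negMagneticLaplacian_ae n (fun j => (hg j).2) (fun j => (hk j j).2)).trans
    (Filter.EventuallyEq.trans ?_ (negMagneticLaplacian_ae n
      (fun j => (hg j).2.congr e (Filter.EventuallyEq.refl _ _)) (fun j => (hk j j).2)).symm)
  filter_upwards [e] with x hx
  simp only [hx]

lemma negMagneticLaplacian_add (n : ℕ) {f f' : ℂ → ℂ} (h : MemH2Loc f) (h' : MemH2Loc f') :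
    negMagneticLaplacian n (f + f') =ᵐ[volume]
      negMagneticLaplacian n f + negMagneticLaplacian n f' := by
  obtain ⟨h0, g, k, hg, hk⟩ := h
  obtain ⟨h0', g', k', hg', hk'⟩ := h'
  filter_upwards [negMagneticLaplacian_ae n (fun j => (hg j).2) (fun j => (hk j j).2),
    negMagneticLaplacian_ae n (fun j => (hg' j).2) (fun j => (hk' j j).2),
    negMagneticLaplacian_ae n (fun j => (hg j).2.add (hg' j).2)
      (fun j => (hk j j).2.add (hk' j j).2)] with x e1 e2 e3
  simp only [Pi.add_apply, e1, e2, e3, Fin.sum_univ_two]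
  ring

lemma negMagneticLaplacian_smul (n : ℕ) (c : ℂ) {f : ℂ → ℂ} (h : MemH2Loc f) :
    negMagneticLaplacian n (c • f) =ᵐ[volume] c • negMagneticLaplacian n f := by
  obtain ⟨h0, g, k, hg, hk⟩ := h
  filter_upwards [negMagneticLaplacian_ae n (fun j => (hg j).2) (fun j => (hk j j).2),
    negMagneticLaplacian_ae n (fun j => (hg j).2.const_smul c)
      (fun j => (hk j j).2.const_smul c)] with x e1 e2
  simp only [Pi.smul_apply, smul_eq_mul, e1, e2, Fin.sum_univ_two]
  ring

lemma MemH2Loc.negMagneticLaplacian (n : ℕ) {f : ℂ → ℂ} (h : MemH2Loc f) :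
    MemL2Loc (negMagneticLaplacian n f) := by
  obtain ⟨h0, g, k, hg, hk⟩ := h
  refine MemL2Loc.congr ?_
    (negMagneticLaplacian_ae n (fun j => (hg j).2) (fun j => (hk j j).2)).symm
  have hc := fun j => (contDiff_potential n j).continuous
  have hj : ∀ j, MemL2Loc (((-1 : ℂ) • k j j +
      (2 * I) • fun x => (potential n j x : ℂ) * g j x) +
      fun x => (potential n j x : ℂ) * ((potential n j x : ℂ) * f x)) := fun j =>
    (((hk j j).1.const_smul _).add ((MemL2Loc.mul (hc j) (hg j).1).const_smul _)).add
      (MemL2Loc.mul (hc j) (MemL2Loc.mul (hc j) h0))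
  refine ((hj 0).add (hj 1)).congr (Filter.Eventually.of_forall fun x => ?_)
  simp [Fin.sum_univ_two]

lemma MemL2Loc.memLp_cell {f : ℂ → ℂ} (h : MemL2Loc f) (τ : ℍ) :
    MemLp f 2 (volume.restrict (cell τ)) := by
  refine (h (Metric.closedBall 0 (‖basis₁ τ‖ + ‖basis₂ τ‖)) (isCompact_closedBall _ _)).mono_measure
    (Measure.restrict_mono ?_ le_rfl)
  rintro x ⟨s, hs, t, ht, rfl⟩
  rw [mem_closedBall_zero_iff]
  refine (norm_add_le _ _).trans (add_le_add ?_ ?_)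
  · rw [norm_mul, norm_real, Real.norm_of_nonneg hs.1]
    exact mul_le_of_le_one_left (norm_nonneg _) hs.2.le
  · rw [norm_mul, norm_real, Real.norm_of_nonneg ht.1]
    exact mul_le_of_le_one_left (norm_nonneg _) ht.2.le

/-! ### The Hilbert space and the operator -/

/-- The complex Hilbert space `L²` of the cell. An element is identified with its quasi-periodic
extension to the plane. -/
abbrev CellL2 (τ : ℍ) : Type := Lp ℂ 2 (volume.restrict (cell τ))

/-- The (classes of) smooth functions on the plane that satisfy the quasi-periodic boundary
condition, restricted to the cell. -/
def smoothQuasiPeriodic (τ : ℍ) (n : ℕ) : Submodule ℂ (CellL2 τ) where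
  carrier := {ψ | ∃ f : ℂ → ℂ, ContDiff ℝ ∞ f ∧ IsQuasiPeriodic τ n f ∧
    ψ =ᵐ[volume.restrict (cell τ)] f}
  zero_mem' := ⟨0, contDiff_const, fun _ _ _ => by simp, Lp.coeFn_zero _ _ _⟩
  add_mem' := by
    rintro ψ φ ⟨f, hf, qf, ef⟩ ⟨g, hg, qg, eg⟩
    refine ⟨f + g, hf.add hg, fun t ht x => ?_, (Lp.coeFn_add ψ φ).trans (ef.add eg)⟩
    simp only [Pi.add_apply, qf t ht x, qg t ht x, mul_add]
  smul_mem' := by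
    rintro c ψ ⟨f, hf, qf, ef⟩
    refine ⟨c • f, contDiff_const.smul hf, fun t ht x => ?_,
      (Lp.coeFn_smul c ψ).trans (ef.const_smul c)⟩
    simp only [Pi.smul_apply, smul_eq_mul, qf t ht x]
    ring

lemma qpExt_coe_add (τ : ℍ) (n : ℕ) (ψ φ : CellL2 τ) :
    qpExt τ n (ψ + φ : CellL2 τ) =ᵐ[volume] qpExt τ n ψ + qpExt τ n φ := by
  rw [← qpExt_add]; exact qpExt_congr τ n (Lp.coeFn_add ψ φ)

lemma qpExt_coe_smul (τ : ℍ) (n : ℕ) (c : ℂ) (ψ : CellL2 τ) :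
    qpExt τ n (c • ψ : CellL2 τ) =ᵐ[volume] c • qpExt τ n ψ := by
  rw [← qpExt_smul]; exact qpExt_congr τ n (Lp.coeFn_smul c ψ)

/-- The Sobolev space `H²` of quasi-periodic functions, as a subspace of `L²`. -/
def quasiPeriodicH2 (τ : ℍ) (n : ℕ) : Submodule ℂ (CellL2 τ) where
  carrier := {ψ | MemH2Loc (qpExt τ n ψ)}
  zero_mem' := by
    refine memH2Loc_zero.congr ?_
    refine Filter.EventuallyEq.trans ?_ (qpExt_congr τ n (Lp.coeFn_zero _ _ _).symm)
    exact Filter.Eventually.of_forall fun x => by simp [qpExt]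
  add_mem' := fun {ψ φ} h h' => (MemH2Loc.add h h').congr (qpExt_coe_add τ n ψ φ).symm
  smul_mem' := fun c ψ h => (MemH2Loc.const_smul h c).congr (qpExt_coe_smul τ n c ψ).symm

/-- The operator `L^n = -Δ_A` on `L²` with domain the quasi-periodic `H²` space: it maps `ψ` to
(the restriction to the cell of) `-Δ_A` of the quasi-periodic extension of `ψ`. -/
def magneticOperator (τ : ℍ) (n : ℕ) : CellL2 τ →ₗ.[ℂ] CellL2 τ where
  domain := quasiPeriodicH2 τ n
  toFun :=
    { toFun := fun ψ => MemLp.toLp (negMagneticLaplacian n (qpExt τ n (ψ : CellL2 τ)))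
        ((MemH2Loc.negMagneticLaplacian n ψ.2).memLp_cell τ)
      map_add' := by
        intro ψ φ
        rw [← MemLp.toLp_add, MemLp.toLp_eq_toLp_iff]
        refine ae_restrict_of_ae ?_
        exact (negMagneticLaplacian_congr n (ψ + φ).2 (qpExt_coe_add τ n ψ φ)).trans
          (negMagneticLaplacian_add n ψ.2 φ.2)
      map_smul' := by
        intro c ψ
        rw [RingHom.id_apply, ← MemLp.toLp_const_smul, MemLp.toLp_eq_toLp_iff]
        refine ae_restrict_of_ae ?_
        exact (negMagneticLaplacian_congr n (c • ψ).2 (qpExt_coe_smul τ n c ψ)).trans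
          (negMagneticLaplacian_smul n c ψ.2) }

/-! ### Spectrum and eigenspaces of an unbounded operator -/

/-- `z` is in the resolvent set of `T`: `T - z` is a bijection from the domain of `T` onto the
space, with bounded inverse. -/
def InResolventSet {E : Type*} [NormedAddCommGroup E] [NormedSpace ℂ E] (T : E →ₗ.[ℂ] E)
    (z : ℂ) : Prop :=
  ∃ R : E →L[ℂ] E,
    (∀ y : E, ∃ h : R y ∈ T.domain, T ⟨R y, h⟩ - z • R y = y) ∧
    ∀ x : T.domain, R (T x - z • (x : E)) = x

/-- The spectrum of an unbounded operator. -/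
def unboundedSpectrum {E : Type*} [NormedAddCommGroup E] [NormedSpace ℂ E]
    (T : E →ₗ.[ℂ] E) : Set ℂ := {z | ¬ InResolventSet T z}

/-- `null (T - z)`. -/
def nullSpace {E : Type*} [NormedAddCommGroup E] [NormedSpace ℂ E] (T : E →ₗ.[ℂ] E)
    (z : ℂ) : Submodule ℂ E :=
  (LinearMap.ker (T.toFun - z • T.domain.subtype)).map T.domain.subtype

/-! ### The theta-type series -/

/-- The coefficient relation `c_{k+n} = e^{i n π τ} e^{2 k i π τ} c_k`. -/
def ThetaRelation (τ : ℍ) (n : ℕ) (c : ℤ → ℂ) : Prop :=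
  ∀ k : ℤ, c (k + n) =
    Complex.exp (I * n * Real.pi * τ) * Complex.exp (2 * k * I * Real.pi * τ) * c k

/-- The terms `c_k e^{k i √(2π Im τ) z}`. -/
def thetaTerm (τ : ℍ) (c : ℤ → ℂ) (z : ℂ) (k : ℤ) : ℂ :=
  c k * Complex.exp (k * I * (√(2 * Real.pi * τ.im) : ℝ) * z)

/-- `e^{(i n / 2) x₂ (x₁ + i x₂)} ∑_k c_k e^{k i √(2π Im τ) (x₁ + i x₂)}`. -/
def thetaSeries (τ : ℍ) (n : ℕ) (c : ℤ → ℂ) (z : ℂ) : ℂ :=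
  Complex.exp (I * (n / 2 : ℂ) * z.im * z) * ∑' k : ℤ, thetaTerm τ c z k

end

end MagneticLattice

/-! The constant magnetic field gives the covariant derivatives the commutator `-(I * n)`
(`cov_comm`), as for a harmonic oscillator. With `up` and `down` equal to ∇₀ ∓ i∇₁ this yields the
factorizations `up_down` and `down_up`. Hence functions killed by `down` have eigenvalue n, each
application of `up` raises the eigenvalue by 2n, and no power of `up` kills a nonzero function of
this kind. The theta series are smooth, quasi-periodic and killed by `down` (`down_theta`). They
form an n-dimensional space, because the coefficient relation says that the quotients by a Gaussian
solution are n-periodic. So each value (2m+1)n has an explicit n-dimensional space of smooth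
eigenfunctions, and different levels are orthogonal.

The main point is completeness (`eq_zero_of_inner_up_pow_theta`). In the independent variables z and
z̄, `up` is 2∂_z conjugated by an exponential, so the iterates of `up` on a theta function are
Taylor coefficients of an entire function of z with z̄ frozen. A function f orthogonal to all levels
is therefore orthogonal to the functions `coherent`, in which z alone is translated. Shifting theta
coefficients by a vector of (1/n) times the lattice, with a matching change of the translation,
multiplies `coherent` by a character of the torus. Thus every Fourier coefficient of the product of
f with the conjugate of `coherent` vanishes, and the product is zero almost everywhere. Varying the
translation moves the zeros of `coherent`, so f = 0.

An orthonormal basis of smooth eigenfunctions now exists. Integration by parts shows that the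
operator acts diagonally on its whole domain. That the domain is maximal follows from a priori
estimates: by the commutator, the graph norm of the Laplacian controls all first and second
covariant derivatives, and weak covariant derivatives are closed in L²
(`isDiagonalIn_magneticOperator`). Self-adjointness, spectrum and null space are then read off the
coefficients. In particular the ground states are identified by completeness, without regularity
theory for weak solutions. -/

namespace MagneticLattice

/-! ### Unbounded operators that are diagonal in a Hilbert basis. -/

section Diagonal

variable {ι H : Type*} [NormedAddCommGroup H] [InnerProductSpace ℂ H]

/-- The operator `T` is diagonal, with maximal domain, in the Hilbert basis `b`. -/
structure IsDiagonalIn (T : H →ₗ.[ℂ] H) (b : HilbertBasis ι ℂ H) (ev : ι → ℝ) : Prop where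
  inner_apply : ∀ (i : ι) (x : T.domain), inner ℂ (b i) (T x) = ev i * inner ℂ (b i) (x : H)
  mem_domain : ∀ u w : H, (∀ i, inner ℂ (b i) w = ev i * inner ℂ (b i) u) → u ∈ T.domain

variable {T : H →ₗ.[ℂ] H} {b : HilbertBasis ι ℂ H} {ev : ι → ℝ}

lemma _root_.HilbertBasis.ext_inner {u w : H} (b : HilbertBasis ι ℂ H)
    (h : ∀ i, inner ℂ (b i) u = inner ℂ (b i) w) : u = w := by
  apply b.repr.injective
  ext i
  simp only [b.repr_apply_apply, h]

lemma _root_.HilbertBasis.inner_smul_self [DecidableEq ι] (b : HilbertBasis ι ℂ H)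
    (ev : ι → ℝ) (i j : ι) :
    inner ℂ (b j) ((ev i : ℂ) • b i) = ev j * inner ℂ (b j) (b i) := by
  rw [inner_smul_right, orthonormal_iff_ite.1 b.orthonormal]
  split_ifs with h
  · rw [h]
  · simp

lemma IsDiagonalIn.apply_eq (hT : IsDiagonalIn T b ev) {u w : H}
    (h : ∀ i, inner ℂ (b i) w = ev i * inner ℂ (b i) u) (hu : u ∈ T.domain) : T ⟨u, hu⟩ = w :=
  b.ext_inner fun i => by rw [hT.inner_apply, h]

lemma IsDiagonalIn.basis_mem (hT : IsDiagonalIn T b ev) (i : ι) : b i ∈ T.domain := by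
  classical
  exact hT.mem_domain _ ((ev i : ℂ) • b i) (b.inner_smul_self ev i)

lemma IsDiagonalIn.apply_basis (hT : IsDiagonalIn T b ev) (i : ι) :
    T ⟨b i, hT.basis_mem i⟩ = (ev i : ℂ) • b i := by
  classical
  exact hT.apply_eq (b.inner_smul_self ev i) _

lemma IsDiagonalIn.dense_domain (hT : IsDiagonalIn T b ev) : Dense (T.domain : Set H) := by
  have h := b.dense_span
  rw [← Submodule.dense_iff_topologicalClosure_eq_top] at h
  refine h.mono ?_
  rw [SetLike.coe_subset_coe, Submodule.span_le]
  rintro _ ⟨i, rfl⟩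
  exact hT.basis_mem i

/-- Symmetry is Parseval with real eigenvalues. Conversely, testing the adjoint against basis
vectors shows that it also multiplies coefficients by `ev`, so maximality of the domain puts every
vector of its domain into `T.domain`. -/
theorem IsDiagonalIn.isSelfAdjoint [CompleteSpace H] (hT : IsDiagonalIn T b ev) : IsSelfAdjoint T := by
  have hd := hT.dense_domain
  have hsymm : T.IsFormalAdjoint T := by
    intro x y
    rw [← b.tsum_inner_mul_inner, ← b.tsum_inner_mul_inner]
    congr 1
    ext i
    rw [hT.inner_apply, ← inner_conj_symm, hT.inner_apply, map_mul, inner_conj_symm, conj_ofReal]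
    ring
  have hle := hsymm.le_adjoint hd
  rw [LinearPMap.isSelfAdjoint_def]
  refine (LinearPMap.eq_of_le_of_domain_eq hle (le_antisymm hle.1 fun y hy => ?_)).symm
  refine hT.mem_domain y (T.adjoint ⟨y, hy⟩) fun i => ?_
  have := LinearPMap.adjoint_isFormalAdjoint hd ⟨y, hy⟩ ⟨b i, hT.basis_mem i⟩
  rw [hT.apply_basis, inner_smul_right] at this
  rw [← inner_conj_symm, this, map_mul, conj_ofReal, inner_conj_symm]

/-- The bounded operator that multiplies the coefficients in a Hilbert basis by a bounded family. -/
lemma exists_multiplier (b : HilbertBasis ι ℂ H) (m : ι → ℂ) {C : ℝ} (hC : ∀ i, ‖m i‖ ≤ C) :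
    ∃ R : H →L[ℂ] H, ∀ y i, inner ℂ (b i) (R y) = m i * inner ℂ (b i) y := by
  have hp : 0 < (2 : ℝ≥0∞).toReal := by simp
  have hle : ∀ (f : lp (fun _ : ι => ℂ) 2) i, ‖m i * f i‖ ^ (2 : ℝ≥0∞).toReal ≤
      C ^ 2 * ‖f i‖ ^ (2 : ℝ≥0∞).toReal := by
    intro f i
    simp only [ENNReal.toReal_ofNat, Real.rpow_ofNat, norm_mul, mul_pow]
    gcongr
    exact hC i
  have hmem : ∀ f : lp (fun _ : ι => ℂ) 2, Memℓp (fun i => m i * f i) 2 := by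
    intro f
    rw [memℓp_gen_iff hp]
    exact Summable.of_nonneg_of_le (fun _ => by positivity) (hle f)
      (((memℓp_gen_iff hp).1 f.2).mul_left _)
  let M : lp (fun _ : ι => ℂ) 2 →ₗ[ℂ] lp (fun _ : ι => ℂ) 2 :=
    { toFun := fun f => ⟨fun i => m i * f i, hmem f⟩
      map_add' := by intro f g; ext i; exact mul_add _ _ _
      map_smul' := by intro c f; ext i; simp; ring }
  have hM : ∀ f, ‖M f‖ ≤ |C| * ‖f‖ := by
    intro f
    have h1 := lp.norm_rpow_eq_tsum hp (M f)
    have h2 := lp.norm_rpow_eq_tsum hp f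
    have h3 : ‖M f‖ ^ (2 : ℝ≥0∞).toReal ≤ C ^ 2 * ‖f‖ ^ (2 : ℝ≥0∞).toReal := by
      rw [h1, h2, ← tsum_mul_left]
      exact Summable.tsum_le_tsum (hle f) ((memℓp_gen_iff hp).1 (hmem f))
        (((memℓp_gen_iff hp).1 f.2).mul_left _)
    simp only [ENNReal.toReal_ofNat, Real.rpow_ofNat] at h3
    refine abs_le_of_sq_le_sq' ?_ (by positivity) |>.2
    rwa [mul_pow, sq_abs]
  let M' := M.mkContinuous |C| hM
  refine ⟨(b.repr.symm.toContinuousLinearEquiv : _ →L[ℂ] H) ∘L M' ∘L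
    (b.repr.toContinuousLinearEquiv : H →L[ℂ] _), fun y i => ?_⟩
  rw [← b.repr_apply_apply, ← b.repr_apply_apply]
  simp [M', M]

/-- The resolvent multiplies coefficients by 1/(ev i - z), which is bounded by 1/δ. It takes values
in the domain because that domain is maximal. -/
theorem IsDiagonalIn.inResolventSet (hT : IsDiagonalIn T b ev) {z : ℂ} {δ : ℝ} (hδ : 0 < δ)
    (h : ∀ i, δ ≤ ‖(ev i : ℂ) - z‖) : InResolventSet T z := by
  have hne : ∀ i, (ev i : ℂ) - z ≠ 0 := fun i => norm_pos_iff.1 (hδ.trans_le (h i))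
  obtain ⟨R, hR⟩ := exists_multiplier b (fun i => ((ev i : ℂ) - z)⁻¹) (C := δ⁻¹) fun i => by
    rw [norm_inv]; exact inv_anti₀ hδ (h i)
  have key : ∀ y i, inner ℂ (b i) (y + z • R y) = ev i * inner ℂ (b i) (R y) := by
    intro y i
    rw [inner_add_right, inner_smul_right, hR]
    field_simp [hne i]
    ring
  refine ⟨R, fun y => ⟨hT.mem_domain _ _ (key y), ?_⟩, fun x => b.ext_inner fun i => ?_⟩
  · rw [hT.apply_eq (key y)]
    simp
  · rw [hR, inner_sub_right, hT.inner_apply, inner_smul_right]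
    field_simp [hne i]

lemma IsDiagonalIn.not_inResolventSet (hT : IsDiagonalIn T b ev) (i : ι) :
    ¬ InResolventSet T (ev i : ℂ) := by
  rintro ⟨R, -, h⟩
  have := h ⟨b i, hT.basis_mem i⟩
  rw [hT.apply_basis] at this
  simp only [sub_self, map_zero] at this
  exact b.orthonormal.ne_zero i this.symm

lemma mem_nullSpace_iff {E : Type*} [NormedAddCommGroup E] [NormedSpace ℂ E] {S : E →ₗ.[ℂ] E}
    {z : ℂ} {u : E} : u ∈ nullSpace S z ↔ ∃ h : u ∈ S.domain, S ⟨u, h⟩ = z • u := by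
  constructor
  · rintro ⟨⟨x, hx⟩, h, rfl⟩
    refine ⟨hx, ?_⟩
    have h' : S ⟨x, hx⟩ - z • x = 0 := h
    exact sub_eq_zero.1 h'
  · rintro ⟨h, e⟩
    refine ⟨⟨u, h⟩, ?_, rfl⟩
    change S ⟨u, h⟩ - z • u = 0
    rw [e, sub_self]

/-- In coefficients the eigenvalue equation reads (ev i - z)⟨b i, u⟩ = 0. For the converse,
maximality of the domain is needed to know that u belongs to it. -/
lemma IsDiagonalIn.mem_nullSpace_iff_inner (hT : IsDiagonalIn T b ev) {z : ℂ} {u : H} :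
    u ∈ nullSpace T z ↔ ∀ i, (ev i : ℂ) ≠ z → inner ℂ (b i) u = 0 := by
  rw [mem_nullSpace_iff]
  constructor
  · rintro ⟨h, e⟩ i hi
    have := hT.inner_apply i ⟨u, h⟩
    rw [e, inner_smul_right] at this
    have h' : ((ev i : ℂ) - z) * inner ℂ (b i) u = 0 := by linear_combination -this
    exact (mul_eq_zero.1 h').resolve_left (sub_ne_zero.2 hi)
  · intro h
    have key : ∀ i, inner ℂ (b i) (z • u) = ev i * inner ℂ (b i) u := by
      intro i
      rw [inner_smul_right]
      by_cases hi : (ev i : ℂ) = z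
      · rw [hi]
      · rw [h i hi, mul_zero, mul_zero]
    exact ⟨hT.mem_domain _ _ key, hT.apply_eq key _⟩

end Diagonal

end MagneticLattice

namespace MagneticLattice

noncomputable section

/-! ### Lattice translates of the cell -/

/-- The lattice vector with integer coordinates `p`. -/
def latVec (τ : ℍ) (p : ℤ × ℤ) : ℂ := (p.1 : ℂ) * basis₁ τ + (p.2 : ℂ) * basis₂ τ

/-- The translate of the cell by the lattice vector with coordinates `p`. -/
def cellTranslate (τ : ℍ) (p : ℤ × ℤ) : Set ℂ := {x | x - latVec τ p ∈ cell τ}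

lemma coord₁_add (τ : ℍ) (x y : ℂ) : coord₁ τ (x + y) = coord₁ τ x + coord₁ τ y := by
  simp only [coord₁, add_re, add_im]; ring

lemma coord₂_add (τ : ℍ) (x y : ℂ) : coord₂ τ (x + y) = coord₂ τ x + coord₂ τ y := by
  simp only [coord₂, add_im]; ring

lemma coord₁_latVec (τ : ℍ) (p : ℤ × ℤ) : coord₁ τ (latVec τ p) = p.1 := by
  simpa [latVec] using coord₁_lin τ p.1 p.2

lemma coord₂_latVec (τ : ℍ) (p : ℤ × ℤ) : coord₂ τ (latVec τ p) = p.2 := by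
  simpa [latVec] using coord₂_lin τ p.1 p.2

lemma continuous_coord₁ (τ : ℍ) : Continuous (coord₁ τ) := by unfold coord₁; fun_prop

lemma continuous_coord₂ (τ : ℍ) : Continuous (coord₂ τ) := by unfold coord₂; fun_prop

lemma mem_cellTranslate_iff (τ : ℍ) (p : ℤ × ℤ) (x : ℂ) :
    x ∈ cellTranslate τ p ↔ ⌊coord₁ τ x⌋ = p.1 ∧ ⌊coord₂ τ x⌋ = p.2 := by
  have h1 := coord₁_add τ (x - latVec τ p) (latVec τ p)
  have h2 := coord₂_add τ (x - latVec τ p) (latVec τ p)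
  rw [sub_add_cancel, coord₁_latVec] at h1
  rw [sub_add_cancel, coord₂_latVec] at h2
  rw [cellTranslate, Set.mem_ofPred_eq, mem_cell_iff, Int.floor_eq_iff, Int.floor_eq_iff,
    Set.mem_Ico, Set.mem_Ico, h1, h2]
  constructor
  · rintro ⟨⟨a, b⟩, c, d⟩
    exact ⟨⟨by linarith, by linarith⟩, by linarith, by linarith⟩
  · rintro ⟨⟨a, b⟩, c, d⟩
    exact ⟨⟨by linarith, by linarith⟩, by linarith, by linarith⟩

lemma measurableSet_cellTranslate (τ : ℍ) (p : ℤ × ℤ) : MeasurableSet (cellTranslate τ p) :=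
  (measurable_sub_const _) (measurableSet_cell τ)

lemma pairwiseDisjoint_cellTranslate (τ : ℍ) (s : Set (ℤ × ℤ)) :
    s.PairwiseDisjoint (cellTranslate τ) := by
  intro p _ q _ hpq
  rw [Function.onFun, Set.disjoint_left]
  intro x hp hq
  rw [mem_cellTranslate_iff] at hp hq
  exact hpq (Prod.ext (hp.1.symm.trans hq.1) (hp.2.symm.trans hq.2))

lemma preimage_cellTranslate (τ : ℍ) (p : ℤ × ℤ) :
    (fun x => x + latVec τ p) ⁻¹' cellTranslate τ p = cell τ := by
  ext x; simp [cellTranslate]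

lemma lintegral_cellTranslate (τ : ℍ) (p : ℤ × ℤ) (g : ℂ → ℝ≥0∞) :
    ∫⁻ x in cellTranslate τ p, g x = ∫⁻ x in cell τ, g (x + latVec τ p) := by
  rw [← preimage_cellTranslate τ p]
  exact ((measurePreserving_add_right volume _).setLIntegral_comp_preimage_emb
    (measurableEmbedding_addRight _) g _).symm

lemma integral_cellTranslate {E : Type*} [NormedAddCommGroup E] [NormedSpace ℝ E] (τ : ℍ)
    (p : ℤ × ℤ) (g : ℂ → E) :
    ∫ x in cellTranslate τ p, g x = ∫ x in cell τ, g (x + latVec τ p) := by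
  rw [← preimage_cellTranslate τ p]
  exact ((measurePreserving_add_right volume _).setIntegral_preimage_emb
    (measurableEmbedding_addRight _) g _).symm

/-- The finite box of lattice points with coordinates in `[-M, M]`. -/
def box (M : ℤ) : Finset (ℤ × ℤ) := Finset.Icc (-M) M ×ˢ Finset.Icc (-M) M

lemma integral_eq_sum_cell {E : Type*} [NormedAddCommGroup E] [NormedSpace ℝ E] (τ : ℍ)
    (s : Finset (ℤ × ℤ)) {g : ℂ → E} (hg : Integrable g)
    (hs : ∀ x, g x ≠ 0 → (⌊coord₁ τ x⌋, ⌊coord₂ τ x⌋) ∈ s) :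
    ∫ x, g x = ∑ p ∈ s, ∫ x in cell τ, g (x + latVec τ p) := by
  simp_rw [← integral_cellTranslate]
  rw [← integral_biUnion_finset s (fun p _ => measurableSet_cellTranslate τ p)
    (pairwiseDisjoint_cellTranslate τ _) (fun p _ => hg.integrableOn)]
  refine (setIntegral_eq_integral_of_forall_compl_eq_zero fun x hx => ?_).symm
  by_contra h
  refine hx (Set.mem_biUnion (hs x h) ?_)
  rw [mem_cellTranslate_iff]
  exact ⟨rfl, rfl⟩

lemma exists_box_of_isCompact (τ : ℍ) {K : Set ℂ} (hK : IsCompact K) :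
    ∃ M : ℤ, K ⊆ ⋃ p ∈ box M, cellTranslate τ p := by
  obtain ⟨A, hA⟩ := hK.exists_bound_of_continuousOn (continuous_coord₁ τ).continuousOn
  obtain ⟨B, hB⟩ := hK.exists_bound_of_continuousOn (continuous_coord₂ τ).continuousOn
  obtain ⟨M, hM⟩ := exists_int_ge (max A B + 1)
  refine ⟨M, fun x hx => ?_⟩
  have h1 := abs_le.1 ((hA x hx).trans (le_max_left A B))
  have h2 := abs_le.1 ((hB x hx).trans (le_max_right A B))
  refine Set.mem_biUnion (x := (⌊coord₁ τ x⌋, ⌊coord₂ τ x⌋)) ?_ ?_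
  · simp only [box, Finset.coe_product, Finset.coe_Icc, Set.mem_prod, Set.mem_Icc, Int.le_floor]
    refine ⟨⟨by push_cast; linarith, ?_⟩, by push_cast; linarith, ?_⟩
    · exact_mod_cast (Int.floor_le (coord₁ τ x)).trans (by linarith : coord₁ τ x ≤ M)
    · exact_mod_cast (Int.floor_le (coord₂ τ x)).trans (by linarith : coord₂ τ x ≤ M)
  · rw [mem_cellTranslate_iff]; exact ⟨rfl, rfl⟩

/-- Invariance under all lattice translations. -/
def LatticePeriodic {α : Type*} (τ : ℍ) (F : ℂ → α) : Prop :=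
  ∀ p x, F (x + latVec τ p) = F x

lemma LatticePeriodic.of_basis {α : Type*} {τ : ℍ} {F : ℂ → α}
    (h1 : ∀ x, F (x + basis₁ τ) = F x) (h2 : ∀ x, F (x + basis₂ τ) = F x) :
    LatticePeriodic τ F := by
  intro p x
  have := (Function.Periodic.int_mul (f := F) (c := basis₁ τ) h1 p.1).add_period
    (Function.Periodic.int_mul (f := F) (c := basis₂ τ) h2 p.2)
  exact this x

lemma latticePart_eq (τ : ℍ) (x : ℂ) :
    latticePart τ x = latVec τ (⌊coord₁ τ x⌋, ⌊coord₂ τ x⌋) := rfl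

lemma LatticePeriodic.sub_latticePart {α : Type*} {τ : ℍ} {F : ℂ → α} (h : LatticePeriodic τ F)
    (x : ℂ) : F (x - latticePart τ x) = F x := by
  have := h (⌊coord₁ τ x⌋, ⌊coord₂ τ x⌋) (x - latticePart τ x)
  rw [← latticePart_eq, sub_add_cancel] at this
  exact this.symm

/-- Finitely many translates of the cell cover K, and a periodic function has the same integral over
each. It matters that N depends on K only. -/
lemma exists_lintegral_le (τ : ℍ) {K : Set ℂ} (hK : IsCompact K) :
    ∃ N : ℕ, ∀ g : ℂ → ℝ≥0∞, LatticePeriodic τ g →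
      ∫⁻ x in K, g x ≤ N * ∫⁻ x in cell τ, g x := by
  obtain ⟨M, hM⟩ := exists_box_of_isCompact τ hK
  refine ⟨(box M).card, fun g hg => (lintegral_mono_set hM).trans ?_⟩
  rw [lintegral_biUnion_finset (pairwiseDisjoint_cellTranslate τ _)
    (fun p _ => measurableSet_cellTranslate τ p)]
  simp_rw [lintegral_cellTranslate, hg _ _]
  simp

lemma norm_le_of_mem_coord (τ : ℍ) {x : ℂ} {M : ℝ} (h1 : |coord₁ τ x| ≤ M)
    (h2 : |coord₂ τ x| ≤ M) : ‖x‖ ≤ M * ‖basis₁ τ‖ + M * ‖basis₂ τ‖ := by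
  rw [eq_coord τ x]
  refine (norm_add_le _ _).trans (add_le_add ?_ ?_)
  · rw [norm_mul, norm_real]
    exact mul_le_mul_of_nonneg_right h1 (norm_nonneg _)
  · rw [norm_mul, norm_real]
    exact mul_le_mul_of_nonneg_right h2 (norm_nonneg _)

lemma cell_subset_closedBall (τ : ℍ) :
    cell τ ⊆ Metric.closedBall 0 (1 * ‖basis₁ τ‖ + 1 * ‖basis₂ τ‖) := by
  intro x hx
  obtain ⟨⟨a, b⟩, c, d⟩ := (mem_cell_iff τ x).1 hx
  rw [mem_closedBall_zero_iff]
  exact norm_le_of_mem_coord τ (abs_le.2 ⟨by linarith, b.le⟩) (abs_le.2 ⟨by linarith, d.le⟩)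

instance isFiniteMeasure_cell (τ : ℍ) : IsFiniteMeasure (volume.restrict (cell τ)) :=
  ⟨by
    rw [Measure.restrict_apply_univ]
    exact (measure_mono (cell_subset_closedBall τ)).trans_lt
      (isCompact_closedBall _ _).measure_lt_top⟩

/-! ### A smooth partition of unity -/

/-- A smooth compactly supported function whose integer translates sum to one. -/
def bump (s : ℝ) : ℝ := Real.smoothTransition (s + 1) - Real.smoothTransition s

lemma contDiff_bump : ContDiff ℝ ∞ bump := by
  unfold bump
  exact (Real.smoothTransition.contDiff.comp (contDiff_id.add contDiff_const)).sub
    Real.smoothTransition.contDiff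

lemma bump_eq_zero {s : ℝ} (h : 1 ≤ |s|) : bump s = 0 := by
  rcases le_abs.1 h with h | h
  · simp [bump, Real.smoothTransition.one_of_one_le h,
      Real.smoothTransition.one_of_one_le (by linarith : 1 ≤ s + 1)]
  · simp [bump, Real.smoothTransition.zero_of_nonpos (by linarith : s ≤ 0),
      Real.smoothTransition.zero_of_nonpos (by linarith : s + 1 ≤ 0)]

/-- The sum telescopes to S(s+2) - S(s-1), with S the smooth transition, and this is 1 - 0 when |s|
≤ 1. -/
lemma sum_bump {s : ℝ} (h : |s| ≤ 1) : ∑ a ∈ Finset.Icc (-1 : ℤ) 1, bump (s + a) = 1 := by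
  have e : Finset.Icc (-1 : ℤ) 1 = {-1, 0, 1} := by decide
  obtain ⟨h1, h2⟩ := abs_le.1 h
  have e1 := Real.smoothTransition.one_of_one_le (by linarith : 1 ≤ s + 1 + 1)
  have e2 := Real.smoothTransition.zero_of_nonpos (by linarith : s + -1 ≤ 0)
  rw [e]
  simp [bump, e1, e2]

/-- A smooth compactly supported function on the plane whose lattice translates sum to one. -/
def planeBump (τ : ℍ) (x : ℂ) : ℝ := bump (coord₁ τ x) * bump (coord₂ τ x)

lemma contDiff_planeBump (τ : ℍ) : ContDiff ℝ ∞ (planeBump τ) := by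
  have h1 : ContDiff ℝ ∞ (coord₁ τ) := by
    unfold coord₁
    exact (reCLM.contDiff.sub ((imCLM.contDiff.div_const _).mul contDiff_const)).div_const _
  have h2 : ContDiff ℝ ∞ (coord₂ τ) := by
    unfold coord₂
    exact imCLM.contDiff.div_const _
  exact (contDiff_bump.comp h1).mul (contDiff_bump.comp h2)

lemma hasCompactSupport_planeBump (τ : ℍ) : HasCompactSupport (planeBump τ) := by
  refine HasCompactSupport.of_support_subset_isCompact
    (isCompact_closedBall 0 (1 * ‖basis₁ τ‖ + 1 * ‖basis₂ τ‖)) fun x hx => ?_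
  rw [mem_closedBall_zero_iff]
  rw [Function.mem_support, planeBump, mul_ne_zero_iff] at hx
  refine norm_le_of_mem_coord τ ?_ ?_
  · by_contra h; exact hx.1 (bump_eq_zero (not_le.1 h).le)
  · by_contra h; exact hx.2 (bump_eq_zero (not_le.1 h).le)

lemma sum_planeBump (τ : ℍ) {x : ℂ} (h1 : |coord₁ τ x| ≤ 1) (h2 : |coord₂ τ x| ≤ 1) :
    ∑ p ∈ box 1, planeBump τ (x + latVec τ p) = 1 := by
  simp only [box, planeBump, coord₁_add, coord₂_add, coord₁_latVec, coord₂_latVec]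
  rw [Finset.sum_product]
  simp_rw [← Finset.mul_sum]
  rw [← Finset.sum_mul, sum_bump h1, sum_bump h2, one_mul]

lemma floor_mem_of_abs_lt {s : ℝ} (h : |s| ≤ 1) : ⌊s⌋ ∈ Finset.Icc (-1 : ℤ) 1 := by
  obtain ⟨h1, h2⟩ := abs_le.1 h
  rw [Finset.mem_Icc]
  refine ⟨Int.le_floor.2 (by push_cast; linarith), ?_⟩
  exact_mod_cast (Int.floor_le s).trans h2

lemma floor_mem_box (τ : ℍ) {x : ℂ} (hx : x ∈ tsupport (planeBump τ)) :
    (⌊coord₁ τ x⌋, ⌊coord₂ τ x⌋) ∈ box 1 := by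
  have hcl : IsClosed {x : ℂ | |coord₁ τ x| ≤ 1 ∧ |coord₂ τ x| ≤ 1} :=
    (isClosed_le (continuous_coord₁ τ).abs continuous_const).inter
      (isClosed_le (continuous_coord₂ τ).abs continuous_const)
  have hsub : tsupport (planeBump τ) ⊆ {x : ℂ | |coord₁ τ x| ≤ 1 ∧ |coord₂ τ x| ≤ 1} := by
    refine closure_minimal (fun x hx => ?_) hcl
    rw [Function.mem_support, planeBump, mul_ne_zero_iff] at hx
    constructor
    · by_contra h; exact hx.1 (bump_eq_zero (not_le.1 h).le)
    · by_contra h; exact hx.2 (bump_eq_zero (not_le.1 h).le)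
  obtain ⟨h1, h2⟩ := hsub hx
  exact Finset.mem_product.2 ⟨floor_mem_of_abs_lt h1, floor_mem_of_abs_lt h2⟩

/-- Folding the plane onto the cell moves the translations from the periodic F to the weight. It is
used both for `planeBump` and for its derivative, hence the hypothesis on the support. -/
lemma integral_smul_eq_cell (τ : ℍ) {w : ℂ → ℝ} (hw : Continuous w) (hc : HasCompactSupport w)
    (hsupp : ∀ x, w x ≠ 0 → x ∈ tsupport (planeBump τ)) {F : ℂ → ℂ} (hF : LocallyIntegrable F)
    (hper : LatticePeriodic τ F) :
    ∫ x, w x • F x = ∫ x in cell τ, (∑ p ∈ box 1, w (x + latVec τ p)) • F x := by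
  have hi := integrable_test hw hc hF
  rw [integral_eq_sum_cell τ (box 1) hi fun x hx => floor_mem_box τ (hsupp x fun h => hx ?_)]
  · rw [← integral_finsetSum]
    · congr 1
      ext x
      rw [Finset.sum_smul]
      exact Finset.sum_congr rfl fun p _ => by rw [hper]
    · intro p _
      exact (hi.comp_add_right (latVec τ p)).integrableOn
  · rw [h, zero_smul]

/-- The integral over the cell of the weak derivative of a periodic function vanishes. -/
theorem integral_cell_weakDeriv (τ : ℍ) {v : ℂ} {F G : ℂ → ℂ} (h : HasWeakDeriv v F G)
    (hF : LatticePeriodic τ F) (hG : LatticePeriodic τ G) : ∫ x in cell τ, G x = 0 := by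
  have hχ := contDiff_planeBump τ
  have hc := hasCompactSupport_planeBump τ
  -- The weak identity is tested with `planeBump`. After folding onto the cell, the translates of
  -- the bump sum to 1 and their derivatives sum to 0, which leaves 0 = -∫ G.
  have key := h.2.2 _ hχ hc
  rw [integral_smul_eq_cell τ (continuous_dtest hχ v) (compact_dtest hc v) ?_ h.1 hF,
    integral_smul_eq_cell τ hχ.continuous hc (fun x hx => subset_tsupport _ hx) h.2.1 hG] at key
  · have e1 : ∫ x in cell τ, (∑ p ∈ box 1, fderiv ℝ (planeBump τ) (x + latVec τ p) v) • F x = 0 := by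
      refine setIntegral_eq_zero_of_forall_eq_zero fun x hx => ?_
      have hd : ∀ p ∈ box 1, HasFDerivAt (fun y => planeBump τ (y + latVec τ p))
          (fderiv ℝ (planeBump τ) (x + latVec τ p)) x := by
        intro p _
        exact (hasFDerivAt_comp_add_right _).2
          ((hχ.differentiable (by simp)) (x + latVec τ p)).hasFDerivAt
      have hs := HasFDerivAt.fun_sum hd
      -- To differentiate, the sum must be 1 on a neighbourhood of x. The cell coordinates lie in
      -- [0,1), inside the open range (-1,1), so this holds even at boundary points of the cell.
      have hev : (fun y => ∑ p ∈ box 1, planeBump τ (y + latVec τ p)) =ᶠ[nhds x] fun _ => 1 := by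
        obtain ⟨⟨a, b⟩, c, d⟩ := (mem_cell_iff τ x).1 hx
        have n1 : ∀ᶠ y in nhds x, |coord₁ τ y| < 1 :=
          (continuous_coord₁ τ).abs.continuousAt.eventually_lt continuousAt_const
            (abs_lt.2 ⟨by linarith, b⟩)
        have n2 : ∀ᶠ y in nhds x, |coord₂ τ y| < 1 :=
          (continuous_coord₂ τ).abs.continuousAt.eventually_lt continuousAt_const
            (abs_lt.2 ⟨by linarith, d⟩)
        filter_upwards [n1, n2] with y h1 h2 using sum_planeBump τ h1.le h2.le
      have := hs.unique ((hasFDerivAt_const (1 : ℝ) x).congr_of_eventuallyEq hev)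
      have h0 := congrArg (fun L : ℂ →L[ℝ] ℝ => L v) this
      simp only [FunLike.coe_sum, Finset.sum_apply] at h0
      rw [h0]
      simp
    have e2 : ∫ x in cell τ, (∑ p ∈ box 1, planeBump τ (x + latVec τ p)) • G x =
        ∫ x in cell τ, G x := by
      refine setIntegral_congr_fun (measurableSet_cell τ) fun x hx => ?_
      obtain ⟨⟨a, b⟩, c, d⟩ := (mem_cell_iff τ x).1 hx
      rw [sum_planeBump τ (abs_le.2 ⟨by linarith, b.le⟩) (abs_le.2 ⟨by linarith, d.le⟩), one_smul]
    rw [e1, e2] at key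
    rw [← neg_eq_zero, ← key]
  · intro x hx
    refine support_fderiv_subset ℝ ?_
    rw [Function.mem_support]
    intro h0
    rw [h0] at hx
    exact hx rfl

end

end MagneticLattice

namespace MagneticLattice

noncomputable section

open scoped ComplexConjugate

/-! ### Quasi-periodic functions -/

/-- The phase factor of the quasi-periodic boundary condition. -/
def phase (n : ℕ) (t x : ℂ) : ℂ := Complex.exp (I * (n / 2 : ℂ) * (wedge t x : ℂ))

lemma phase_eq (n : ℕ) (t x : ℂ) : phase n t x = Complex.exp (((n / 2 * wedge t x : ℝ) : ℂ) * I) := by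
  rw [phase]; congr 1; push_cast; ring

@[simp] lemma norm_phase (n : ℕ) (t x : ℂ) : ‖phase n t x‖ = 1 := by
  rw [phase_eq, norm_exp_ofReal_mul_I]

lemma conj_phase_mul (n : ℕ) (t x : ℂ) : conj (phase n t x) * phase n t x = 1 := by
  rw [conj_mul', norm_phase]; simp

lemma hasFDerivAt_phase (n : ℕ) (t x : ℂ) : HasFDerivAt (phase n t)
    ((phase n t x * (I * (n / 2 : ℂ))) • (ofRealCLM.comp (t.re • imCLM - t.im • reCLM))) x := by
  have h : HasFDerivAt (fun x => (wedge t x : ℂ)) (ofRealCLM.comp (t.re • imCLM - t.im • reCLM)) x :=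
    (ofRealCLM.comp (t.re • imCLM - t.im • reCLM)).hasFDerivAt
  have := (h.const_mul (I * (n / 2 : ℂ))).cexp
  rw [smul_smul] at this
  exact this

lemma contDiff_phase (n : ℕ) (t : ℂ) : ContDiff ℝ ∞ (phase n t) := by
  have h : ContDiff ℝ ∞ (fun x => (wedge t x : ℂ)) :=
    (ofRealCLM.comp (t.re • imCLM - t.im • reCLM)).contDiff
  exact (contDiff_const.mul h).cexp

/-- The phase is a gauge transformation: the gradient of (n/2) t ∧ x is A(t), exactly the change of
the potential under translation by t. -/
lemma fderiv_phase (n : ℕ) (t x : ℂ) (j : Fin 2) :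
    fderiv ℝ (phase n t) x (dir j) = I * potential n j t * phase n t x := by
  rw [(hasFDerivAt_phase n t x).fderiv]
  fin_cases j
  · simp [dir, potential]; ring
  · simp [dir, potential]; ring

lemma potential_add (n : ℕ) (j : Fin 2) (x t : ℂ) :
    potential n j (x + t) = potential n j x + potential n j t := by
  fin_cases j <;> simp [potential] <;> ring

section QuasiPeriodic

variable {τ : ℍ} {n : ℕ} {f g : ℂ → ℂ}

lemma IsQuasiPeriodic.periodic_of_invariant {α : Type*} (hf : IsQuasiPeriodic τ n f)
    {Φ : ℂ → α} (h : ∀ t x, f (x + t) = phase n t x * f x → Φ (x + t) = Φ x) :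
    LatticePeriodic τ Φ :=
  .of_basis (fun x => h _ x (hf _ (by simp) x)) (fun x => h _ x (hf _ (by simp) x))

lemma IsQuasiPeriodic.periodic_norm (hf : IsQuasiPeriodic τ n f) :
    LatticePeriodic τ fun x => ‖f x‖ :=
  hf.periodic_of_invariant fun t x h => by simp [h]

lemma IsQuasiPeriodic.periodic_enorm_rpow (hf : IsQuasiPeriodic τ n f) (p : ℝ) :
    LatticePeriodic τ fun x => ‖f x‖ₑ ^ p := by
  intro q x
  have := hf.periodic_norm q x
  simp only at this ⊢
  rw [← ofReal_norm, this, ofReal_norm]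

lemma IsQuasiPeriodic.periodic_conj_mul (hf : IsQuasiPeriodic τ n f) (hg : IsQuasiPeriodic τ n g) :
    LatticePeriodic τ fun x => conj (f x) * g x := by
  have key : ∀ t ∈ ({basis₁ τ, basis₂ τ} : Set ℂ), ∀ x,
      conj (f (x + t)) * g (x + t) = conj (f x) * g x := by
    intro t ht x
    have h1 : f (x + t) = phase n t x * f x := hf t ht x
    have h2 : g (x + t) = phase n t x * g x := hg t ht x
    rw [h1, h2, map_mul]
    linear_combination (conj (f x) * g x) * conj_phase_mul n t x
  exact .of_basis (key _ (by simp)) (key _ (by simp))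

lemma IsQuasiPeriodic.sub (hf : IsQuasiPeriodic τ n f) (hg : IsQuasiPeriodic τ n g) :
    IsQuasiPeriodic τ n (f - g) := by
  intro t ht x
  simp only [Pi.sub_apply, hf t ht x, hg t ht x, mul_sub]

/-- The difference of f and its extension is quasi-periodic and vanishes on the cell, and its
absolute value is periodic. -/
lemma IsQuasiPeriodic.qpExt_eq_self (hf : IsQuasiPeriodic τ n f) : qpExt τ n f = f := by
  ext x
  have h := ((qpExt_isQuasiPeriodic τ n f).sub hf).periodic_norm.sub_latticePart x
  simp only [Pi.sub_apply, qpExt_eq τ n f (sub_latticePart_mem τ x), sub_self, norm_zero] at h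
  exact sub_eq_zero.1 (norm_eq_zero.1 h.symm)

/-- The translations under which Φ is invariant almost everywhere form a subgroup, so the two
generators suffice. -/
lemma ae_periodic {α : Type*} {Φ : ℂ → α}
    (h : ∀ t ∈ ({basis₁ τ, basis₂ τ} : Set ℂ), ∀ᵐ x, Φ (x + t) = Φ x) (p : ℤ × ℤ) :
    ∀ᵐ x, Φ (x + latVec τ p) = Φ x := by
  let A : AddSubgroup ℂ :=
    { carrier := {t | ∀ᵐ x, Φ (x + t) = Φ x}
      zero_mem' := by simp
      add_mem' := by
        intro s t hs ht
        have := (measurePreserving_add_right volume s).quasiMeasurePreserving.ae ht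
        filter_upwards [hs, this] with x h1 h2
        rw [← add_assoc, h2, h1]
      neg_mem' := by
        intro t ht
        have := (measurePreserving_add_right volume (-t)).quasiMeasurePreserving.ae ht
        filter_upwards [this] with x h1
        rw [← h1, neg_add_cancel_right] }
  have h1 : basis₁ τ ∈ A := h _ (by simp)
  have h2 : basis₂ τ ∈ A := h _ (by simp)
  have := A.add_mem (A.zsmul_mem h1 p.1) (A.zsmul_mem h2 p.2)
  simp only [zsmul_eq_mul] at this
  exact this

/-- The distance |f - `qpExt` f| is periodic almost everywhere and zero on the cell. Since the
lattice is countable, a single null set serves all translations. -/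
lemma ae_eq_qpExt
    (h : ∀ t ∈ ({basis₁ τ, basis₂ τ} : Set ℂ), ∀ᵐ x, f (x + t) = phase n t x * f x) :
    f =ᵐ[volume] qpExt τ n f := by
  have hq := qpExt_isQuasiPeriodic τ n f
  have key := ae_periodic (τ := τ) (Φ := fun x => ‖f x - qpExt τ n f x‖) fun t ht => by
    filter_upwards [h t ht] with x hx
    have h2 : qpExt τ n f (x + t) = phase n t x * qpExt τ n f x := hq t ht x
    rw [hx, h2, ← mul_sub, norm_mul, norm_phase, one_mul]
  have key' : ∀ᵐ x, ∀ p : ℤ × ℤ, ‖f (x - latVec τ p) - qpExt τ n f (x - latVec τ p)‖ =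
      ‖f x - qpExt τ n f x‖ := by
    rw [ae_all_iff]
    intro p
    have := (measurePreserving_sub_right volume (latVec τ p)).quasiMeasurePreserving.ae (key p)
    filter_upwards [this] with x hx
    rw [← hx, sub_add_cancel]
  filter_upwards [key'] with x hx
  have := hx (⌊coord₁ τ x⌋, ⌊coord₂ τ x⌋)
  rw [← latticePart_eq, qpExt_eq τ n f (sub_latticePart_mem τ x), sub_self, norm_zero] at this
  exact sub_eq_zero.1 (norm_eq_zero.1 this.symm)

end QuasiPeriodic

/-! ### Calculus of weak derivatives -/

lemma HasWeakDeriv.comp_add {v : ℂ} {f g : ℂ → ℂ} (h : HasWeakDeriv v f g) (t : ℂ) :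
    HasWeakDeriv v (fun x => f (x + t)) (fun x => g (x + t)) := by
  have hl : ∀ {u : ℂ → ℂ}, LocallyIntegrable u → LocallyIntegrable fun x => u (x + t) := by
    intro u hu
    have := (locallyIntegrable_map_homeomorph (Homeomorph.addRight t) (f := u) (μ := volume))
    rw [show Measure.map (Homeomorph.addRight t) volume = (volume : Measure ℂ) from
      (measurePreserving_add_right volume t).map_eq] at this
    exact this.1 hu
  refine ⟨hl h.1, hl h.2.1, fun φ h1 h2 => ?_⟩
  have key := h.2.2 (fun x => φ (x - t)) (h1.comp (contDiff_id.sub contDiff_const))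
    (h2.comp_homeomorph (Homeomorph.subRight t))
  have e : ∀ x, fderiv ℝ (fun x => φ (x - t)) x = fderiv ℝ φ (x - t) := fun x =>
    fderiv_comp_sub _
  simp only [e] at key
  rw [← integral_add_right_eq_self _ t, ← integral_add_right_eq_self (fun x => φ (x - t) • g x) t]
    at key
  simpa using key

/-- The Leibniz rule for real multipliers is applied to the real and imaginary parts of a
separately. -/
lemma HasWeakDeriv.mul_complex {v : ℂ} {f g : ℂ → ℂ} (h : HasWeakDeriv v f g) {a : ℂ → ℂ}
    (ha : ContDiff ℝ ∞ a) :
    HasWeakDeriv v (fun x => a x * f x) (fun x => a x * g x + fderiv ℝ a x v * f x) := by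
  have h1 := h.mul (reCLM.contDiff.comp ha)
  have h2 := (h.mul (imCLM.contDiff.comp ha)).const_smul I
  have hd := ha.differentiable (by simp)
  have e1 : ∀ x, fderiv ℝ (reCLM ∘ a) x v = (fderiv ℝ a x v).re := by
    intro x
    rw [(reCLM.hasFDerivAt.comp x (hd x).hasFDerivAt).fderiv]; rfl
  have e2 : ∀ x, fderiv ℝ (imCLM ∘ a) x v = (fderiv ℝ a x v).im := by
    intro x
    rw [(imCLM.hasFDerivAt.comp x (hd x).hasFDerivAt).fderiv]; rfl
  refine (h1.add h2).congr (.of_forall fun x => ?_) (.of_forall fun x => ?_)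
  · simp only [Pi.add_apply, Pi.smul_apply, smul_eq_mul, Function.comp_apply, reCLM_apply,
      imCLM_apply]
    conv_rhs => rw [← re_add_im (a x)]
    ring
  · simp only [Pi.add_apply, Pi.smul_apply, smul_eq_mul, Function.comp_apply, reCLM_apply,
      imCLM_apply, e1, e2]
    conv_rhs => rw [← re_add_im (a x), ← re_add_im (fderiv ℝ a x v)]
    ring

lemma hasWeakDeriv_of_contDiff {f : ℂ → ℂ} (hf : ContDiff ℝ ∞ f) (v : ℂ) :
    HasWeakDeriv v f fun x => fderiv ℝ f x v := by
  have hc : Continuous fun x => fderiv ℝ f x v :=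
    (hf.continuous_fderiv (by simp)).clm_apply continuous_const
  refine ⟨hf.continuous.locallyIntegrable, hc.locallyIntegrable, fun φ h1 h2 => ?_⟩
  rw [integral_smul_fderiv_eq_neg_fderiv_smul_of_integrable, neg_neg]
  · exact integrable_test (continuous_dtest h1 v) (compact_dtest h2 v)
      hf.continuous.locallyIntegrable
  · exact integrable_test h1.continuous h2 hc.locallyIntegrable
  · exact integrable_test h1.continuous h2 hf.continuous.locallyIntegrable
  · exact fun x _ => h1.differentiable (by simp) x
  · exact fun x _ => hf.differentiable (by simp) x

/-- `w` is the weak covariant derivative `(∂_j - i A_j) f`. -/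
def HasCovDeriv (n : ℕ) (j : Fin 2) (f w : ℂ → ℂ) : Prop :=
  HasWeakDeriv (dir j) f fun x => w x + I * potential n j x * f x

/-! ### Weak covariant derivatives: gauge covariance, Sobolev regularity, integration by parts. -/

section Cov

variable {τ : ℍ} {n : ℕ} {j : Fin 2} {f f' w w' : ℂ → ℂ}

lemma HasCovDeriv.congr (h : HasCovDeriv n j f w) (hf : f =ᵐ[volume] f') (hw : w =ᵐ[volume] w') :
    HasCovDeriv n j f' w' :=
  HasWeakDeriv.congr h hf (by filter_upwards [hf, hw] with x h1 h2; rw [h1, h2])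

lemma HasCovDeriv.covGrad_ae (h : HasCovDeriv n j f w) : covGrad n f j =ᵐ[volume] w := by
  filter_upwards [HasWeakDeriv.weakDeriv_ae h] with x hx
  rw [covGrad, hx]; ring

lemma HasWeakDeriv.hasCovDeriv (h : HasWeakDeriv (dir j) f w) :
    HasCovDeriv n j f fun x => w x - I * potential n j x * f x :=
  HasWeakDeriv.congr h .rfl (.of_forall fun x => by ring)

/-- The covariant derivative of a quasi-periodic function is quasi-periodic. -/
lemma HasCovDeriv.ae_eq_qpExt (h : HasCovDeriv n j f w) (hf : IsQuasiPeriodic τ n f) :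
    w =ᵐ[volume] qpExt τ n w := by
  refine MagneticLattice.ae_eq_qpExt fun t ht => ?_
  have h1 := HasWeakDeriv.comp_add h t
  have h2 := HasWeakDeriv.mul_complex h (contDiff_phase n t)
  have e : (fun x => f (x + t)) = fun x => phase n t x * f x := funext fun x => hf t ht x
  rw [e] at h1
  -- Two expressions for the weak derivative of f(x+t) are compared. The derivative of the phase
  -- cancels the shift A(x+t) - A(x) = A(t) of the potential.
  filter_upwards [h1.unique h2] with x hx
  have hfx : f (x + t) = phase n t x * f x := hf t ht x
  rw [fderiv_phase, potential_add, hfx] at hx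
  push_cast at hx
  linear_combination hx

lemma HasCovDeriv.negMagneticLaplacian_ae {w : Fin 2 → ℂ → ℂ} {u : Fin 2 → ℂ → ℂ}
    (hw : ∀ j, HasCovDeriv n j f (w j)) (hu : ∀ j, HasCovDeriv n j (w j) (u j)) :
    negMagneticLaplacian n f =ᵐ[volume] fun x => -(u 0 x + u 1 x) := by
  have h1 := fun j => (hw j).covGrad_ae
  have h2 := fun j => HasWeakDeriv.weakDeriv_ae
    (HasCovDeriv.congr (hu j) (h1 j).symm (Filter.EventuallyEq.rfl))
  filter_upwards [h1 0, h1 1, h2 0, h2 1] with x a0 a1 b0 b1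
  simp only [negMagneticLaplacian, covGradAdjoint, Fin.sum_univ_two, b0, b1, a0, a1]
  ring

lemma memL2Loc_continuous_mul {a : ℂ → ℝ} (ha : Continuous a) (hf : MemL2Loc f) (c : ℂ) :
    MemL2Loc fun x => c * a x * f x :=
  ((MemL2Loc.mul ha hf).const_smul c).congr (.of_forall fun x => by simp [mul_assoc])

/-- Covariant derivatives are quasi-periodic only almost everywhere, so each is replaced by its
extension, which is quasi-periodic at every point. Only the repeated derivatives enter the
Laplacian. -/
lemma MemH2Loc.exists_hasCovDeriv (h : MemH2Loc f) (hf : IsQuasiPeriodic τ n f) :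
    ∃ w : Fin 2 → ℂ → ℂ, ∃ u : Fin 2 → ℂ → ℂ, (∀ j, IsQuasiPeriodic τ n (w j)) ∧
      (∀ j, IsQuasiPeriodic τ n (u j)) ∧ (∀ j, HasCovDeriv n j f (w j)) ∧
      ∀ j, HasCovDeriv n j (w j) (u j) := by
  obtain ⟨-, g, k, hg, hk⟩ := h
  have h1 : ∀ j, ∃ w, IsQuasiPeriodic τ n w ∧ HasCovDeriv n j f w ∧ ∃ u, HasCovDeriv n j w u := by
    intro j
    have a := HasWeakDeriv.hasCovDeriv (n := n) (hg j).2
    have e := a.ae_eq_qpExt hf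
    refine ⟨_, qpExt_isQuasiPeriodic τ n _, a.congr .rfl e, ?_⟩
    have b := (hk j j).2.add
      (((hg j).2.mul (contDiff_potential n j)).const_smul (-I))
    have b' := b.congr (f' := fun x => g j x - I * potential n j x * f x) (.of_forall fun x => by
      simp only [Pi.add_apply, Pi.smul_apply, smul_eq_mul]; ring) .rfl
    exact ⟨_, (HasWeakDeriv.hasCovDeriv (n := n) b').congr e .rfl⟩
  choose w hw1 hw2 u hu using h1
  exact ⟨w, fun j => qpExt τ n (u j), hw1, fun j => qpExt_isQuasiPeriodic τ n _, hw2,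
    fun j => (hu j).congr .rfl ((hu j).ae_eq_qpExt (hw1 j))⟩

/-- Ordinary and covariant derivatives differ by multiples of the potential and its derivatives,
which are smooth and hence locally bounded. -/
lemma memH2Loc_of_hasCovDeriv {w : Fin 2 → ℂ → ℂ} {u : Fin 2 → Fin 2 → ℂ → ℂ} (hf : MemL2Loc f)
    (hw : ∀ j, MemL2Loc (w j)) (hu : ∀ j k, MemL2Loc (u j k))
    (hfw : ∀ j, HasCovDeriv n j f (w j)) (hwu : ∀ j k, HasCovDeriv n k (w j) (u j k)) :
    MemH2Loc f := by
  have hc := fun j => (contDiff_potential n j).continuous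
  have hd := fun j k => continuous_dtest (contDiff_potential n j) (dir k)
  have hg : ∀ j, MemL2Loc fun x => w j x + I * potential n j x * f x := fun j =>
    (hw j).add (memL2Loc_continuous_mul (hc j) hf I)
  have hwl : ∀ j k, MemL2Loc fun x => u j k x + I * potential n k x * w j x := fun j k =>
    (hu j k).add (memL2Loc_continuous_mul (hc k) (hw j) I)
  refine ⟨hf, fun j x => w j x + I * potential n j x * f x, fun j k x =>
    (u j k x + I * potential n k x * w j x) + (I * potential n j x *
      (w k x + I * potential n k x * f x) + I * (fderiv ℝ (potential n j) x (dir k) : ℝ) * f x),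
    fun j => ⟨hg j, hfw j⟩, fun j k => ⟨?_, ?_⟩⟩
  · exact (hwl j k).add ((memL2Loc_continuous_mul (hc j) (hg k) I).add
      (memL2Loc_continuous_mul (hd j k) hf I))
  · refine (HasWeakDeriv.add (hwu j k)
      ((HasWeakDeriv.mul (hfw k) (contDiff_potential n j)).const_smul I)).congr
      (.of_forall fun x => ?_) (.of_forall fun x => ?_)
    · simp only [Pi.add_apply, Pi.smul_apply, smul_eq_mul]; ring
    · simp only [Pi.add_apply, Pi.smul_apply, smul_eq_mul]; ring

/-- The covariant derivative of a smooth function. -/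
def covDeriv (n : ℕ) (j : Fin 2) (f : ℂ → ℂ) (x : ℂ) : ℂ :=
  fderiv ℝ f x (dir j) - I * potential n j x * f x

lemma contDiff_covDeriv (hf : ContDiff ℝ ∞ f) : ContDiff ℝ ∞ (covDeriv n j f) := by
  have h1 : ContDiff ℝ ∞ fun x => fderiv ℝ f x (dir j) :=
    (hf.fderiv_right (m := ∞) (by simp)).clm_apply contDiff_const
  exact h1.sub ((contDiff_const.mul (ofRealCLM.contDiff.comp (contDiff_potential n j))).mul hf)

lemma hasCovDeriv_covDeriv (hf : ContDiff ℝ ∞ f) : HasCovDeriv n j f (covDeriv n j f) :=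
  HasWeakDeriv.hasCovDeriv (hasWeakDeriv_of_contDiff hf _)

/-- Both sides of the boundary condition are continuous in x, so equality almost everywhere is
equality. -/
lemma isQuasiPeriodic_of_ae (hf : Continuous f) (h : f =ᵐ[volume] qpExt τ n f) :
    IsQuasiPeriodic τ n f := by
  intro t ht
  have hq := qpExt_isQuasiPeriodic τ n f t ht
  have h' := (measurePreserving_add_right volume t).quasiMeasurePreserving.ae h
  have e : (fun x => f (x + t)) =ᵐ[volume] fun x => phase n t x * f x := by
    filter_upwards [h, h'] with x h1 h2
    rw [h2, hq x, ← h1]; rfl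
  exact congrFun (Continuous.ae_eq_iff_eq volume (hf.comp (continuous_add_const t))
    ((contDiff_phase n t).continuous.mul hf) |>.1 e)

lemma isQuasiPeriodic_covDeriv (hf : ContDiff ℝ ∞ f) (hq : IsQuasiPeriodic τ n f) :
    IsQuasiPeriodic τ n (covDeriv n j f) :=
  isQuasiPeriodic_of_ae (contDiff_covDeriv hf).continuous
    ((hasCovDeriv_covDeriv hf).ae_eq_qpExt hq)

/-- Integration by parts over the cell. -/
lemma HasCovDeriv.integral_cell {η : ℂ → ℂ} (h : HasCovDeriv n j f w)
    (hf : IsQuasiPeriodic τ n f) (hw : IsQuasiPeriodic τ n w) (hη : ContDiff ℝ ∞ η)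
    (hηq : IsQuasiPeriodic τ n η) :
    ∫ x in cell τ, (conj (η x) * w x + conj (covDeriv n j η x) * f x) = 0 := by
  have hc : ContDiff ℝ ∞ fun x => conj (η x) := conjCLE.contDiff.comp hη
  -- The product of f with the conjugate of η is lattice periodic. In its weak derivative the two
  -- potential terms cancel, and `integral_cell_weakDeriv` applies.
  have h1 := HasWeakDeriv.mul_complex h hc
  have e : ∀ x, fderiv ℝ (fun x => conj (η x)) x (dir j) = conj (fderiv ℝ η x (dir j)) := by
    intro x
    have := conjCLE.hasFDerivAt.comp x (hη.differentiable (by simp) x).hasFDerivAt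
    have h2 : HasFDerivAt (fun x => conj (η x)) _ x := this
    rw [h2.fderiv]; rfl
  refine integral_cell_weakDeriv τ (h1.congr .rfl (.of_forall fun x => ?_))
    (hηq.periodic_conj_mul hf) ?_
  · simp only [e, covDeriv, map_sub, map_mul, conj_I, conj_ofReal]
    ring
  · intro p x
    have a := hηq.periodic_conj_mul hw p x
    have b := (isQuasiPeriodic_covDeriv (j := j) hη hηq).periodic_conj_mul hf p x
    simp only at a b ⊢
    rw [a, b]

end Cov

end

end MagneticLattice

namespace MagneticLattice

noncomputable section

open scoped ComplexConjugate

/-! ### Extensions of square integrable functions -/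

lemma measurable_latticePart (τ : ℍ) : Measurable (latticePart τ) := by
  have h1 : Measurable fun x => ((⌊coord₁ τ x⌋ : ℤ) : ℂ) :=
    (measurable_from_top (f := fun k : ℤ => (k : ℂ))).comp (continuous_coord₁ τ).measurable.floor
  have h2 : Measurable fun x => ((⌊coord₂ τ x⌋ : ℤ) : ℂ) :=
    (measurable_from_top (f := fun k : ℤ => (k : ℂ))).comp (continuous_coord₂ τ).measurable.floor
  exact (h1.mul_const _).add (h2.mul_const _)

lemma measurable_qpExt (τ : ℍ) (n : ℕ) {f : ℂ → ℂ} (hf : Measurable f) :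
    Measurable (qpExt τ n f) := by
  have h0 := measurable_latticePart τ
  have h1 : Measurable fun x => ((⌊coord₁ τ x⌋ : ℤ) : ℂ) :=
    (measurable_from_top (f := fun k : ℤ => (k : ℂ))).comp (continuous_coord₁ τ).measurable.floor
  have h2 : Measurable fun x => ((⌊coord₂ τ x⌋ : ℤ) : ℂ) :=
    (measurable_from_top (f := fun k : ℤ => (k : ℂ))).comp (continuous_coord₂ τ).measurable.floor
  have h3 : Measurable fun x => ((wedge (latticePart τ x) x : ℝ) : ℂ) :=
    continuous_ofReal.measurable.comp
      (((measurable_re.comp h0).mul measurable_im).sub ((measurable_im.comp h0).mul measurable_re))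
  have h4 : Measurable fun x => I * ((n / 2 : ℂ) * (wedge (latticePart τ x) x : ℂ)
      + Real.pi * n * ⌊coord₁ τ x⌋ * ⌊coord₂ τ x⌋) :=
    ((h3.const_mul _).add ((h1.const_mul _).mul h2)).const_mul I
  exact h4.cexp.mul (hf.comp (measurable_id.sub h0))

lemma measurable_coe_qpExt (τ : ℍ) (n : ℕ) (ψ : CellL2 τ) : Measurable (qpExt τ n ψ) :=
  measurable_qpExt τ n (Lp.stronglyMeasurable ψ).measurable

lemma lintegral_cell_qpExt (τ : ℍ) (n : ℕ) (f : ℂ → ℂ) (p : ℝ) :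
    ∫⁻ x in cell τ, ‖qpExt τ n f x‖ₑ ^ p = ∫⁻ x in cell τ, ‖f x‖ₑ ^ p :=
  setLIntegral_congr_fun (measurableSet_cell τ) fun x hx => by
    simp only [qpExt_eq τ n f hx]

lemma memL2Loc_qpExt (τ : ℍ) (n : ℕ) (ψ : CellL2 τ) : MemL2Loc (qpExt τ n ψ) := by
  intro K hK
  refine ⟨(measurable_coe_qpExt τ n ψ).aestronglyMeasurable, ?_⟩
  obtain ⟨N, hN⟩ := exists_lintegral_le τ hK
  rw [eLpNorm_lt_top_iff_lintegral_rpow_enorm_lt_top (by simp) (by simp)]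
  refine (hN _ ((qpExt_isQuasiPeriodic τ n ψ).periodic_enorm_rpow _)).trans_lt ?_
  rw [lintegral_cell_qpExt]
  exact ENNReal.mul_lt_top (by simp)
    ((eLpNorm_lt_top_iff_lintegral_rpow_enorm_lt_top (by simp) (by simp)).1 (Lp.memLp ψ).2)

lemma MemL2Loc.locallyIntegrable {f : ℂ → ℂ} (h : MemL2Loc f) : LocallyIntegrable f := by
  rw [locallyIntegrable_iff]
  intro K hK
  have : IsFiniteMeasure (volume.restrict K) :=
    ⟨by rw [Measure.restrict_apply_univ]; exact hK.measure_lt_top⟩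
  exact (h K hK).integrable (by norm_num)

lemma integrable_mul_qpExt (τ : ℍ) (n : ℕ) {η : ℂ → ℂ} (hη : Continuous η)
    (hc : HasCompactSupport η) (ψ : CellL2 τ) : Integrable fun x => η x * qpExt τ n ψ x :=
  (memL2Loc_qpExt τ n ψ).locallyIntegrable.integrable_smul_left_of_hasCompactSupport hη hc

/-- Pairing the extension with a continuous compactly supported function is continuous on `L²` of
the cell. -/
lemma exists_pairing (τ : ℍ) (n : ℕ) {η : ℂ → ℂ} (hη : Continuous η) (hc : HasCompactSupport η) :
    ∃ Λ : CellL2 τ →L[ℂ] ℂ, ∀ ψ : CellL2 τ, Λ ψ = ∫ x, η x * qpExt τ n ψ x := by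
  obtain ⟨N, hN⟩ := exists_lintegral_le τ hc.isCompact
  obtain ⟨C, hC⟩ := hη.bounded_above_of_compact_support hc
  have hC0 : 0 ≤ C := (norm_nonneg _).trans (hC 0)
  let L : CellL2 τ →ₗ[ℂ] ℂ :=
    { toFun := fun ψ => ∫ x, η x * qpExt τ n ψ x
      map_add' := by
        intro ψ φ
        rw [← integral_add (integrable_mul_qpExt τ n hη hc ψ) (integrable_mul_qpExt τ n hη hc φ)]
        refine integral_congr_ae ?_
        filter_upwards [qpExt_coe_add τ n ψ φ] with x hx
        rw [hx, Pi.add_apply, mul_add]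
      map_smul' := by
        intro c ψ
        rw [RingHom.id_apply, ← integral_smul]
        refine integral_congr_ae ?_
        filter_upwards [qpExt_coe_smul τ n c ψ] with x hx
        rw [hx, Pi.smul_apply, smul_eq_mul, smul_eq_mul]; ring }
  -- V is the measure of the cell to the power 1 - 1/2, the Hölder constant of the inclusion of L²
  -- in L¹.
  set V : ℝ≥0∞ := (volume.restrict (cell τ)) Set.univ ^ (1 / (1 : ℝ≥0∞).toReal - 1 / (2 : ℝ≥0∞).toReal)
    with hV
  have hVt : V ≠ ⊤ :=
    ENNReal.rpow_ne_top_of_nonneg (by norm_num) (measure_ne_top (volume.restrict (cell τ)) _)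
  refine ⟨L.mkContinuous (C * N * V.toReal) fun ψ => ?_, fun ψ => rfl⟩
  have h1 : ∫⁻ x, ‖η x * qpExt τ n ψ x‖ₑ ≤
      ENNReal.ofReal C * (N * (eLpNorm ψ 2 (volume.restrict (cell τ)) * V)) := by
    calc ∫⁻ x, ‖η x * qpExt τ n ψ x‖ₑ
        = ∫⁻ x in tsupport η, ‖η x * qpExt τ n ψ x‖ₑ := by
          refine (setLIntegral_eq_of_support_subset fun x hx => ?_).symm
          refine subset_tsupport _ fun h => hx ?_
          simp only at h ⊢
          rw [h, zero_mul, enorm_zero]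
      _ ≤ ∫⁻ x in tsupport η, ENNReal.ofReal C * ‖qpExt τ n ψ x‖ₑ := by
          refine lintegral_mono fun x => ?_
          rw [enorm_mul]
          gcongr
          rw [← ofReal_norm]
          exact ENNReal.ofReal_le_ofReal (hC x)
      _ = ENNReal.ofReal C * ∫⁻ x in tsupport η, ‖qpExt τ n ψ x‖ₑ ^ (1 : ℝ) := by
          rw [lintegral_const_mul _ (measurable_coe_qpExt τ n ψ).enorm]
          simp
      _ ≤ ENNReal.ofReal C * (N * ∫⁻ x in cell τ, ‖qpExt τ n ψ x‖ₑ ^ (1 : ℝ)) := by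
          gcongr
          exact hN _ ((qpExt_isQuasiPeriodic τ n ψ).periodic_enorm_rpow _)
      _ ≤ _ := by
          gcongr
          rw [lintegral_cell_qpExt]
          have := eLpNorm_le_eLpNorm_mul_rpow_measure_univ (μ := volume.restrict (cell τ))
            (p := 1) (q := 2) (by norm_num) (Lp.aestronglyMeasurable ψ)
          rw [eLpNorm_one_eq_lintegral_enorm] at this
          simpa [hV] using this
  have h2 : ‖L ψ‖ₑ ≤ ENNReal.ofReal C * (N * (eLpNorm ψ 2 (volume.restrict (cell τ)) * V)) :=
    (enorm_integral_le_lintegral_enorm _).trans h1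
  have h3 := ENNReal.toReal_mono (ENNReal.mul_ne_top (by simp) (ENNReal.mul_ne_top (by simp)
    (ENNReal.mul_ne_top (Lp.eLpNorm_ne_top ψ) hVt))) h2
  rw [toReal_enorm] at h3
  simp only [ENNReal.toReal_mul, ENNReal.toReal_ofReal hC0, ENNReal.toReal_natCast] at h3
  rw [← Lp.norm_def] at h3
  linarith [h3]

/-- The weak covariant derivative is a closed operator in `L²` of the cell. -/
lemma hasCovDeriv_of_tendsto {τ : ℍ} {n : ℕ} {j : Fin 2} {f g : ℕ → CellL2 τ} {u w : CellL2 τ}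
    (h : ∀ N, HasCovDeriv n j (qpExt τ n (f N)) (qpExt τ n (g N)))
    (hf : Filter.Tendsto f Filter.atTop (nhds u)) (hg : Filter.Tendsto g Filter.atTop (nhds w)) :
    HasCovDeriv n j (qpExt τ n u) (qpExt τ n w) := by
  have hcA := (contDiff_potential n j).continuous
  refine ⟨(memL2Loc_qpExt τ n u).locallyIntegrable, ((memL2Loc_qpExt τ n w).add
    (memL2Loc_continuous_mul hcA (memL2Loc_qpExt τ n u) I)).locallyIntegrable,
    fun φ h1 h2 => ?_⟩
  have hcs : ∀ {a : ℂ → ℝ}, HasCompactSupport a → HasCompactSupport fun x => (a x : ℂ) :=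
    fun ha => ha.comp_left ofReal_zero
  have c1 := continuous_ofReal.comp (continuous_dtest h1 (dir j))
  have c2 := continuous_ofReal.comp h1.continuous
  have c3 : Continuous fun x => I * (potential n j x : ℂ) * φ x :=
    (continuous_const.mul (continuous_ofReal.comp hcA)).mul c2
  have s1 := hcs (compact_dtest h2 (dir j))
  have s2 := hcs h2
  have s3 : HasCompactSupport fun x => I * (potential n j x : ℂ) * φ x := s2.mul_left
  obtain ⟨Λ₁, e1⟩ := exists_pairing τ n c1 s1
  obtain ⟨Λ₂, e2⟩ := exists_pairing τ n c2 s2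
  obtain ⟨Λ₃, e3⟩ := exists_pairing τ n c3 s3
  -- For a fixed test function the weak identity is a linear relation between three continuous
  -- functionals on L² of the cell, so it survives limits.
  have key : ∀ ψ χ : CellL2 τ, (∫ x, fderiv ℝ φ x (dir j) • qpExt τ n ψ x =
      -∫ x, φ x • (qpExt τ n χ x + I * potential n j x * qpExt τ n ψ x)) ↔
      Λ₁ ψ = -(Λ₂ χ + Λ₃ ψ) := by
    intro ψ χ
    rw [e1, e2, e3, ← integral_add (integrable_mul_qpExt τ n c2 s2 χ)
      (integrable_mul_qpExt τ n c3 s3 ψ)]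
    have a : ∀ x, φ x • (qpExt τ n χ x + I * potential n j x * qpExt τ n ψ x) =
        (φ x : ℂ) * qpExt τ n χ x + I * potential n j x * φ x * qpExt τ n ψ x := by
      intro x; rw [real_smul]; ring
    simp only [a, Function.comp_apply, real_smul]
  rw [key]
  have hN := fun N => (key (f N) (g N)).1 ((h N).2.2 φ h1 h2)
  refine tendsto_nhds_unique ((Λ₁.continuous.tendsto u).comp hf) ?_
  have := (((Λ₂.continuous.tendsto w).comp hg).add ((Λ₃.continuous.tendsto u).comp hf)).neg
  refine this.congr fun N => ?_
  simp only [Function.comp_apply]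
  exact (hN N).symm

/-! ### Smooth quasi-periodic functions -/

/-- The space of smooth quasi-periodic functions on the plane. -/
def smoothSpace (τ : ℍ) (n : ℕ) : Submodule ℂ (ℂ → ℂ) where
  carrier := {f | ContDiff ℝ ∞ f ∧ IsQuasiPeriodic τ n f}
  zero_mem' := ⟨contDiff_const, fun _ _ _ => by simp⟩
  add_mem' := by
    rintro f g ⟨hf, qf⟩ ⟨hg, qg⟩
    exact ⟨hf.add hg, fun t ht x => by simp only [Pi.add_apply, qf t ht x, qg t ht x, mul_add]⟩
  smul_mem' := by
    rintro c f ⟨hf, qf⟩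
    exact ⟨contDiff_const.smul hf, fun t ht x => by
      simp only [Pi.smul_apply, smul_eq_mul, qf t ht x]; ring⟩

variable {τ : ℍ} {n : ℕ}

lemma differentiable_smooth (u : smoothSpace τ n) : Differentiable ℝ (u : ℂ → ℂ) :=
  u.2.1.differentiable (by simp)

/-- The covariant derivative on smooth quasi-periodic functions. -/
def cov (τ : ℍ) (n : ℕ) (j : Fin 2) : smoothSpace τ n →ₗ[ℂ] smoothSpace τ n where
  toFun u := ⟨covDeriv n j u, contDiff_covDeriv u.2.1, isQuasiPeriodic_covDeriv u.2.1 u.2.2⟩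
  map_add' u v := by
    ext x
    have := fderiv_add (differentiable_smooth u x) (differentiable_smooth v x)
    simp only [covDeriv, Submodule.coe_add, this, Pi.add_apply, add_apply]
    ring
  map_smul' c u := by
    ext x
    have := fderiv_const_smul (differentiable_smooth u x) c
    simp only [covDeriv, Submodule.coe_smul, this, Pi.smul_apply, smul_apply,
      smul_eq_mul, RingHom.id_apply]
    ring

lemma cov_apply (j : Fin 2) (u : smoothSpace τ n) (x : ℂ) :
    (cov τ n j u : ℂ → ℂ) x = fderiv ℝ u x (dir j) - I * potential n j x * (u : ℂ → ℂ) x := rfl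

/-- These off-diagonal derivatives make the curl of the potential equal to n, which is the source of
the commutator. -/
lemma fderiv_potential_dir (n : ℕ) (x : ℂ) :
    fderiv ℝ (potential n 0) x (dir 1) = -(n / 2) ∧ fderiv ℝ (potential n 1) x (dir 0) = n / 2 := by
  constructor
  · have : HasFDerivAt (potential n 0) (-(n / 2 : ℝ) • imCLM) x :=
      (imCLM.hasFDerivAt (x := x)).const_mul (-(n / 2 : ℝ))
    simp [this.fderiv, dir]
  · have : HasFDerivAt (potential n 1) ((n / 2 : ℝ) • reCLM) x :=
      (reCLM.hasFDerivAt (x := x)).const_mul (n / 2 : ℝ)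
    simp [this.fderiv, dir]

lemma cov_cov_apply (j k : Fin 2) (u : smoothSpace τ n) (x : ℂ) :
    (cov τ n k (cov τ n j u) : ℂ → ℂ) x = fderiv ℝ (fderiv ℝ u) x (dir k) (dir j)
      - I * ((fderiv ℝ (potential n j) x (dir k) : ℝ) * (u : ℂ → ℂ) x +
        potential n j x * fderiv ℝ u x (dir k))
      - I * potential n k x * (fderiv ℝ u x (dir j) - I * potential n j x * (u : ℂ → ℂ) x) := by
  have h1 : HasFDerivAt (fun y => fderiv ℝ u y (dir j))
      ((fderiv ℝ (fderiv ℝ (u : ℂ → ℂ)) x).flip (dir j)) x := by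
    have := ((u.2.1.fderiv_right (m := ∞) (by simp)).differentiable (by simp) x).hasFDerivAt
    simpa using this.clm_apply (hasFDerivAt_const (dir j) x)
  have h2 : HasFDerivAt (fun y => (potential n j y : ℂ))
      (ofRealCLM.comp (fderiv ℝ (potential n j) x)) x :=
    ofRealCLM.hasFDerivAt.comp x ((contDiff_potential n j).differentiable (by simp) x).hasFDerivAt
  have h3 := h1.sub ((h2.const_mul I).mul (differentiable_smooth u x).hasFDerivAt)
  rw [cov_apply]
  have e : (cov τ n j u : ℂ → ℂ) = fun y => fderiv ℝ u y (dir j) - I * potential n j y *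
    (u : ℂ → ℂ) y := rfl
  have h4 : fderiv ℝ (cov τ n j u : ℂ → ℂ) x = (fderiv ℝ (fderiv ℝ (u : ℂ → ℂ)) x).flip (dir j) -
      ((I * (potential n j x : ℂ)) • fderiv ℝ (u : ℂ → ℂ) x + (u : ℂ → ℂ) x •
        I • ofRealCLM.comp (fderiv ℝ (potential n j) x)) := by
    rw [e]; exact h3.fderiv
  rw [h4, e]
  simp only [sub_apply, ContinuousLinearMap.flip_apply,
    add_apply, smul_apply, ContinuousLinearMap.comp_apply,
    ofRealCLM_apply, smul_eq_mul]
  ring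

/-- The canonical commutation relation: the magnetic field is constant. -/
lemma cov_comm (u : smoothSpace τ n) :
    cov τ n 0 (cov τ n 1 u) - cov τ n 1 (cov τ n 0 u) = -(I * n) • u := by
  ext x
  have hs : IsSymmSndFDerivAt ℝ (u : ℂ → ℂ) x :=
    u.2.1.contDiffAt.isSymmSndFDerivAt (by simp only [minSmoothness_of_isRCLikeNormedField]; exact WithTop.coe_le_coe.2 le_top)
  have h := hs (dir 0) (dir 1)
  obtain ⟨h1, h2⟩ := fderiv_potential_dir n x
  simp only [Submodule.coe_sub, Pi.sub_apply, Submodule.coe_smul, Pi.smul_apply, cov_cov_apply, h,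
    h1, h2, smul_eq_mul]
  push_cast
  ring

lemma memLp_smooth (u : smoothSpace τ n) : MemLp (u : ℂ → ℂ) 2 (volume.restrict (cell τ)) := by
  refine MemL2Loc.memLp_cell (fun K hK => ?_) τ
  have : IsFiniteMeasure (volume.restrict K) :=
    ⟨by rw [Measure.restrict_apply_univ]; exact hK.measure_lt_top⟩
  obtain ⟨C, hC⟩ := hK.exists_bound_of_continuousOn u.2.1.continuous.continuousOn
  exact MemLp.of_bound u.2.1.continuous.aestronglyMeasurable C
    ((ae_restrict_mem hK.measurableSet).mono hC)

/-- The class in `L²` of the cell of a smooth quasi-periodic function. -/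
def toL2 (τ : ℍ) (n : ℕ) : smoothSpace τ n →ₗ[ℂ] CellL2 τ where
  toFun u := (memLp_smooth u).toLp
  map_add' _ _ := rfl
  map_smul' _ _ := rfl

lemma coe_toL2 (u : smoothSpace τ n) : toL2 τ n u =ᵐ[volume.restrict (cell τ)] (u : ℂ → ℂ) :=
  (memLp_smooth u).coeFn_toLp

lemma qpExt_toL2 (u : smoothSpace τ n) : qpExt τ n (toL2 τ n u) =ᵐ[volume] (u : ℂ → ℂ) := by
  have := qpExt_congr τ n (coe_toL2 u)
  rwa [u.2.2.qpExt_eq_self] at this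

lemma toL2_injective : Function.Injective (toL2 τ n) := by
  intro u v h
  have h1 := (qpExt_toL2 u).symm.trans ((congrArg (fun ψ : CellL2 τ => qpExt τ n ψ) h ▸
    qpExt_toL2 v : qpExt τ n (toL2 τ n u) =ᵐ[volume] (v : ℂ → ℂ)))
  exact Subtype.ext ((Continuous.ae_eq_iff_eq volume u.2.1.continuous v.2.1.continuous).1 h1)

lemma hasCovDeriv_toL2 (j : Fin 2) (u : smoothSpace τ n) :
    HasCovDeriv n j (qpExt τ n (toL2 τ n u)) (qpExt τ n (toL2 τ n (cov τ n j u))) :=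
  (hasCovDeriv_covDeriv u.2.1).congr (qpExt_toL2 u).symm (qpExt_toL2 (cov τ n j u)).symm

lemma inner_toL2 (u : smoothSpace τ n) {ψ : CellL2 τ} {f : ℂ → ℂ}
    (h : ψ =ᵐ[volume.restrict (cell τ)] f) :
    inner ℂ (toL2 τ n u) ψ = ∫ x in cell τ, conj ((u : ℂ → ℂ) x) * f x := by
  rw [L2.inner_def]
  refine integral_congr_ae ?_
  filter_upwards [coe_toL2 u, h] with x h1 h2
  rw [h1, h2, RCLike.inner_apply, mul_comm]

lemma integrableOn_cell_mul {a f : ℂ → ℂ} (ha : Continuous a) (hf : LocallyIntegrable f) :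
    IntegrableOn (fun x => a x * f x) (cell τ) := by
  refine IntegrableOn.mono_set ?_ (cell_subset_closedBall τ)
  exact (hf.integrableOn_isCompact (isCompact_closedBall _ _)).continuousOn_mul ha.continuousOn
    (isCompact_closedBall _ _)

lemma HasCovDeriv.locallyIntegrable {j : Fin 2} {f w : ℂ → ℂ} (h : HasCovDeriv n j f w) :
    LocallyIntegrable w := by
  have h1 := (locallyIntegrable_mul (contDiff_potential n j).continuous h.1).smul (-I)
  refine (h.2.1.add h1).congr (.of_forall fun x => ?_)
  simp only [Pi.add_apply, Pi.smul_apply, smul_eq_mul]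
  ring

lemma HasCovDeriv.integral_cov {j : Fin 2} {f w : ℂ → ℂ} (h : HasCovDeriv n j f w)
    (hf : IsQuasiPeriodic τ n f) (hw : IsQuasiPeriodic τ n w) (u : smoothSpace τ n) :
    ∫ x in cell τ, conj ((u : ℂ → ℂ) x) * w x =
      -∫ x in cell τ, conj ((cov τ n j u : ℂ → ℂ) x) * f x := by
  have := h.integral_cell hf hw u.2.1 u.2.2
  rw [integral_add] at this
  · exact eq_neg_of_add_eq_zero_left this
  · exact integrableOn_cell_mul (continuous_conj.comp u.2.1.continuous) h.locallyIntegrable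
  · exact integrableOn_cell_mul (continuous_conj.comp (cov τ n j u).2.1.continuous) h.1

/-- Each covariant derivative is skew-symmetric: quasi-periodicity makes the boundary terms cancel.
-/
lemma inner_cov (j : Fin 2) (u v : smoothSpace τ n) :
    inner ℂ (toL2 τ n (cov τ n j u)) (toL2 τ n v) =
      -inner ℂ (toL2 τ n u) (toL2 τ n (cov τ n j v)) := by
  rw [inner_toL2 _ (coe_toL2 v), inner_toL2 _ (coe_toL2 (cov τ n j v))]
  have := (hasCovDeriv_covDeriv (n := n) (j := j) v.2.1).integral_cov v.2.2 (cov τ n j v).2.2 u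
  rw [← neg_eq_iff_eq_neg]
  exact this.symm

/-- The magnetic Laplacian on smooth quasi-periodic functions. -/
def lap (τ : ℍ) (n : ℕ) : smoothSpace τ n →ₗ[ℂ] smoothSpace τ n :=
  -(cov τ n 0 ∘ₗ cov τ n 0 + cov τ n 1 ∘ₗ cov τ n 1)

lemma lap_apply (u : smoothSpace τ n) :
    lap τ n u = -(cov τ n 0 (cov τ n 0 u) + cov τ n 1 (cov τ n 1 u)) := rfl

/-- Two weak integrations by parts put all derivatives on the smooth u. Taken at an eigenfunction u,
this shows that the operator is diagonal on all of its domain, not only on smooth functions. -/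
lemma inner_magneticOperator (u : smoothSpace τ n) (ψ : (magneticOperator τ n).domain) :
    inner ℂ (toL2 τ n u) (magneticOperator τ n ψ) =
      inner ℂ (toL2 τ n (lap τ n u)) (ψ : CellL2 τ) := by
  have hψ : MemH2Loc (qpExt τ n (ψ : CellL2 τ)) := ψ.2
  have hq := qpExt_isQuasiPeriodic τ n (ψ : CellL2 τ)
  obtain ⟨w, v, hw, hv, hfw, hwv⟩ := hψ.exists_hasCovDeriv hq
  have h1 : magneticOperator τ n ψ =ᵐ[volume.restrict (cell τ)] fun x => -(v 0 x + v 1 x) :=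
    (MemLp.coeFn_toLp ((MemH2Loc.negMagneticLaplacian n hψ).memLp_cell τ)).trans
      (ae_restrict_of_ae (HasCovDeriv.negMagneticLaplacian_ae hfw hwv))
  have h2 : (ψ : CellL2 τ) =ᵐ[volume.restrict (cell τ)] qpExt τ n (ψ : CellL2 τ) := by
    filter_upwards [ae_restrict_mem (measurableSet_cell τ)] with x hx
    rw [qpExt_eq τ n _ hx]
  rw [inner_toL2 u h1, inner_toL2 _ h2]
  have hc : ∀ u : smoothSpace τ n, Continuous fun x => conj ((u : ℂ → ℂ) x) := fun u =>
    continuous_conj.comp u.2.1.continuous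
  have e1 : ∫ x in cell τ, conj ((u : ℂ → ℂ) x) * -(v 0 x + v 1 x) =
      -(∫ x in cell τ, conj ((u : ℂ → ℂ) x) * v 0 x) -
        ∫ x in cell τ, conj ((u : ℂ → ℂ) x) * v 1 x := by
    rw [← integral_neg, ← integral_sub]
    · congr 1; ext x; ring
    · exact (integrableOn_cell_mul (hc u) (hwv 0).locallyIntegrable).neg
    · exact integrableOn_cell_mul (hc u) (hwv 1).locallyIntegrable
  have e2 : ∫ x in cell τ, conj ((lap τ n u : ℂ → ℂ) x) * qpExt τ n (ψ : CellL2 τ) x =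
      -(∫ x in cell τ, conj ((cov τ n 0 (cov τ n 0 u) : ℂ → ℂ) x) * qpExt τ n (ψ : CellL2 τ) x) -
        ∫ x in cell τ, conj ((cov τ n 1 (cov τ n 1 u) : ℂ → ℂ) x) *
          qpExt τ n (ψ : CellL2 τ) x := by
    rw [← integral_neg, ← integral_sub]
    · congr 1; ext x
      simp only [lap_apply, Submodule.coe_neg, Submodule.coe_add, Pi.neg_apply, Pi.add_apply,
        map_neg, map_add]
      ring
    · exact (integrableOn_cell_mul (hc _) (hfw 0).1).neg
    · exact integrableOn_cell_mul (hc _) (hfw 0).1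
  have e3 : ∀ j, ∫ x in cell τ, conj ((u : ℂ → ℂ) x) * v j x =
      ∫ x in cell τ, conj ((cov τ n j (cov τ n j u) : ℂ → ℂ) x) * qpExt τ n (ψ : CellL2 τ) x := by
    intro j
    rw [(hwv j).integral_cov (hw j) (hv j) u, (hfw j).integral_cov hq (hw j) (cov τ n j u), neg_neg]
  rw [e1, e2, e3, e3]

end

end MagneticLattice

namespace MagneticLattice

noncomputable section

open scoped ComplexConjugate

variable {τ : ℍ} {n : ℕ}

/-! ### A priori estimates and the domain of the operator -/

lemma inner_lap (u v : smoothSpace τ n) :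
    inner ℂ (toL2 τ n (lap τ n u)) (toL2 τ n v) = inner ℂ (toL2 τ n u) (toL2 τ n (lap τ n v)) := by
  simp only [lap_apply, map_neg, map_add, inner_neg_left, inner_neg_right, inner_add_left,
    inner_add_right, inner_cov, neg_neg]

/-- The energy identity, from skew-symmetry of the covariant derivatives. It bounds the first
derivatives, and applied to ∇ⱼu also the second ones. -/
lemma sum_norm_cov (u : smoothSpace τ n) :
    ((‖toL2 τ n (cov τ n 0 u)‖ ^ 2 + ‖toL2 τ n (cov τ n 1 u)‖ ^ 2 : ℝ) : ℂ) =
      inner ℂ (toL2 τ n u) (toL2 τ n (lap τ n u)) := by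
  push_cast
  rw [← RCLike.ofReal_eq_complex_ofReal, ← inner_self_eq_norm_sq_to_K,
    ← inner_self_eq_norm_sq_to_K, inner_cov, inner_cov]
  simp only [lap_apply, map_neg, map_add, inner_neg_right, inner_add_right]
  ring

lemma sum_norm_cov_le (u : smoothSpace τ n) :
    ‖toL2 τ n (cov τ n 0 u)‖ ^ 2 + ‖toL2 τ n (cov τ n 1 u)‖ ^ 2 ≤
      ‖toL2 τ n u‖ * ‖toL2 τ n (lap τ n u)‖ := by
  have h := congrArg norm (sum_norm_cov u)
  rw [norm_real, Real.norm_of_nonneg (by positivity)] at h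
  rw [h]
  exact norm_inner_le_norm _ _

lemma cov_zero_one (u : smoothSpace τ n) :
    cov τ n 0 (cov τ n 1 u) = cov τ n 1 (cov τ n 0 u) - (I * n) • u := by
  have := cov_comm u
  rw [sub_eq_iff_eq_add] at this
  rw [this]; module

/-- The field is constant, so commuting the Laplacian past a covariant derivative costs only a
first-order term. -/
lemma lap_cov_zero (u : smoothSpace τ n) :
    lap τ n (cov τ n 0 u) = cov τ n 0 (lap τ n u) - (2 * I * n) • cov τ n 1 u := by
  simp only [lap_apply, map_neg, map_add, map_sub, map_smul, cov_zero_one]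
  module

lemma lap_cov_one (u : smoothSpace τ n) :
    lap τ n (cov τ n 1 u) = cov τ n 1 (lap τ n u) + (2 * I * n) • cov τ n 0 u := by
  simp only [lap_apply, map_neg, map_add, map_sub, map_smul, cov_zero_one]
  module

/-- The energy identity is applied to ∇₀u and ∇₁u and the Laplacian is commuted outwards. The
leading part is ‖Lu‖². The two commutator terms are each at most 2n‖∇₀u‖‖∇₁u‖, and this product of
norms is controlled by the energy identity for u. -/
lemma sum_norm_cov_cov_le (u : smoothSpace τ n) :
    ‖toL2 τ n (cov τ n 0 (cov τ n 0 u))‖ ^ 2 + ‖toL2 τ n (cov τ n 1 (cov τ n 0 u))‖ ^ 2 +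
      (‖toL2 τ n (cov τ n 0 (cov τ n 1 u))‖ ^ 2 + ‖toL2 τ n (cov τ n 1 (cov τ n 1 u))‖ ^ 2) ≤
      ‖toL2 τ n (lap τ n u)‖ ^ 2 + 4 * n * (‖toL2 τ n u‖ * ‖toL2 τ n (lap τ n u)‖) := by
  have h := congrArg₂ (· + ·) (sum_norm_cov (cov τ n 0 u)) (sum_norm_cov (cov τ n 1 u))
  simp only [← ofReal_add, lap_cov_zero, lap_cov_one, map_sub, map_add, map_smul, inner_sub_right,
    inner_add_right, inner_smul_right] at h
  have e : inner ℂ (toL2 τ n (cov τ n 0 u)) (toL2 τ n (cov τ n 0 (lap τ n u))) +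
      inner ℂ (toL2 τ n (cov τ n 1 u)) (toL2 τ n (cov τ n 1 (lap τ n u))) =
      inner ℂ (toL2 τ n (lap τ n u)) (toL2 τ n (lap τ n u)) := by
    have hl : ∀ w, inner ℂ (toL2 τ n (lap τ n u)) w =
        -(inner ℂ (toL2 τ n (cov τ n 0 (cov τ n 0 u))) w +
          inner ℂ (toL2 τ n (cov τ n 1 (cov τ n 1 u))) w) := by
      intro w
      simp only [lap_apply, map_neg, map_add, inner_neg_left, inner_add_left]
    rw [hl, inner_cov 0 (cov τ n 0 u), inner_cov 1 (cov τ n 1 u)]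
    ring
  have h' := h.trans (show _ = inner ℂ (toL2 τ n (lap τ n u)) (toL2 τ n (lap τ n u)) +
      (-(2 * I * n * inner ℂ (toL2 τ n (cov τ n 0 u)) (toL2 τ n (cov τ n 1 u))) +
      2 * I * n * inner ℂ (toL2 τ n (cov τ n 1 u)) (toL2 τ n (cov τ n 0 u))) by rw [← e]; ring)
  have h2 := congrArg norm h'
  rw [norm_real, Real.norm_of_nonneg (by positivity)] at h2
  rw [h2]
  have hc : ‖(2 * I * n : ℂ)‖ = 2 * n := by simp
  have hab : ‖toL2 τ n (cov τ n 0 u)‖ * ‖toL2 τ n (cov τ n 1 u)‖ ≤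
      ‖toL2 τ n u‖ * ‖toL2 τ n (lap τ n u)‖ := by
    nlinarith [sum_norm_cov_le u, sq_nonneg (‖toL2 τ n (cov τ n 0 u)‖ - ‖toL2 τ n (cov τ n 1 u)‖),
      norm_nonneg (toL2 τ n (cov τ n 0 u)), norm_nonneg (toL2 τ n (cov τ n 1 u))]
  have i1 := norm_inner_le_norm (𝕜 := ℂ) (toL2 τ n (lap τ n u)) (toL2 τ n (lap τ n u))
  have i2 := norm_inner_le_norm (𝕜 := ℂ) (toL2 τ n (cov τ n 0 u)) (toL2 τ n (cov τ n 1 u))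
  have i3 := norm_inner_le_norm (𝕜 := ℂ) (toL2 τ n (cov τ n 1 u)) (toL2 τ n (cov τ n 0 u))
  have hn : (0 : ℝ) ≤ 2 * n := by positivity
  refine (norm_add_le _ _).trans ?_
  refine (add_le_add i1 (norm_add_le _ _)).trans ?_
  rw [norm_neg, norm_mul (2 * I * (n : ℂ)), norm_mul (2 * I * (n : ℂ)), hc]
  have j2 := mul_le_mul_of_nonneg_left (i2.trans hab) hn
  have j3 := mul_le_mul_of_nonneg_left (i3.trans ((mul_comm _ _).trans_le hab)) hn
  linarith

/-- The graph norm of the magnetic Laplacian controls the first covariant derivatives. -/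
lemma norm_cov_le (j : Fin 2) (u : smoothSpace τ n) :
    ‖toL2 τ n (cov τ n j u)‖ ≤ (1 + 4 * n) * (‖toL2 τ n u‖ + ‖toL2 τ n (lap τ n u)‖) := by
  have h1 := sum_norm_cov_le u
  have a := norm_nonneg (toL2 τ n u)
  have b := norm_nonneg (toL2 τ n (lap τ n u))
  have hn : (0 : ℝ) ≤ n := by positivity
  -- Here the constant 1 is enough; the factor 1 + 4n only matches the bound for second derivatives.
  have h2 : ‖toL2 τ n (cov τ n j u)‖ ≤ ‖toL2 τ n u‖ + ‖toL2 τ n (lap τ n u)‖ := by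
    refine abs_le_of_sq_le_sq' ?_ (by positivity) |>.2
    fin_cases j
    · simp only [Fin.zero_eta]
      nlinarith [sq_nonneg ‖toL2 τ n (cov τ n 1 u)‖, mul_nonneg a b]
    · simp only [Fin.mk_one]
      nlinarith [sq_nonneg ‖toL2 τ n (cov τ n 0 u)‖, mul_nonneg a b]
  nlinarith [mul_nonneg hn (add_nonneg a b)]

/-- The graph norm of the magnetic Laplacian controls the second covariant derivatives. -/
lemma norm_cov_cov_le (j k : Fin 2) (u : smoothSpace τ n) :
    ‖toL2 τ n (cov τ n k (cov τ n j u))‖ ≤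
      (1 + 4 * n) * (‖toL2 τ n u‖ + ‖toL2 τ n (lap τ n u)‖) := by
  have h1 := sum_norm_cov_cov_le u
  have a := norm_nonneg (toL2 τ n u)
  have b := norm_nonneg (toL2 τ n (lap τ n u))
  have hn : (0 : ℝ) ≤ n := by positivity
  have hab := mul_nonneg a b
  have h2 : ‖toL2 τ n (lap τ n u)‖ ^ 2 + 4 * n * (‖toL2 τ n u‖ * ‖toL2 τ n (lap τ n u)‖) ≤
      ((1 + 4 * n) * (‖toL2 τ n u‖ + ‖toL2 τ n (lap τ n u)‖)) ^ 2 := by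
    have h3 : ‖toL2 τ n (lap τ n u)‖ ^ 2 + 4 * n * (‖toL2 τ n u‖ * ‖toL2 τ n (lap τ n u)‖) ≤
        (1 + 4 * n) * (‖toL2 τ n u‖ + ‖toL2 τ n (lap τ n u)‖) ^ 2 := by
      nlinarith [mul_nonneg hn (sq_nonneg ‖toL2 τ n (lap τ n u)‖),
        mul_nonneg hn (sq_nonneg ‖toL2 τ n u‖), mul_nonneg hn hab]
    refine h3.trans ?_
    rw [mul_pow]
    refine mul_le_mul_of_nonneg_right ?_ (by positivity)
    nlinarith
  refine abs_le_of_sq_le_sq' (le_trans ?_ (h1.trans h2)) (by positivity) |>.2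
  have p00 := sq_nonneg ‖toL2 τ n (cov τ n 0 (cov τ n 0 u))‖
  have p10 := sq_nonneg ‖toL2 τ n (cov τ n 1 (cov τ n 0 u))‖
  have p01 := sq_nonneg ‖toL2 τ n (cov τ n 0 (cov τ n 1 u))‖
  have p11 := sq_nonneg ‖toL2 τ n (cov τ n 1 (cov τ n 1 u))‖
  fin_cases j <;> fin_cases k <;> simp only [Fin.zero_eta, Fin.mk_one] <;> linarith

/-- By linearity the estimate for P applies to the differences `v a - v b`, so sequences that are
Cauchy in the graph norm have Cauchy images under P. -/
lemma cauchySeq_toL2 {P : smoothSpace τ n →ₗ[ℂ] smoothSpace τ n} {C : ℝ}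
    (hP : ∀ u, ‖toL2 τ n (P u)‖ ≤ C * (‖toL2 τ n u‖ + ‖toL2 τ n (lap τ n u)‖))
    {v : ℕ → smoothSpace τ n} (h1 : CauchySeq fun N => toL2 τ n (v N))
    (h2 : CauchySeq fun N => toL2 τ n (lap τ n (v N))) : CauchySeq fun N => toL2 τ n (P (v N)) := by
  rw [Metric.cauchySeq_iff] at h1 h2 ⊢
  intro ε hε
  have hC : 0 < 2 * (|C| + 1) := by positivity
  obtain ⟨N1, hN1⟩ := h1 (ε / (2 * (|C| + 1))) (by positivity)
  obtain ⟨N2, hN2⟩ := h2 (ε / (2 * (|C| + 1))) (by positivity)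
  refine ⟨max N1 N2, fun a ha b hb => ?_⟩
  have d1 := hN1 a (le_of_max_le_left ha) b (le_of_max_le_left hb)
  have d2 := hN2 a (le_of_max_le_right ha) b (le_of_max_le_right hb)
  have h3 := hP (v a - v b)
  rw [dist_eq_norm, ← map_sub] at d1 d2
  rw [← map_sub] at d2
  rw [dist_eq_norm, ← map_sub, ← map_sub]
  rw [lt_div_iff₀ hC] at d1 d2
  set A := ‖toL2 τ n (v a - v b)‖
  set B := ‖toL2 τ n (lap τ n (v a - v b))‖
  have hA : 0 ≤ A := norm_nonneg _
  have hB : 0 ≤ B := norm_nonneg _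
  have h4 : C * (A + B) ≤ (|C| + 1) * (A + B) :=
    mul_le_mul_of_nonneg_right ((le_abs_self C).trans (by linarith)) (by positivity)
  linarith

/-- The closure of the magnetic Laplacian on smooth quasi-periodic functions has its domain in the
Sobolev space. -/
theorem mem_quasiPeriodicH2_of_closure {u w : CellL2 τ}
    (h : (u, w) ∈ closure (Set.range fun v : smoothSpace τ n =>
      (toL2 τ n v, toL2 τ n (lap τ n v)))) : u ∈ quasiPeriodicH2 τ n := by
  obtain ⟨x, hx, hlim⟩ := mem_closure_iff_seq_limit.1 h
  choose v hv using hx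
  have l1 : Filter.Tendsto (fun N => toL2 τ n (v N)) Filter.atTop (nhds u) := by
    refine ((continuous_fst.tendsto _).comp hlim).congr fun N => ?_
    rw [Function.comp_apply, ← hv N]
  have l2 : Filter.Tendsto (fun N => toL2 τ n (lap τ n (v N))) Filter.atTop (nhds w) := by
    refine ((continuous_snd.tendsto _).comp hlim).congr fun N => ?_
    rw [Function.comp_apply, ← hv N]
  -- By the a priori estimates the first and second covariant derivatives of the approximants
  -- converge. By closedness the limits are the weak covariant derivatives of u.
  have c1 := fun j => cauchySeq_tendsto_of_complete
    (cauchySeq_toL2 (norm_cov_le j) l1.cauchySeq l2.cauchySeq)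
  have c2 := fun j k => cauchySeq_tendsto_of_complete
    (cauchySeq_toL2 (P := cov τ n k ∘ₗ cov τ n j) (norm_cov_cov_le j k) l1.cauchySeq l2.cauchySeq)
  choose f hf using c1
  choose g hg using c2
  exact memH2Loc_of_hasCovDeriv (memL2Loc_qpExt τ n u) (fun j => memL2Loc_qpExt τ n (f j))
    (fun j k => memL2Loc_qpExt τ n (g j k))
    (fun j => hasCovDeriv_of_tendsto (fun N => hasCovDeriv_toL2 j (v N)) l1 (hf j))
    (fun j k => hasCovDeriv_of_tendsto (fun N => hasCovDeriv_toL2 k (cov τ n j (v N))) (hf j)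
      (hg j k))

/-- A Hilbert basis of smooth eigenfunctions diagonalizes the magnetic operator. -/
theorem isDiagonalIn_magneticOperator {ι : Type*} (b : HilbertBasis ι ℂ (CellL2 τ)) (ev : ι → ℝ)
    (h : ∀ i, ∃ v : smoothSpace τ n, toL2 τ n v = b i ∧ lap τ n v = (ev i : ℂ) • v) :
    IsDiagonalIn (magneticOperator τ n) b ev := by
  choose v hv hev using h
  refine ⟨fun i x => ?_, fun u w huw => ?_⟩
  · rw [← hv i, inner_magneticOperator, hev, map_smul, inner_smul_left, conj_ofReal]
  · refine mem_quasiPeriodicH2_of_closure (n := n) (w := w) ?_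
    -- The partial sums of the expansion of u are smooth, and the relation between coefficients
    -- makes their Laplacians the partial sums of the expansion of w.
    refine mem_closure_of_tendsto ((b.hasSum_repr u).prodMk (b.hasSum_repr w))
      (.of_forall fun s => ⟨∑ i ∈ s, b.repr u i • v i, ?_⟩)
    refine Prod.ext ?_ ?_
    · rw [Prod.fst_sum]
      simp only [map_sum, map_smul, hv]
    · rw [Prod.snd_sum]
      simp only [map_sum, map_smul, hv, hev]
      refine Finset.sum_congr rfl fun i _ => ?_
      rw [b.repr_apply_apply, b.repr_apply_apply, huw, smul_smul, mul_comm]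

/-! ### Ladder operators -/

/-- The creation operator. -/
def up (τ : ℍ) (n : ℕ) : smoothSpace τ n →ₗ[ℂ] smoothSpace τ n := cov τ n 0 - I • cov τ n 1

/-- The annihilation operator. -/
def down (τ : ℍ) (n : ℕ) : smoothSpace τ n →ₗ[ℂ] smoothSpace τ n := cov τ n 0 + I • cov τ n 1

lemma up_apply (u : smoothSpace τ n) : up τ n u = cov τ n 0 u - I • cov τ n 1 u := rfl

lemma down_apply (u : smoothSpace τ n) : down τ n u = cov τ n 0 u + I • cov τ n 1 u := rfl

/-- In the product the pure second derivatives give -L and the commutator of the mixed ones gives n.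
In the opposite order the commutator changes sign. -/
lemma up_down (u : smoothSpace τ n) : up τ n (down τ n u) = (n : ℂ) • u - lap τ n u := by
  simp only [up_apply, down_apply, lap_apply, map_add, map_smul, cov_zero_one]
  match_scalars <;> ring_nf <;> simp only [I_sq] <;> ring

lemma down_up (u : smoothSpace τ n) : down τ n (up τ n u) = -(n : ℂ) • u - lap τ n u := by
  simp only [up_apply, down_apply, lap_apply, map_sub, map_smul, cov_zero_one]
  match_scalars <;> ring_nf <;> simp only [I_sq] <;> ring

lemma lap_of_down_eq_zero {u : smoothSpace τ n} (h : down τ n u = 0) :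
    lap τ n u = (n : ℂ) • u := by
  have := up_down u
  rw [h, map_zero] at this
  exact (sub_eq_zero.1 this.symm).symm

/-- The product up ∘ down ∘ up is evaluated by `up_down` and by `down_up`; the two constants ±n
differ by 2n. -/
lemma lap_up (u : smoothSpace τ n) :
    lap τ n (up τ n u) = up τ n (lap τ n u) + (2 * n : ℂ) • up τ n u := by
  have h1 := up_down (up τ n u)
  rw [down_up, map_sub, map_smul] at h1
  linear_combination (norm := module) h1

lemma lap_up_pow {u : smoothSpace τ n} (h : down τ n u = 0) (m : ℕ) :
    lap τ n ((up τ n ^ m) u) = ((2 * m + 1) * n : ℂ) • (up τ n ^ m) u := by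
  induction m with
  | zero => simp [lap_of_down_eq_zero h]
  | succ m ih =>
    rw [pow_succ', Module.End.mul_apply, lap_up, ih, map_smul, ← add_smul]
    congr 1; push_cast; ring

/-- At level m, `down` after `up` is multiplication by -(2m+2)n, which is nonzero, so each step up
the ladder can be undone. -/
lemma up_pow_injective (hn : 0 < n) {u : smoothSpace τ n} (h : down τ n u = 0) {m : ℕ}
    (hu : (up τ n ^ m) u = 0) : u = 0 := by
  induction m with
  | zero => simpa using hu
  | succ m ih =>
    apply ih
    rw [pow_succ', Module.End.mul_apply] at hu
    have := down_up ((up τ n ^ m) u)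
    rw [hu, map_zero, lap_up_pow h] at this
    have h0 : (-(n : ℂ) - (2 * m + 1) * n) • (up τ n ^ m) u = 0 := by
      linear_combination (norm := module) -this
    refine (smul_eq_zero.1 h0).resolve_left ?_
    have e : -(n : ℂ) - (2 * m + 1) * n = -(((2 * m + 2) * n : ℕ) : ℂ) := by push_cast; ring
    rw [e, neg_eq_zero, Nat.cast_eq_zero]
    positivity

end

end MagneticLattice

namespace MagneticLattice

noncomputable section

open scoped ComplexConjugate

variable {τ : ℍ} {n : ℕ}

/-! ### Convergence of the theta series -/

/-- The length of the dual lattice vector, `√(2π Im τ) = 2π / r`. -/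
def dualScale (τ : ℍ) : ℝ := √(2 * Real.pi * τ.im)

lemma dualScale_eq (τ : ℍ) : dualScale τ = scale τ * τ.im := by
  have h := τ.im_pos
  have h' := (scale_pos τ).le
  rw [dualScale, Real.sqrt_eq_iff_mul_self_eq (by positivity) (by positivity)]
  rw [← scale_sq τ]; ring

lemma dualScale_mul_scale (τ : ℍ) : dualScale τ * scale τ = 2 * Real.pi := by
  rw [dualScale_eq, ← scale_sq τ]; ring

/-- The Gaussian solution of the coefficient relation. -/
def gaussCoeff (τ : ℍ) (n : ℕ) (k : ℤ) : ℂ := Complex.exp (Real.pi * I * k ^ 2 * (τ / n))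

lemma gaussCoeff_ne_zero (k : ℤ) : gaussCoeff τ n k ≠ 0 := Complex.exp_ne_zero _

lemma gaussCoeff_add (hn : 0 < n) (k : ℤ) : gaussCoeff τ n (k + n) =
    Complex.exp (I * n * Real.pi * τ) * Complex.exp (2 * k * I * Real.pi * τ) *
      gaussCoeff τ n k := by
  have h : (n : ℂ) ≠ 0 := by exact_mod_cast hn.ne'
  rw [gaussCoeff, gaussCoeff, ← Complex.exp_add, ← Complex.exp_add]
  congr 1
  push_cast
  field_simp
  ring

/-- Dividing a linear recurrence by a nowhere vanishing particular solution leaves periodicity. This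
gives both the dimension n and the growth of the coefficients. -/
lemma thetaRelation_iff_periodic (hn : 0 < n) (c : ℤ → ℂ) :
    ThetaRelation τ n c ↔ Function.Periodic (fun k => c k / gaussCoeff τ n k) (n : ℤ) := by
  refine forall_congr' fun k => ?_
  have h1 := gaussCoeff_ne_zero (τ := τ) (n := n) k
  have h2 := gaussCoeff_ne_zero (τ := τ) (n := n) (k + n)
  rw [div_eq_div_iff h2 h1]
  constructor
  · intro h
    rw [h, gaussCoeff_add hn]; ring
  · intro h
    refine mul_right_cancel₀ h1 ?_
    rw [h, gaussCoeff_add hn]; ring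

/-- The space of coefficient sequences of theta series. -/
def thetaSpace (τ : ℍ) (n : ℕ) : Submodule ℂ (ℤ → ℂ) where
  carrier := {c | ThetaRelation τ n c}
  zero_mem' := fun k => by simp
  add_mem' := fun {c d} hc hd k => by simp only [Pi.add_apply, hc k, hd k, mul_add]
  smul_mem' := fun a c hc k => by simp only [Pi.smul_apply, hc k, smul_eq_mul]; ring

lemma mem_thetaSpace_iff {c : ℤ → ℂ} : c ∈ thetaSpace τ n ↔ ThetaRelation τ n c := Iff.rfl

lemma periodic_apply_emod {α : Type*} {f : ℤ → α} (hf : Function.Periodic f (n : ℤ)) (k : ℤ) :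
    f (k % n) = f k := by
  rw [Int.emod_def, mul_comm]
  exact hf.sub_int_mul_eq _

/-- A coefficient sequence is determined by its quotients with the Gaussian coefficients, which are
periodic modulo `n`. -/
def thetaSpaceEquiv (hn : 0 < n) : thetaSpace τ n ≃ₗ[ℂ] (Fin n → ℂ) where
  toFun c j := (c : ℤ → ℂ) j / gaussCoeff τ n j
  map_add' c d := by ext j; simp [add_div]
  map_smul' a c := by ext j; simp [mul_div_assoc]
  invFun d := ⟨fun k => d ⟨(k % n).toNat, by
      have := Int.emod_lt_of_pos k (by exact_mod_cast hn : (0 : ℤ) < n)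
      have := Int.emod_nonneg k (by exact_mod_cast hn.ne' : (n : ℤ) ≠ 0)
      omega⟩ * gaussCoeff τ n k, by
    refine mem_thetaSpace_iff.2 ((thetaRelation_iff_periodic hn _).2 fun k => ?_)
    simp [mul_div_cancel_right₀ _ (gaussCoeff_ne_zero _)]⟩
  left_inv c := by
    ext k
    have hp := (thetaRelation_iff_periodic hn _).1 c.2
    have h0 := Int.emod_nonneg k (by exact_mod_cast hn.ne' : (n : ℤ) ≠ 0)
    have := periodic_apply_emod hp k
    simp only [Int.toNat_of_nonneg h0] at this ⊢
    rw [this, div_mul_cancel₀ _ (gaussCoeff_ne_zero _)]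
  right_inv d := by
    ext j
    simp only
    rw [mul_div_cancel_right₀ _ (gaussCoeff_ne_zero _)]
    congr 1
    ext
    have : (j : ℤ) % n = j := Int.emod_eq_of_lt (by positivity) (by exact_mod_cast j.2)
    simp [this]

lemma ThetaRelation.exists_bound (hn : 0 < n) {c : ℤ → ℂ} (hc : ThetaRelation τ n c) :
    ∃ C, ∀ k, ‖c k / gaussCoeff τ n k‖ ≤ C := by
  have hp := (thetaRelation_iff_periodic hn c).1 hc
  refine ⟨∑ j ∈ Finset.Ico (0 : ℤ) n, ‖c j / gaussCoeff τ n j‖, fun k => ?_⟩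
  rw [← periodic_apply_emod hp k]
  refine Finset.single_le_sum (f := fun j => ‖c j / gaussCoeff τ n j‖) (fun _ _ => norm_nonneg _) ?_
  rw [Finset.mem_Ico]
  exact ⟨Int.emod_nonneg k (by exact_mod_cast hn.ne'), Int.emod_lt_of_pos k (by exact_mod_cast hn)⟩

/-- This compares the series with Jacobi's theta series at modular parameter τ/n, whose terms have
summable bounds; the quotients in front are bounded. -/
lemma thetaTerm_eq (c : ℤ → ℂ) (z : ℂ) (k : ℤ) : thetaTerm τ c z k =
    c k / gaussCoeff τ n k * jacobiTheta₂_term k (dualScale τ * z / (2 * Real.pi)) (τ / n) := by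
  have hpi : (Real.pi : ℂ) ≠ 0 := by exact_mod_cast Real.pi_ne_zero
  have h : jacobiTheta₂_term k (dualScale τ * z / (2 * Real.pi)) (τ / n) =
      gaussCoeff τ n k * Complex.exp (k * I * dualScale τ * z) := by
    rw [jacobiTheta₂_term, gaussCoeff, ← Complex.exp_add]
    congr 1
    field_simp
    ring
  rw [h, thetaTerm, dualScale, ← mul_assoc, div_mul_cancel₀ _ (gaussCoeff_ne_zero _)]

lemma im_div_pos (hn : 0 < n) : 0 < ((τ : ℂ) / n).im := by
  have h := τ.im_pos
  have : ((τ : ℂ) / n).im = τ.im / n := by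
    rw [← ofReal_natCast, div_ofReal_im]; rfl
  rw [this]; positivity

/-- The bound is uniform on horizontal strips, so it gives absolute convergence, holomorphy and
integration term by term along the real axis. -/
lemma ThetaRelation.exists_majorant (hn : 0 < n) {c : ℤ → ℂ} (hc : ThetaRelation τ n c) (M : ℝ) :
    ∃ u : ℤ → ℝ, Summable u ∧ ∀ k z, |z.im| ≤ M → ‖thetaTerm τ c z k‖ ≤ u k := by
  obtain ⟨C, hC⟩ := hc.exists_bound hn
  have hT := im_div_pos (τ := τ) hn
  set S : ℝ := dualScale τ / (2 * Real.pi) * M with hS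
  have hs := (summable_pow_mul_jacobiTheta₂_term_bound S hT 0).mul_left C
  refine ⟨_, hs, fun k z hz => ?_⟩
  rw [thetaTerm_eq (n := n), norm_mul]
  have hd : 0 ≤ dualScale τ / (2 * Real.pi) := by
    have := Real.pi_pos
    have : 0 ≤ dualScale τ := Real.sqrt_nonneg _
    positivity
  have him : |((dualScale τ * z / (2 * Real.pi) : ℂ)).im| ≤ S := by
    have e : (dualScale τ * z / (2 * Real.pi) : ℂ) = ((dualScale τ / (2 * Real.pi) : ℝ) : ℂ) * z := by
      push_cast; ring
    rw [e, im_ofReal_mul, abs_mul, abs_of_nonneg hd, hS]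
    exact mul_le_mul_of_nonneg_left hz hd
  have h := norm_jacobiTheta₂_term_le hT him le_rfl k
  rw [pow_zero, one_mul]
  exact mul_le_mul (hC k) h (norm_nonneg _) ((norm_nonneg _).trans (hC k))

lemma ThetaRelation.summable (hn : 0 < n) {c : ℤ → ℂ} (hc : ThetaRelation τ n c) (z : ℂ) :
    Summable (thetaTerm τ c z) := by
  obtain ⟨u, hu, h⟩ := hc.exists_majorant hn |z.im|
  exact Summable.of_norm_bounded hu fun k => h k z le_rfl

/-- The entire function `∑ c_k e^{k i √(2π Im τ) z}`. -/
def thetaSum (τ : ℍ) (c : ℤ → ℂ) (z : ℂ) : ℂ := ∑' k : ℤ, thetaTerm τ c z k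

lemma ThetaRelation.differentiable (hn : 0 < n) {c : ℤ → ℂ} (hc : ThetaRelation τ n c) :
    Differentiable ℂ (thetaSum τ c) := by
  intro z
  obtain ⟨u, hu, h⟩ := hc.exists_majorant hn (|z.im| + 1)
  have ho : IsOpen {w : ℂ | |w.im| < |z.im| + 1} :=
    isOpen_lt continuous_im.abs continuous_const
  have := differentiableOn_tsum_of_summable_norm hu (F := fun k w => thetaTerm τ c w k)
    (fun k => ?_) ho (fun k w hw => h k w (le_of_lt hw))
  · exact this.differentiableAt (ho.mem_nhds (by simp))
  · refine Differentiable.differentiableOn ?_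
    unfold thetaTerm
    fun_prop

/-- Writing x₂ as (z - z̄)/2i makes the prefactor holomorphic in the pair (z, z̄), with all
dependence on z̄ inside it. -/
lemma thetaSeries_eq (c : ℤ → ℂ) (z : ℂ) :
    thetaSeries τ n c z = Complex.exp (n / 4 * z * (z - conj z)) * thetaSum τ c z := by
  rw [thetaSeries, thetaSum]
  congr 2
  have h : z - conj z = 2 * I * z.im := by
    rw [sub_conj]; push_cast; ring
  rw [h]; ring

lemma thetaSum_add_basis₁ (c : ℤ → ℂ) (z : ℂ) :
    thetaSum τ c (z + basis₁ τ) = thetaSum τ c z := by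
  unfold thetaSum
  congr 1
  ext k
  rw [thetaTerm, thetaTerm]
  congr 1
  rw [Complex.exp_eq_exp_iff_exists_int]
  refine ⟨k, ?_⟩
  have h := congrArg (fun x : ℝ => (x : ℂ)) (dualScale_mul_scale τ)
  simp only [dualScale, ofReal_mul, ofReal_ofNat] at h
  rw [basis₁]
  linear_combination (k * I : ℂ) * h

/-- Translation by rτ multiplies the k-th exponential by e^{2πikτ}, which the coefficient relation
turns into a shift of the index by n. -/
lemma ThetaRelation.thetaSum_add_basis₂ {c : ℤ → ℂ} (hc : ThetaRelation τ n c) (z : ℂ) :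
    thetaSum τ c (z + basis₂ τ) =
      Complex.exp (-(I * n * dualScale τ * z) - I * n * Real.pi * τ) * thetaSum τ c z := by
  have e : thetaSum τ c z = ∑' k : ℤ, thetaTerm τ c z (k + n) :=
    ((Equiv.addRight (n : ℤ)).tsum_eq _).symm
  rw [e, thetaSum, ← tsum_mul_left]
  congr 1
  ext k
  have h := congrArg (fun x : ℝ => (x : ℂ)) (dualScale_mul_scale τ)
  simp only [ofReal_mul, ofReal_ofNat] at h
  rw [thetaTerm, thetaTerm, hc k, ← dualScale]
  have : Complex.exp (k * I * dualScale τ * (z + basis₂ τ)) =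
      Complex.exp (-(I * n * dualScale τ * z) - I * n * Real.pi * τ) *
      (Complex.exp (I * n * Real.pi * τ) * Complex.exp (2 * k * I * Real.pi * τ) *
      Complex.exp ((k + n : ℤ) * I * dualScale τ * z)) := by
    rw [← Complex.exp_add, ← Complex.exp_add, ← Complex.exp_add, basis₂]
    congr 1
    push_cast
    linear_combination (k * I * τ : ℂ) * h
  rw [this]; ring

theorem ThetaRelation.isQuasiPeriodic {c : ℤ → ℂ} (hc : ThetaRelation τ n c) :
    IsQuasiPeriodic τ n (thetaSeries τ n c) := by
  intro t ht x
  rcases ht with rfl | ht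
  · rw [thetaSeries_eq, thetaSeries_eq, thetaSum_add_basis₁, ← mul_assoc, ← Complex.exp_add]
    congr 2
    have h : x - conj x = 2 * I * x.im := by rw [sub_conj]; push_cast; ring
    simp only [basis₁, map_add, conj_ofReal, wedge, ofReal_re, ofReal_im, zero_mul, sub_zero,
      ofReal_mul]
    linear_combination (n / 4 * scale τ : ℂ) * h
  · rw [Set.mem_singleton_iff] at ht
    subst ht
    rw [thetaSeries_eq, thetaSeries_eq, hc.thetaSum_add_basis₂, ← mul_assoc, ← mul_assoc,
      ← Complex.exp_add, ← Complex.exp_add]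
    congr 2
    have h1 : x - conj x = 2 * I * x.im := by rw [sub_conj]; push_cast; ring
    have h2 : (τ : ℂ) - conj (τ : ℂ) = 2 * I * τ.im := by
      rw [sub_conj]; push_cast; rw [UpperHalfPlane.coe_im]; ring
    have h3 : (dualScale τ : ℂ) = scale τ * τ.im := by rw [dualScale_eq]; push_cast; rfl
    have h4 : (scale τ : ℂ) ^ 2 * τ.im = 2 * Real.pi := by exact_mod_cast scale_sq τ
    have h5 : x = x.re + x.im * I := (re_add_im x).symm
    have h6 : (τ : ℂ) = τ.re + τ.im * I := (re_add_im (τ : ℂ)).symm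
    simp only [basis₂, map_add, map_mul, conj_ofReal, wedge, re_ofReal_mul, im_ofReal_mul,
      ofReal_mul, ofReal_sub, UpperHalfPlane.coe_re, UpperHalfPlane.coe_im]
    rw [h3]
    have h7 : conj x = x.re - x.im * I := by linear_combination -h1 + h5
    have h8 : conj (τ : ℂ) = τ.re - τ.im * I := by linear_combination -h2 + h6
    rw [h7, h8]
    generalize hxr : (x.re : ℂ) = a at *
    generalize hxi : (x.im : ℂ) = b at *
    generalize hr : (τ.re : ℂ) = p at *
    generalize hi : (τ.im : ℂ) = q at *
    rw [h5, h6]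
    linear_combination (n * I * (p + q * I) / 2) * h4

lemma contDiff_thetaSeries (hn : 0 < n) {c : ℤ → ℂ} (hc : ThetaRelation τ n c) :
    ContDiff ℝ ∞ (thetaSeries τ n c) := by
  have h1 : ContDiff ℝ ∞ (thetaSum τ c) := ((hc.differentiable hn).contDiff).restrict_scalars ℝ
  have h2 : ContDiff ℝ ∞ (fun z : ℂ => conj z) := conjCLE.contDiff
  have e : thetaSeries τ n c = fun z => Complex.exp (n / 4 * z * (z - conj z)) * thetaSum τ c z :=
    funext fun z => thetaSeries_eq c z
  rw [e]
  exact ((contDiff_const.mul contDiff_id).mul (contDiff_id.sub h2)).cexp.mul h1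

/-- The theta series as a smooth quasi-periodic function, linear in the coefficients. -/
def theta (hn : 0 < n) : thetaSpace τ n →ₗ[ℂ] smoothSpace τ n where
  toFun c := ⟨thetaSeries τ n c, contDiff_thetaSeries hn c.2, c.2.isQuasiPeriodic⟩
  map_add' c d := by
    ext z
    have h := Summable.tsum_add (c.2.summable hn z) (d.2.summable hn z)
    simp only [thetaTerm] at h
    simp only [thetaSeries, Submodule.coe_add, Pi.add_apply, thetaTerm, add_mul, h, mul_add]
  map_smul' a c := by
    ext z
    simp only [thetaSeries, Submodule.coe_smul, Pi.smul_apply, thetaTerm, smul_eq_mul, mul_assoc,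
      tsum_mul_left, RingHom.id_apply]
    ring

lemma coe_theta (hn : 0 < n) (c : thetaSpace τ n) :
    (theta hn c : ℂ → ℂ) = thetaSeries τ n c := rfl

/-- The theta series vanishes identically only for zero coefficients. -/
lemma theta_injective (hn : 0 < n) : Function.Injective (theta (τ := τ) hn) := by
  rw [← LinearMap.ker_eq_bot, LinearMap.ker_eq_bot']
  intro c hc
  have h0 : ∀ z, thetaSum τ c z = 0 := by
    intro z
    have h1 : thetaSeries τ n c z = 0 := congrFun (congrArg Subtype.val hc) z
    rw [thetaSeries_eq] at h1
    exact (mul_eq_zero.1 h1).resolve_left (Complex.exp_ne_zero _)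
  obtain ⟨u, hu, hb⟩ := c.2.exists_majorant hn 0
  ext m
  set κ := dualScale τ with hκ
  set r := scale τ with hr
  have hr0 : 0 < r := scale_pos τ
  have hκr : (κ : ℂ) * r = 2 * Real.pi := by exact_mod_cast dualScale_mul_scale τ
  have hκ0 : (κ : ℂ) ≠ 0 := by
    intro h
    rw [h, zero_mul] at hκr
    exact mul_ne_zero two_ne_zero (ofReal_ne_zero.2 Real.pi_ne_zero) hκr.symm
  have hint : ∀ k : ℤ, ∫ x in (0 : ℝ)..r, thetaTerm τ c x k * Complex.exp (-(m * I * κ * x)) =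
      if k = m then (c : ℤ → ℂ) m * r else 0 := by
    intro k
    have e : ∀ x : ℝ, thetaTerm τ c x k * Complex.exp (-(m * I * κ * x)) =
        (c : ℤ → ℂ) k * Complex.exp (((k - m : ℤ) * I * κ) * x) := by
      intro x
      rw [thetaTerm, ← dualScale, mul_assoc, ← Complex.exp_add]
      congr 2
      push_cast; ring
    simp_rw [e]
    rw [intervalIntegral.integral_const_mul]
    split_ifs with h
    · subst h; simp
    · have hne : ((k - m : ℤ) : ℂ) * I * κ ≠ 0 :=
        mul_ne_zero (mul_ne_zero (Int.cast_ne_zero.2 (sub_ne_zero.2 h)) I_ne_zero) hκ0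
      rw [integral_exp_mul_complex hne]
      have : ((k - m : ℤ) : ℂ) * I * κ * r = (k - m : ℤ) * (2 * Real.pi * I) := by
        linear_combination ((k - m : ℤ) * I : ℂ) * hκr
      rw [this, Complex.exp_int_mul_two_pi_mul_I]
      simp
  have hsum : HasSum (fun k : ℤ => ∫ x in (0 : ℝ)..r,
      thetaTerm τ c x k * Complex.exp (-(m * I * κ * x))) 0 := by
    have := intervalIntegral.hasSum_integral_of_dominated_convergence
      (μ := volume) (a := 0) (b := r)
      (F := fun (k : ℤ) (x : ℝ) => thetaTerm τ c x k * Complex.exp (-(m * I * κ * x)))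
      (f := fun _ => 0) (fun k _ => u k) (fun k => ?_) (fun k => ?_) ?_ ?_ ?_
    · simpa using this
    · refine Continuous.aestronglyMeasurable ?_
      unfold thetaTerm
      fun_prop
    · refine .of_forall fun x _ => ?_
      rw [norm_mul]
      have : ‖Complex.exp (-(m * I * κ * x))‖ = 1 := by
        rw [Complex.norm_exp]
        simp
      rw [this, mul_one]
      exact hb k x (by simp)
    · exact .of_forall fun x _ => hu
    · exact intervalIntegrable_const
    · refine .of_forall fun x _ => ?_
      have := (c.2.summable hn x).hasSum.mul_right (Complex.exp (-(m * I * κ * x)))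
      rwa [show ∑' k, thetaTerm τ c x k = 0 from h0 x, zero_mul] at this
  simp_rw [hint] at hsum
  have := hsum.unique (hasSum_ite_eq m ((c : ℤ → ℂ) m * r))
  have h3 := (mul_eq_zero.1 this.symm).resolve_right (ofReal_ne_zero.2 hr0.ne')
  simpa using h3

end

end MagneticLattice

namespace MagneticLattice

noncomputable section

open scoped ComplexConjugate

variable {τ : ℍ} {n : ℕ}

/-! ### Holomorphic extension to two variables -/

/-- The restriction of a function of two variables to the pairs `(z, z̄)`. -/
def diag (F : ℂ × ℂ → ℂ) (z : ℂ) : ℂ := F (z, conj z)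

/-- The creation operator on functions of the two variables `z`, `z̄`. -/
def raise (n : ℕ) (F : ℂ × ℂ → ℂ) (p : ℂ × ℂ) : ℂ :=
  2 * fderiv ℂ F p (1, 0) - n / 2 * p.2 * F p

/-- For a function holomorphic in both variables the Wirtinger derivatives of its diagonal
restriction are the two complex partial derivatives. -/
lemma fderiv_diag {F : ℂ × ℂ → ℂ} (hF : Differentiable ℂ F) (z v : ℂ) :
    fderiv ℝ (diag F) z v = v * fderiv ℂ F (z, conj z) (1, 0) +
      conj v * fderiv ℂ F (z, conj z) (0, 1) := by
  have h1 : HasFDerivAt (fun z : ℂ => (z, conj z))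
      ((ContinuousLinearMap.id ℝ ℂ).prod (conjCLE : ℂ →L[ℝ] ℂ)) z :=
    (hasFDerivAt_id z).prodMk conjCLE.hasFDerivAt
  have h2 := ((hF (z, conj z)).hasFDerivAt.restrictScalars ℝ).comp z h1
  have h3 : fderiv ℝ (diag F) z v = fderiv ℂ F (z, conj z) (v, conj v) := by
    have : HasFDerivAt (diag F) _ z := h2
    rw [this.fderiv]; rfl
  have h4 : ((v, conj v) : ℂ × ℂ) = v • (1, 0) + conj v • (0, 1) := by simp
  rw [h3, h4, map_add, map_smul, map_smul, smul_eq_mul, smul_eq_mul]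

lemma potential_zero (x : ℂ) : (potential n 0 x : ℂ) = -(n / 2) * x.im := by
  simp [potential]

lemma potential_one (x : ℂ) : (potential n 1 x : ℂ) = n / 2 * x.re := by
  simp [potential]

lemma conj_eq (z : ℂ) : conj z = z.re - z.im * I := by
  apply Complex.ext <;> simp

/-- In these coordinates `up` is 2∂_z - (n/2)z̄. It differentiates in the first variable only, so
the second can be frozen as a parameter. -/
lemma up_eq_diag {F : ℂ × ℂ → ℂ} (hF : Differentiable ℂ F) {u : smoothSpace τ n}
    (hu : (u : ℂ → ℂ) = diag F) : (up τ n u : ℂ → ℂ) = diag (raise n F) := by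
  ext z
  have h0 := fderiv_diag hF z (dir 0)
  have h1 := fderiv_diag hF z (dir 1)
  simp only [dir, Matrix.cons_val_zero, Matrix.cons_val_one, map_one, conj_I] at h0 h1
  simp only [up_apply, Submodule.coe_sub, Submodule.coe_smul, Pi.sub_apply, Pi.smul_apply,
    cov_apply, hu, dir, Matrix.cons_val_zero, Matrix.cons_val_one, h0, h1, smul_eq_mul,
    potential_zero, potential_one]
  simp only [diag, raise, conj_eq z]
  linear_combination (-(fderiv ℂ F (z, z.re - z.im * I) (1, 0)) +
    fderiv ℂ F (z, z.re - z.im * I) (0, 1) + n / 2 * z.re * F (z, z.re - z.im * I)) * I_sq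

lemma down_eq_diag {F : ℂ × ℂ → ℂ} (hF : Differentiable ℂ F) {u : smoothSpace τ n}
    (hu : (u : ℂ → ℂ) = diag F) (z : ℂ) : (down τ n u : ℂ → ℂ) z =
      2 * fderiv ℂ F (z, conj z) (0, 1) + n / 2 * z * F (z, conj z) := by
  have h0 := fderiv_diag hF z (dir 0)
  have h1 := fderiv_diag hF z (dir 1)
  simp only [dir, Matrix.cons_val_zero, Matrix.cons_val_one, map_one, conj_I] at h0 h1
  simp only [down_apply, Submodule.coe_add, Submodule.coe_smul, Pi.add_apply, Pi.smul_apply,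
    cov_apply, hu, dir, Matrix.cons_val_zero, Matrix.cons_val_one, h0, h1, smul_eq_mul,
    potential_zero, potential_one]
  have hz : (n / 2 * z * F (z, conj z) : ℂ) = n / 2 * (z.re + z.im * I) * F (z, conj z) := by
    rw [re_add_im]
  rw [hz]
  simp only [diag]
  linear_combination ((fderiv ℂ F (z, conj z) (1, 0)) -
    fderiv ℂ F (z, conj z) (0, 1) - n / 2 * z.re * F (z, conj z)) * I_sq

lemma contDiff_raise {F : ℂ × ℂ → ℂ} (hF : ContDiff ℂ ∞ F) : ContDiff ℂ ∞ (raise n F) := by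
  have h : ContDiff ℂ ∞ fun p => fderiv ℂ F p (1, 0) :=
    (hF.fderiv_right (m := ∞) (by simp)).clm_apply contDiff_const
  exact (contDiff_const.mul h).sub ((contDiff_const.mul contDiff_snd).mul hF)

lemma contDiff_raise_iterate {F : ℂ × ℂ → ℂ} (hF : ContDiff ℂ ∞ F) (m : ℕ) :
    ContDiff ℂ ∞ ((raise n)^[m] F) := by
  induction m with
  | zero => exact hF
  | succ m ih => rw [Function.iterate_succ_apply']; exact contDiff_raise ih

lemma up_pow_eq_diag {F : ℂ × ℂ → ℂ} (hF : ContDiff ℂ ∞ F) {u : smoothSpace τ n}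
    (hu : (u : ℂ → ℂ) = diag F) (m : ℕ) :
    ((up τ n ^ m) u : ℂ → ℂ) = diag ((raise n)^[m] F) := by
  induction m with
  | zero => simpa using hu
  | succ m ih =>
    rw [pow_succ', Module.End.mul_apply, Function.iterate_succ_apply']
    exact up_eq_diag ((contDiff_raise_iterate hF m).differentiable (by simp)) ih

/-- The function of the first variable that the creation operator differentiates. -/
def slice (n : ℕ) (F : ℂ × ℂ → ℂ) (w s : ℂ) : ℂ := Complex.exp (-(n / 4 * w * s)) * F (s, w)

/-- For fixed w, `raise` is 2∂_z conjugated by e^{nwz/4}, so its powers are ordinary derivatives of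
`slice`. -/
lemma raise_iterate_eq {F : ℂ × ℂ → ℂ} (hF : ContDiff ℂ ∞ F) (m : ℕ) (z w : ℂ) :
    (raise n)^[m] F (z, w) =
      Complex.exp (n / 4 * w * z) * (2 ^ m * iteratedDeriv m (slice n F w) z) := by
  have hs : ContDiff ℂ ∞ (slice n F w) := by
    have h1 : ContDiff ℂ ∞ fun s : ℂ => Complex.exp (-(n / 4 * w * s)) :=
      (contDiff_const.mul contDiff_id).neg.cexp
    exact h1.mul (hF.comp (contDiff_id.prodMk contDiff_const))
  induction m generalizing z with
  | zero =>
    rw [Function.iterate_zero, id, pow_zero, one_mul, iteratedDeriv_zero, slice, ← mul_assoc,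
      ← Complex.exp_add]
    simp
  | succ m ih =>
    rw [Function.iterate_succ_apply', raise]
    have hd := (contDiff_raise_iterate (n := n) hF m).differentiable (by simp) (z, w)
    have h1 : HasDerivAt (fun s : ℂ => (raise n)^[m] F (s, w))
        (fderiv ℂ ((raise n)^[m] F) (z, w) (1, 0)) z :=
      hd.hasFDerivAt.comp_hasDerivAt z ((hasDerivAt_id z).prodMk (hasDerivAt_const z w))
    have h2 : HasDerivAt (iteratedDeriv m (slice n F w)) (iteratedDeriv (m + 1) (slice n F w) z) z := by
      rw [iteratedDeriv_succ]
      exact ((hs.differentiable_iteratedDeriv m (by exact_mod_cast WithTop.coe_lt_top m)) z).hasDerivAt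
    have h3 : HasDerivAt (fun s : ℂ => Complex.exp (n / 4 * w * s))
        (Complex.exp (n / 4 * w * z) * (n / 4 * w)) z := by
      have := ((hasDerivAt_id z).const_mul (n / 4 * w : ℂ)).cexp
      simpa using this
    have h4 := h3.mul (h2.const_mul (2 ^ m : ℂ))
    have h5 : fderiv ℂ ((raise n)^[m] F) (z, w) (1, 0) = _ :=
      h1.unique (h4.congr_of_eventuallyEq (.of_forall fun s => ih s))
    rw [h5, ih]
    ring

/-! ### The theta functions in two variables -/

/-- The theta series as a function of `z` and `z̄`. -/
def thetaDiag (τ : ℍ) (n : ℕ) (c : ℤ → ℂ) (p : ℂ × ℂ) : ℂ :=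
  Complex.exp (n / 4 * p.1 * (p.1 - p.2)) * thetaSum τ c p.1

lemma contDiff_thetaDiag (hn : 0 < n) (c : thetaSpace τ n) :
    ContDiff ℂ ∞ (thetaDiag τ n c) := by
  have h1 : ContDiff ℂ ∞ (thetaSum τ c) := (c.2.differentiable hn).contDiff
  exact ((contDiff_const.mul contDiff_fst).mul (contDiff_fst.sub contDiff_snd)).cexp.mul
    (h1.comp contDiff_fst)

lemma theta_eq_diag (hn : 0 < n) (c : thetaSpace τ n) :
    (theta hn c : ℂ → ℂ) = diag (thetaDiag τ n c) := by
  ext z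
  rw [coe_theta, thetaSeries_eq]; rfl

/-- In these coordinates `down` is 2∂_{z̄} + (n/2)z, and z̄ enters a theta function only through the
factor e^{-nzz̄/4}, which this operator annihilates. -/
lemma down_theta (hn : 0 < n) (c : thetaSpace τ n) : down τ n (theta hn c) = 0 := by
  ext z
  have hF := (contDiff_thetaDiag hn c).differentiable (by simp)
  rw [down_eq_diag hF (theta_eq_diag hn c)]
  have h1 : HasDerivAt (fun w : ℂ => thetaDiag τ n c (z, w))
      (fderiv ℂ (thetaDiag τ n c) (z, conj z) (0, 1)) (conj z) :=
    (hF (z, conj z)).hasFDerivAt.comp_hasDerivAt (conj z)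
      ((hasDerivAt_const (conj z) z).prodMk (hasDerivAt_id (conj z)))
  have h2 : HasDerivAt (fun w : ℂ => thetaDiag τ n c (z, w)) _ (conj z) :=
    ((((hasDerivAt_id (conj z)).const_sub z).const_mul (n / 4 * z : ℂ)).cexp).mul_const
      (thetaSum τ c z)
  rw [h1.unique h2]
  simp only [thetaDiag, id]
  rw [Submodule.coe_zero, Pi.zero_apply]
  ring

lemma slice_thetaDiag (c : ℤ → ℂ) (w s : ℂ) : slice n (thetaDiag τ n c) w s =
    Complex.exp (n / 4 * s ^ 2 - n / 2 * w * s) * thetaSum τ c s := by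
  rw [slice, thetaDiag, ← mul_assoc, ← Complex.exp_add]
  congr 2; ring

end

end MagneticLattice

namespace MagneticLattice

noncomputable section

open scoped ComplexConjugate

variable {τ : ℍ} {n : ℕ}

/-! ### Fourier uniqueness on the cell -/

/-- Trigonometric polynomials are uniformly dense in the continuous functions, which are dense in
L². This works for any finite measure, so the pushforward of Lebesgue measure from the cell can be
used as it is. -/
lemma ae_eq_zero_of_mFourier {ν : Measure (UnitAddTorus (Fin 2))} [IsFiniteMeasure ν]
    {h : UnitAddTorus (Fin 2) → ℂ} (hh : MemLp h 2 ν)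
    (h0 : ∀ k : Fin 2 → ℤ, ∫ x, UnitAddTorus.mFourier k x * conj (h x) ∂ν = 0) :
    h =ᵐ[ν] 0 := by
  let L : C(UnitAddTorus (Fin 2), ℂ) →L[ℂ] ℂ :=
    (innerSL ℂ hh.toLp) ∘L (ContinuousMap.toLp 2 ν ℂ)
  have hL : ∀ φ, L φ = ∫ x, φ x * conj (h x) ∂ν := by
    intro φ
    change inner ℂ hh.toLp (ContinuousMap.toLp 2 ν ℂ φ) = _
    rw [L2.inner_def]
    refine integral_congr_ae ?_
    filter_upwards [hh.coeFn_toLp, ContinuousMap.coeFn_toLp (p := 2) (𝕜 := ℂ) ν φ] with x h1 h2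
    rw [h1, h2, RCLike.inner_apply]
  have hker : LinearMap.ker (L : C(UnitAddTorus (Fin 2), ℂ) →ₗ[ℂ] ℂ) = ⊤ := by
    rw [← top_le_iff, ← UnitAddTorus.span_mFourier_closure_eq_top]
    refine Submodule.topologicalClosure_minimal _ (Submodule.span_le.2 ?_) L.isClosed_ker
    rintro _ ⟨k, rfl⟩
    exact (hL _).trans (h0 k)
  have hd := ContinuousMap.toLp_denseRange (α := UnitAddTorus (Fin 2)) (E := ℂ) (p := 2) (μ := ν)
    (𝕜 := ℂ) (by simp)
  have hz : hh.toLp = 0 := by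
    refine hd.eq_zero_of_inner_left ℂ ?_
    intro φ
    have : φ ∈ LinearMap.ker (L : C(UnitAddTorus (Fin 2), ℂ) →ₗ[ℂ] ℂ) := hker ▸ Submodule.mem_top
    exact this
  have h1 := hh.coeFn_toLp
  rw [hz] at h1
  exact h1.symm.trans (Lp.coeFn_zero _ _ _)

/-- The projection of the plane onto the torus. -/
def toTorus (τ : ℍ) (z : ℂ) : UnitAddTorus (Fin 2) := ![(coord₁ τ z : UnitAddCircle), coord₂ τ z]

/-- The section of the projection with values in the cell. -/
def ofTorus (τ : ℍ) (x : UnitAddTorus (Fin 2)) : ℂ :=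
  ((AddCircle.equivIco 1 0 (x 0) : ℝ) : ℂ) * basis₁ τ +
    ((AddCircle.equivIco 1 0 (x 1) : ℝ) : ℂ) * basis₂ τ

lemma measurable_toTorus (τ : ℍ) : Measurable (toTorus τ) := by
  refine measurable_pi_iff.2 fun i => ?_
  fin_cases i
  · exact AddCircle.measurable_mk'.comp (continuous_coord₁ τ).measurable
  · exact AddCircle.measurable_mk'.comp (continuous_coord₂ τ).measurable

lemma measurable_ofTorus (τ : ℍ) : Measurable (ofTorus τ) := by
  have h : Measurable fun x : UnitAddCircle => ((AddCircle.equivIco 1 0 x : ℝ) : ℂ) :=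
    continuous_ofReal.measurable.comp
      (measurable_subtype_coe.comp (AddCircle.measurableEquivIco 1 0).measurable)
  have p : ∀ i : Fin 2, Measurable fun x : UnitAddTorus (Fin 2) => x i :=
    fun i => measurable_pi_apply i
  exact ((h.comp (p 0)).mul_const _).add ((h.comp (p 1)).mul_const _)

lemma ofTorus_toTorus {z : ℂ} (hz : z ∈ cell τ) : ofTorus τ (toTorus τ z) = z := by
  obtain ⟨h1, h2⟩ := (mem_cell_iff τ z).1 hz
  conv_rhs => rw [eq_coord τ z]
  have e : Set.Ico (0 : ℝ) 1 = Set.Ico (0 : ℝ) (0 + 1) := by rw [zero_add]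
  rw [e] at h1 h2
  simp only [ofTorus, toTorus, Matrix.cons_val_zero, Matrix.cons_val_one]
  rw [AddCircle.equivIco_coe_eq h1, AddCircle.equivIco_coe_eq h2]

/-- A square integrable function on the cell is determined by its Fourier coefficients. -/
lemma ae_eq_zero_of_fourier {g : ℂ → ℂ} (hg : MemLp g 2 (volume.restrict (cell τ)))
    (h0 : ∀ a b : ℤ, ∫ z in cell τ,
      Complex.exp (2 * Real.pi * I * (a * coord₁ τ z + b * coord₂ τ z)) * conj (g z) = 0) :
    g =ᵐ[volume.restrict (cell τ)] 0 := by
  have hq := measurable_toTorus τ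
  have hs := measurable_ofTorus τ
  have hid : ∀ᵐ z ∂(volume.restrict (cell τ)), ofTorus τ (toTorus τ z) = z :=
    (ae_restrict_mem (measurableSet_cell τ)).mono fun z hz => ofTorus_toTorus hz
  -- The measure is transported together with the function, so no Jacobian has to be computed;
  -- `ofTorus` inverts the projection on the cell.
  set ν := Measure.map (toTorus τ) (volume.restrict (cell τ)) with hν
  have hmap : Measure.map (ofTorus τ) ν = volume.restrict (cell τ) := by
    rw [hν, Measure.map_map hs hq]
    exact (Measure.map_congr hid).trans Measure.map_id
  have hg' : MemLp (g ∘ ofTorus τ) 2 ν := by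
    rw [← hmap] at hg
    exact (memLp_map_measure_iff hg.1 hs.aemeasurable).1 hg
  have := ae_eq_zero_of_mFourier hg' fun k => ?_
  · filter_upwards [ae_of_ae_map hq.aemeasurable this, hid] with z h1 h2
    rwa [Function.comp_apply, h2] at h1
  · rw [hν, integral_map hq.aemeasurable]
    · rw [← h0 (k 0) (k 1)]
      refine integral_congr_ae ?_
      filter_upwards [hid] with z hz
      rw [Function.comp_apply, hz]
      congr 1
      simp only [UnitAddTorus.mFourier, ContinuousMap.coe_mk, Fin.prod_univ_two, toTorus,
        Matrix.cons_val_zero, Matrix.cons_val_one, fourier_coe_apply, ← Complex.exp_add]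
      congr 1
      push_cast
      ring
    · exact (UnitAddTorus.mFourier k).continuous.aestronglyMeasurable.mul
        (continuous_conj.comp_aestronglyMeasurable hg'.1)

/-! ### Completeness of the Landau levels -/

/-- The translates of a theta function generated by the creation operator. -/
def coherent (τ : ℍ) (n : ℕ) (c : ℤ → ℂ) (v z : ℂ) : ℂ :=
  Complex.exp (n / 4 * conj z * z) * slice n (thetaDiag τ n c) (conj z) (z + v)

lemma continuous_slice (hn : 0 < n) (c : thetaSpace τ n) :
    Continuous fun p : ℂ × ℂ => slice n (thetaDiag τ n c) p.1 p.2 := by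
  have := (contDiff_thetaDiag hn c).continuous
  unfold slice
  fun_prop

lemma differentiable_slice (hn : 0 < n) (c : thetaSpace τ n) (w : ℂ) :
    Differentiable ℂ (slice n (thetaDiag τ n c) w) := by
  have h1 : Differentiable ℂ fun s => thetaDiag τ n c (s, w) :=
    ((contDiff_thetaDiag hn c).comp (contDiff_id.prodMk contDiff_const)).differentiable (by simp)
  have h2 : Differentiable ℂ fun s => Complex.exp (-(n / 4 * w * s)) :=
    (differentiable_id.const_mul (n / 4 * w : ℂ)).neg.cexp
  exact h2.mul h1

lemma continuous_coherent (hn : 0 < n) (c : thetaSpace τ n) (v : ℂ) :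
    Continuous (coherent τ n c v) := by
  have h := continuous_slice hn c
  have h0 : Continuous fun z : ℂ => (conj z, z + v) :=
    continuous_conj.prodMk (continuous_id.add continuous_const)
  have h1 := h.comp h0
  have h2 : Continuous fun z : ℂ => Complex.exp (n / 4 * conj z * z) :=
    ((continuous_const.mul continuous_conj).mul continuous_id).cexp
  exact h2.mul h1

lemma up_pow_theta_apply (hn : 0 < n) (c : thetaSpace τ n) (m : ℕ) (z : ℂ) :
    ((up τ n ^ m) (theta hn c) : ℂ → ℂ) z = Complex.exp (n / 4 * conj z * z) *
      (2 ^ m * iteratedDeriv m (slice n (thetaDiag τ n c) (conj z)) z) := by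
  rw [up_pow_eq_diag (contDiff_thetaDiag hn c) (theta_eq_diag hn c), diag,
    raise_iterate_eq (contDiff_thetaDiag hn c)]

/-- This is the Taylor expansion of the entire function `slice` at z, evaluated at z + v. The factor
2^m produced by `up` cancels against (v/2)^m. -/
lemma hasSum_coherent (hn : 0 < n) (c : thetaSpace τ n) (v z : ℂ) :
    HasSum (fun m : ℕ => (m.factorial : ℂ)⁻¹ * (v / 2) ^ m *
      ((up τ n ^ m) (theta hn c) : ℂ → ℂ) z) (coherent τ n c v z) := by
  have h := (hasSum_taylorSeries_of_entire (differentiable_slice hn c (conj z)) z (z + v)).mul_left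
    (Complex.exp (n / 4 * conj z * z))
  refine h.congr_fun fun m => ?_
  rw [up_pow_theta_apply, add_sub_cancel_left, smul_eq_mul, smul_eq_mul, div_pow]
  field_simp

/-- Cauchy estimates, uniform for z in the cell, give a geometric majorant; with it the Taylor
series is integrated term by term against f. -/
lemma exists_bound_up_pow (hn : 0 < n) (c : thetaSpace τ n) (v : ℂ) :
    ∃ B, 0 ≤ B ∧ ∀ m : ℕ, ∀ z ∈ cell τ, ‖(m.factorial : ℂ)⁻¹ * (v / 2) ^ m *
      ((up τ n ^ m) (theta hn c) : ℂ → ℂ) z‖ ≤ B * (1 / 2) ^ m := by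
  set ρ := 1 * ‖basis₁ τ‖ + 1 * ‖basis₂ τ‖
  -- This radius gives ‖v‖/R ≤ 1/2, the ratio of the majorant; the summand 1 keeps R positive when v
  -- = 0.
  set R := 2 * ‖v‖ + 1 with hR
  have hR0 : 0 < R := by positivity
  obtain ⟨C, hC⟩ := ((isCompact_closedBall (0 : ℂ) ρ).prod
    (isCompact_closedBall (0 : ℂ) (ρ + R))).exists_bound_of_continuousOn
    (continuous_slice hn c).continuousOn
  have hE : Continuous fun z : ℂ => Complex.exp (n / 4 * conj z * z) :=
    ((continuous_const.mul continuous_conj).mul continuous_id).cexp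
  obtain ⟨E, hE⟩ := (isCompact_closedBall (0 : ℂ) ρ).exists_bound_of_continuousOn hE.continuousOn
  refine ⟨|E| * |C|, by positivity, fun m z hz => ?_⟩
  have hz' := cell_subset_closedBall τ hz
  have hzn : ‖z‖ ≤ ρ := mem_closedBall_zero_iff.1 hz'
  have hd := norm_iteratedDeriv_le_of_forall_mem_sphere_norm_le (c := z) (C := |C|) m hR0
    (differentiable_slice hn c (conj z)).diffContOnCl fun s hs => by
      refine (hC (conj z, s) ⟨?_, ?_⟩).trans (le_abs_self C)
      · simpa using hzn
      · have : ‖s - z‖ = R := by simpa [dist_eq_norm] using hs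
        simp only [mem_closedBall_zero_iff]
        calc ‖s‖ = ‖z + (s - z)‖ := by rw [add_sub_cancel]
          _ ≤ ρ + R := (norm_add_le _ _).trans (by linarith)
  have he := (hE z hz').trans (le_abs_self E)
  rw [up_pow_theta_apply]
  have hfac : (0 : ℝ) < m.factorial := by exact_mod_cast m.factorial_pos
  have hvR : ‖v‖ ^ m / R ^ m ≤ (1 / 2) ^ m := by
    rw [← div_pow]
    refine pow_le_pow_left₀ (by positivity) ?_ m
    rw [div_le_div_iff₀ hR0 two_pos]
    linarith [norm_nonneg v]
  calc ‖(m.factorial : ℂ)⁻¹ * (v / 2) ^ m * (Complex.exp (n / 4 * conj z * z) *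
        (2 ^ m * iteratedDeriv m (slice n (thetaDiag τ n c) (conj z)) z))‖
      = (m.factorial : ℝ)⁻¹ * ‖v‖ ^ m * (‖Complex.exp (n / 4 * conj z * z)‖ *
        ‖iteratedDeriv m (slice n (thetaDiag τ n c) (conj z)) z‖) := by
        simp only [norm_mul, norm_inv, norm_pow, norm_div, Complex.norm_natCast, div_pow]
        norm_num
        field_simp
    _ ≤ (m.factorial : ℝ)⁻¹ * ‖v‖ ^ m * (|E| * (m.factorial * |C| / R ^ m)) := by gcongr
    _ = |E| * |C| * (‖v‖ ^ m / R ^ m) := by field_simp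
    _ ≤ |E| * |C| * (1 / 2) ^ m := by gcongr

/-- A function orthogonal to all excited theta functions is orthogonal to all their translates. -/
lemma integral_coherent_eq_zero (hn : 0 < n) {f : CellL2 τ}
    (hf : ∀ m c, inner ℂ (toL2 τ n ((up τ n ^ m) (theta hn c))) f = 0) (c : thetaSpace τ n)
    (v : ℂ) : ∫ z in cell τ, conj (coherent τ n c v z) * f z = 0 := by
  obtain ⟨B, hB0, hB⟩ := exists_bound_up_pow hn c v
  have hfi : Integrable f (volume.restrict (cell τ)) := (Lp.memLp f).integrable (by norm_num)
  set F : ℕ → ℂ → ℂ := fun m z => conj ((m.factorial : ℂ)⁻¹ * (v / 2) ^ m *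
      ((up τ n ^ m) (theta hn c) : ℂ → ℂ) z) * f z with hF
  have hFb : ∀ m, ∀ᵐ z ∂volume.restrict (cell τ), ‖conj ((m.factorial : ℂ)⁻¹ * (v / 2) ^ m *
      ((up τ n ^ m) (theta hn c) : ℂ → ℂ) z)‖ ≤ B * (1 / 2) ^ m := fun m => by
    filter_upwards [ae_restrict_mem (measurableSet_cell τ)] with z hz
    rw [RCLike.norm_conj]
    exact hB m z hz
  have hFi : ∀ m, Integrable (F m) (volume.restrict (cell τ)) := fun m => by
    refine hfi.bdd_mul ?_ (hFb m)
    exact (continuous_conj.comp (continuous_const.mul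
      ((up τ n ^ m) (theta hn c)).2.1.continuous)).aestronglyMeasurable
  have hint : ∀ m, ∫ z in cell τ, F m z = 0 := fun m => by
    have h1 := hf m c
    rw [inner_toL2 _ (Filter.EventuallyEq.refl _ _)] at h1
    simp only [hF, map_mul, mul_assoc]
    rw [integral_const_mul, integral_const_mul]
    rw [h1, mul_zero, mul_zero]
  have hsum : Summable fun m => ∫ z in cell τ, ‖F m z‖ := by
    refine Summable.of_nonneg_of_le (fun m => integral_nonneg fun z => norm_nonneg _) (fun m => ?_)
      ((summable_geometric_two.mul_left B).mul_right (∫ z in cell τ, ‖f z‖))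
    rw [← integral_const_mul]
    refine integral_mono_ae (hFi m).norm (hfi.norm.const_mul _) ?_
    filter_upwards [hFb m] with z hz
    simp only [hF]
    rw [norm_mul]
    exact mul_le_mul_of_nonneg_right hz (norm_nonneg _)
  have key := hasSum_integral_of_summable_integral_norm hFi hsum
  simp only [hint] at key
  rw [← key.unique hasSum_zero]
  refine integral_congr_ae (.of_forall fun z => ?_)
  have h2 := ((hasSum_coherent hn c v z).map (starRingEnd ℂ) continuous_conj).mul_right (f z)
  exact h2.tsum_eq.symm

/-- The action of the dual lattice on the coefficients. -/
def shiftCoeff (τ : ℍ) (μ : ℂ) (b : ℤ) (c : ℤ → ℂ) (k : ℤ) : ℂ :=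
  c (k - b) * Complex.exp ((k - b : ℤ) * I * dualScale τ * μ)

lemma dualScale_mul_basis (τ : ℍ) :
    (dualScale τ : ℂ) * basis₁ τ = 2 * Real.pi ∧
      (dualScale τ : ℂ) * basis₂ τ = 2 * Real.pi * τ := by
  have h : (dualScale τ : ℂ) * scale τ = 2 * Real.pi := by exact_mod_cast dualScale_mul_scale τ
  exact ⟨h, by rw [basis₂, ← mul_assoc, h]⟩

/-- By `hμ`, n · `dualScale` · μ equals 2π(a + bτ). The part with a is an integer period of the
exponential, and the part with b makes up for replacing k by k - b in the relation. -/
lemma ThetaRelation.shiftCoeff {c : ℤ → ℂ} (hc : ThetaRelation τ n c) (a b : ℤ)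
    {μ : ℂ} (hμ : n * μ = a * basis₁ τ + b * basis₂ τ) :
    ThetaRelation τ n (shiftCoeff τ μ b c) := by
  intro k
  obtain ⟨h1, h2⟩ := dualScale_mul_basis τ
  have h3 : (n : ℂ) * I * dualScale τ * μ = 2 * Real.pi * I * b * τ + a * (2 * Real.pi * I) := by
    linear_combination (I * dualScale τ) * hμ + (I * a) * h1 + (I * b) * h2
  have h4 := hc (k - b)
  have e : k + n - b = k - b + n := by ring
  simp only [MagneticLattice.shiftCoeff]
  rw [e, h4]
  have h5 : Complex.exp ((k - b + n : ℤ) * I * dualScale τ * μ) =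
      Complex.exp ((k - b : ℤ) * I * dualScale τ * μ) * Complex.exp (2 * Real.pi * I * b * τ) := by
    rw [← Complex.exp_add, Complex.exp_eq_exp_iff_exists_int]
    refine ⟨a, ?_⟩
    push_cast
    linear_combination h3
  have h6 : Complex.exp (2 * (k - b : ℤ) * I * Real.pi * τ) * Complex.exp (2 * Real.pi * I * b * τ) =
      Complex.exp (2 * k * I * Real.pi * τ) := by
    rw [← Complex.exp_add]
    congr 1
    push_cast
    ring
  rw [h5, ← h6]
  ring

lemma thetaSum_shiftCoeff (c : ℤ → ℂ) (μ : ℂ) (b : ℤ) (s : ℂ) :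
    thetaSum τ (shiftCoeff τ μ b c) s =
      Complex.exp (b * I * dualScale τ * s) * thetaSum τ c (s + μ) := by
  have e : thetaSum τ (shiftCoeff τ μ b c) s =
      ∑' k : ℤ, thetaTerm τ (shiftCoeff τ μ b c) s (k + b) :=
    ((Equiv.addRight b).tsum_eq _).symm
  rw [e, thetaSum, ← tsum_mul_left]
  congr 1
  ext k
  simp only [thetaTerm, shiftCoeff, add_sub_cancel_right]
  rw [← dualScale, mul_assoc, ← Complex.exp_add, mul_left_comm, ← Complex.exp_add]
  congr 2
  push_cast
  ring

lemma coherent_eq (c : ℤ → ℂ) (v z : ℂ) : coherent τ n c v z =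
    Complex.exp (n / 4 * conj z * z + n / 4 * (z + v) ^ 2 - n / 2 * conj z * (z + v)) *
      thetaSum τ c (z + v) := by
  rw [coherent, slice_thetaDiag, ← mul_assoc, ← Complex.exp_add]
  congr 2
  ring

/-- Shifting the coefficients multiplies the translates by a character of the torus. -/
lemma coherent_shiftCoeff (c : ℤ → ℂ) (a b : ℤ) {μ : ℂ}
    (hμ : n * μ = a * basis₁ τ + b * basis₂ τ) (u : ℂ) :
    ∃ K : ℂ, K ≠ 0 ∧ ∀ z, coherent τ n (shiftCoeff τ μ b c) (u - μ) z =
      K * (Complex.exp (2 * Real.pi * I * (b * coord₁ τ z - a * coord₂ τ z)) *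
        coherent τ n c u z) := by
  refine ⟨Complex.exp (n / 4 * (μ ^ 2 - 2 * u * μ) + b * I * dualScale τ * (u - μ)),
    Complex.exp_ne_zero _, fun z => ?_⟩
  rw [coherent_eq, coherent_eq, thetaSum_shiftCoeff]
  -- The translation u - μ is chosen so that both sides contain the same value of `thetaSum`; only
  -- exponents remain to be compared. K collects the part free of z.
  have e : z + (u - μ) + μ = z + u := by ring
  rw [e, ← mul_assoc, ← mul_assoc, ← mul_assoc, ← Complex.exp_add, ← Complex.exp_add,
    ← Complex.exp_add]
  congr 2
  have h1 : (coord₁ τ z : ℂ) * scale τ * τ.im = z.re * τ.im - z.im * τ.re := by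
    have h := τ.im_pos.ne'
    have h' := (scale_pos τ).ne'
    have : coord₁ τ z * scale τ * τ.im = z.re * τ.im - z.im * τ.re := by
      unfold coord₁; field_simp
    exact_mod_cast this
  have h2 : (coord₂ τ z : ℂ) * (scale τ * τ.im) = z.im := by
    have h := τ.im_pos.ne'
    have h' := (scale_pos τ).ne'
    have : coord₂ τ z * (scale τ * τ.im) = z.im := by
      unfold coord₂; field_simp
    exact_mod_cast this
  have h3 : (scale τ : ℂ) ^ 2 * τ.im = 2 * Real.pi := by exact_mod_cast scale_sq τ
  have h4 : (dualScale τ : ℂ) = scale τ * τ.im := by rw [dualScale_eq]; push_cast; rfl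
  have h5 : z = z.re + z.im * I := (re_add_im z).symm
  have h6 : (τ : ℂ) = τ.re + τ.im * I := (re_add_im (τ : ℂ)).symm
  rw [basis₁, basis₂, h6] at hμ
  rw [conj_eq z, h4, ← h3]
  generalize hxr : (z.re : ℂ) = x at *
  generalize hxi : (z.im : ℂ) = y at *
  generalize hr : (τ.re : ℂ) = p at *
  generalize hi : (τ.im : ℂ) = q at *
  generalize hs : (scale τ : ℂ) = r at *
  generalize hs : (coord₁ τ z : ℂ) = s at *
  generalize hs : (coord₂ τ z : ℂ) = t at *
  rw [h5]
  linear_combination (-(y * I)) * hμ - (I * r * b) * h1 + (I * r * a) * h2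

end

end MagneticLattice

namespace MagneticLattice

noncomputable section

open scoped ComplexConjugate

variable {τ : ℍ} {n : ℕ}

/-- A character times `coherent` is, up to a nonzero constant, again a `coherent` function, to which
f is orthogonal. So all Fourier coefficients of the product vanish. -/
lemma coherent_mul_ae_eq_zero (hn : 0 < n) {f : CellL2 τ}
    (hf : ∀ m c, inner ℂ (toL2 τ n ((up τ n ^ m) (theta hn c))) f = 0) (c : thetaSpace τ n)
    (u : ℂ) : (fun z => conj (coherent τ n c u z) * f z) =ᵐ[volume.restrict (cell τ)] 0 := by
  have hcont := continuous_coherent hn c u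
  refine ae_eq_zero_of_fourier ?_ fun a b => ?_
  · obtain ⟨C, hC⟩ := (isCompact_closedBall (0 : ℂ)
      (1 * ‖basis₁ τ‖ + 1 * ‖basis₂ τ‖)).exists_bound_of_continuousOn hcont.continuousOn
    have hb : MemLp (fun z => conj (coherent τ n c u z)) ⊤ (volume.restrict (cell τ)) := by
      refine memLp_top_of_bound (continuous_conj.comp hcont).aestronglyMeasurable C ?_
      filter_upwards [ae_restrict_mem (measurableSet_cell τ)] with z hz
      rw [RCLike.norm_conj]
      exact hC z (cell_subset_closedBall τ hz)
    exact (Lp.memLp f).mul hb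
  · have hn0 : (n : ℂ) ≠ 0 := by exact_mod_cast hn.ne'
    -- A shift by (a, b) produces the character with frequencies (b, -a), so the frequencies (a, b)
    -- need the shift (-b, a).
    obtain ⟨μ, hμ⟩ : ∃ μ : ℂ, n * μ = (-b : ℤ) * basis₁ τ + a * basis₂ τ :=
      ⟨((-b : ℤ) * basis₁ τ + a * basis₂ τ) / n, by field_simp⟩
    obtain ⟨K, hK, h⟩ := coherent_shiftCoeff (c : ℤ → ℂ) (-b) a hμ u
    have h1 := integral_coherent_eq_zero hn hf
      ⟨_, (mem_thetaSpace_iff.1 c.2).shiftCoeff (-b) a hμ⟩ (u - μ)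
    have h2 := congrArg (starRingEnd ℂ) h1
    rw [← integral_conj, map_zero] at h2
    rw [← mul_right_inj' hK, mul_zero, ← h2, ← integral_const_mul]
    congr 1
    ext z
    rw [map_mul, map_mul, conj_conj, conj_conj, h]
    push_cast
    ring_nf

/-- The functions obtained from the theta functions by the creation operator are total. -/
theorem eq_zero_of_inner_up_pow_theta (hn : 0 < n) {f : CellL2 τ}
    (hf : ∀ m c, inner ℂ (toL2 τ n ((up τ n ^ m) (theta hn c))) f = 0) : f = 0 := by
  have : Nonempty (Fin n) := ⟨⟨0, hn⟩⟩
  obtain ⟨c, hc⟩ : ∃ c : thetaSpace τ n, c ≠ 0 :=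
    ⟨(thetaSpaceEquiv hn).symm 1, by simp⟩
  -- One nonzero theta function and one point where it does not vanish are enough, since the
  -- translation parameter is free.
  obtain ⟨p, hp⟩ : ∃ p, thetaSum τ c p ≠ 0 := by
    by_contra! h
    refine hc (theta_injective hn ?_)
    ext z
    rw [coe_theta, thetaSeries_eq, h, mul_zero, map_zero]
    rfl
  have hcd : Continuous (thetaSum τ c) := ((mem_thetaSpace_iff.1 c.2).differentiable hn).continuous
  have hnull : volume.restrict (cell τ) {z | f z ≠ 0} = 0 := by
    refine measure_null_of_locally_null _ fun z _ => ?_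
    -- The translation p - z carries z to the nonvanishing point p. Near z the factor multiplying f
    -- has no zeros, so f vanishes almost everywhere there.
    have ho : ∀ᶠ w in nhds z, thetaSum τ c (w + (p - z)) ≠ 0 := by
      have : ContinuousAt (fun w => thetaSum τ c (w + (p - z))) z := by fun_prop
      exact this.eventually_ne (by simpa using hp)
    refine ⟨{z | f z ≠ 0} ∩ {w | thetaSum τ c (w + (p - z)) ≠ 0},
      Filter.inter_mem self_mem_nhdsWithin (mem_nhdsWithin_of_mem_nhds ho), ?_⟩
    refine measure_mono_null ?_ (coherent_mul_ae_eq_zero hn hf c (p - z))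
    rintro w ⟨h1, h2⟩ h3
    have h4 : conj (coherent τ n c (p - z) w) * f w = 0 := h3
    rw [coherent_eq, mul_eq_zero, map_eq_zero, mul_eq_zero] at h4
    rcases h4 with (h4 | h4) | h4
    · exact Complex.exp_ne_zero _ h4
    · exact h2 h4
    · exact h1 h4
  refine Lp.ext (.trans ?_ (Lp.coeFn_zero _ _ _).symm)
  exact hnull

/-! ### The Landau levels -/

/-- The functions of the Landau level `m`. -/
def levelMap (hn : 0 < n) (m : ℕ) : thetaSpace τ n →ₗ[ℂ] CellL2 τ :=
  toL2 τ n ∘ₗ (up τ n ^ m) ∘ₗ theta hn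

/-- The Landau level `m`. -/
def level (τ : ℍ) (hn : 0 < n) (m : ℕ) : Submodule ℂ (CellL2 τ) :=
  LinearMap.range (levelMap (τ := τ) hn m)

lemma levelMap_injective (hn : 0 < n) (m : ℕ) : Function.Injective (levelMap (τ := τ) hn m) := by
  rw [← LinearMap.ker_eq_bot, LinearMap.ker_eq_bot']
  intro c hc
  have h := toL2_injective (hc.trans (map_zero _).symm)
  exact theta_injective hn ((up_pow_injective hn (down_theta hn c) h).trans (map_zero _).symm)

lemma finrank_level (hn : 0 < n) (m : ℕ) : Module.finrank ℂ (level τ hn m) = n := by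
  rw [level, LinearMap.finrank_range_of_inj (levelMap_injective hn m),
    (thetaSpaceEquiv hn).finrank_eq, Module.finrank_fin_fun]

lemma exists_of_mem_level (hn : 0 < n) {m : ℕ} {ψ : CellL2 τ} (h : ψ ∈ level τ hn m) :
    ∃ v : smoothSpace τ n, toL2 τ n v = ψ ∧ lap τ n v = ((2 * m + 1) * n : ℂ) • v := by
  obtain ⟨c, rfl⟩ := h
  exact ⟨_, rfl, lap_up_pow (down_theta hn c) m⟩

/-- Eigenvectors of the symmetric Laplacian for different real eigenvalues. -/
lemma orthogonalFamily_level (hn : 0 < n) :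
    OrthogonalFamily ℂ (fun m => level τ hn m) fun m => (level τ hn m).subtypeₗᵢ := by
  rintro m k hmk ⟨ψ, hψ⟩ ⟨φ, hφ⟩
  obtain ⟨u, rfl, hu⟩ := exists_of_mem_level hn hψ
  obtain ⟨v, rfl, hv⟩ := exists_of_mem_level hn hφ
  have h := inner_lap u v
  rw [hu, hv, map_smul, map_smul, inner_smul_left, inner_smul_right, ← sub_eq_zero,
    ← sub_mul, mul_eq_zero] at h
  refine h.resolve_left ?_
  have h1 : ((2 * m + 1) * n : ℂ) = (((2 * m + 1) * n : ℕ) : ℂ) := by push_cast; rfl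
  rw [h1, map_natCast, sub_eq_zero]
  have : (2 * m + 1) * n ≠ (2 * k + 1) * n := fun h => hmk (by
    have := Nat.eq_of_mul_eq_mul_right hn h
    omega)
  exact_mod_cast this

/-- An orthonormal basis adapted to a total orthogonal family of subspaces of dimension `n`. -/
lemma _root_.OrthogonalFamily.exists_hilbertBasis {H κ : Type*} [NormedAddCommGroup H]
    [InnerProductSpace ℂ H] [CompleteSpace H] {V : κ → Submodule ℂ H} {n : ℕ} (hn : 0 < n)
    (hV : OrthogonalFamily ℂ (fun m => V m) fun m => (V m).subtypeₗᵢ)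
    (hr : ∀ m, Module.finrank ℂ (V m) = n) (ht : ∀ f : H, (∀ m, ∀ v ∈ V m, inner ℂ v f = 0) → f = 0) :
    ∃ b : HilbertBasis (Σ _ : κ, Fin n) ℂ H, (∀ i, b i ∈ V i.1) ∧
      ∀ m, Submodule.span ℂ (Set.range fun j => b ⟨m, j⟩) = V m := by
  have hfd : ∀ m, FiniteDimensional ℂ (V m) := fun m =>
    Module.finite_of_finrank_pos (by rw [hr]; exact hn)
  have he : ∀ m, Nonempty (OrthonormalBasis (Fin n) ℂ (V m)) := fun m =>
    ⟨(stdOrthonormalBasis ℂ (V m)).reindex (finCongr (hr m))⟩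
  let e : ∀ m, OrthonormalBasis (Fin n) ℂ (V m) := fun m => (he m).some
  clear_value e
  have hspan : ∀ m, Submodule.span ℂ (Set.range fun j => (e m j : H)) = V m := fun m => by
    have h1 := congrArg (Submodule.map (V m).subtype) (e m).toBasis.span_eq
    rw [Submodule.map_span, Submodule.map_top, Submodule.range_subtype, ← Set.range_comp] at h1
    simpa [Function.comp_def] using h1
  have ho : Orthonormal ℂ fun i : Σ _ : κ, Fin n => (e i.1 i.2 : H) :=
    hV.orthonormal_sigma_orthonormal fun m => (e m).orthonormal
  have hbot : (Submodule.span ℂ (Set.range fun i : Σ _ : κ, Fin n => (e i.1 i.2 : H)))ᗮ = ⊥ := by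
    rw [Submodule.eq_bot_iff]
    intro f hf
    refine ht f fun m v hv => (Submodule.mem_orthogonal _ _).1 hf _ ?_
    rw [← hspan m] at hv
    refine Submodule.span_mono ?_ hv
    rintro _ ⟨j, rfl⟩
    exact ⟨⟨m, j⟩, rfl⟩
  have hb := HilbertBasis.coe_mkOfOrthogonalEqBot ho hbot
  generalize HilbertBasis.mkOfOrthogonalEqBot ho hbot = b at hb
  refine ⟨b, fun i => ?_, fun m => ?_⟩
  · rw [hb]; exact (e i.1 i.2).2
  · rw [hb]; exact hspan m

/-- An orthonormal basis adapted to the Landau levels. -/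
theorem exists_hilbertBasis_level (τ : ℍ) (hn : 0 < n) :
    ∃ b : HilbertBasis (Σ _ : ℕ, Fin n) ℂ (CellL2 τ), (∀ i, b i ∈ level τ hn i.1) ∧
      ∀ m, Submodule.span ℂ (Set.range fun j => b ⟨m, j⟩) = level τ hn m :=
  (orthogonalFamily_level hn).exists_hilbertBasis hn (finrank_level hn) fun _ hf =>
    eq_zero_of_inner_up_pow_theta hn fun m c => hf m _ ⟨c, rfl⟩

/-- The eigenvalue of the Landau level `m`. -/
def levelValue (n m : ℕ) : ℝ := (2 * m + 1) * n

lemma ofReal_levelValue (n m : ℕ) : (levelValue n m : ℂ) = (2 * m + 1) * n := by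
  simp [levelValue]

lemma levelValue_injective (hn : 0 < n) : Function.Injective (levelValue n) := by
  intro m k h
  have h0 : (n : ℝ) ≠ 0 := by exact_mod_cast hn.ne'
  have h1 := mul_right_cancel₀ h0 h
  have : (m : ℝ) = k := by linarith
  exact_mod_cast this

/-- The eigenvalue of level m is at least m, so beyond ‖z‖ + 1 the distance to z is at least 1;
finitely many levels remain. -/
lemma exists_dist_levelValue (hn : 0 < n) {z : ℂ} (hz : ∀ m, (levelValue n m : ℂ) ≠ z) :
    ∃ δ > 0, ∀ m, δ ≤ ‖(levelValue n m : ℂ) - z‖ := by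
  have hn1 : (1 : ℝ) ≤ n := by exact_mod_cast hn
  obtain ⟨N, hN⟩ := exists_nat_ge ‖z‖
  obtain ⟨δ, hδ, h⟩ : ∃ δ > 0, ∀ m ∈ Finset.range (N + 1), δ ≤ ‖(levelValue n m : ℂ) - z‖ := by
    obtain ⟨k, -, hk⟩ := Finset.exists_min_image (Finset.range (N + 1))
      (fun m => ‖(levelValue n m : ℂ) - z‖) ⟨0, by simp⟩
    exact ⟨_, norm_pos_iff.2 (sub_ne_zero.2 (hz k)), hk⟩
  refine ⟨min δ 1, lt_min hδ one_pos, fun m => ?_⟩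
  rcases Nat.lt_or_ge m (N + 1) with hm | hm
  · exact (min_le_left _ _).trans (h m (Finset.mem_range.2 hm))
  · refine (min_le_right _ _).trans ?_
    have h1 : (N : ℝ) + 1 ≤ m := by exact_mod_cast hm
    have h2 : (m : ℝ) ≤ levelValue n m := by
      unfold levelValue; nlinarith
    have h3 : ‖(levelValue n m : ℂ)‖ = levelValue n m := by
      rw [norm_real, Real.norm_of_nonneg ((Nat.cast_nonneg m).trans h2)]
    have h4 := norm_sub_norm_le (levelValue n m : ℂ) z
    linarith

/-- Different levels have different eigenvalues, so only the n coefficients of level m can survive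
in an eigenvector. -/
lemma nullSpace_levelValue {b : HilbertBasis (Σ _ : ℕ, Fin n) ℂ (CellL2 τ)} (hn : 0 < n)
    (hspan : ∀ m, Submodule.span ℂ (Set.range fun j => b ⟨m, j⟩) = level τ hn m)
    (hT : IsDiagonalIn (magneticOperator τ n) b fun i => levelValue n i.1) (m : ℕ) :
    nullSpace (magneticOperator τ n) (levelValue n m : ℂ) = level τ hn m := by
  ext u
  rw [hT.mem_nullSpace_iff_inner, ← hspan]
  constructor
  · intro h
    have h1 : u = ∑ j, inner ℂ (b ⟨m, j⟩) u • b ⟨m, j⟩ := by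
      refine b.ext_inner fun i => ?_
      rw [inner_sum]
      simp only [inner_smul_right, orthonormal_iff_ite.1 b.orthonormal]
      obtain ⟨k, j⟩ := i
      by_cases hk : k = m
      · subst hk
        simp
      · rw [h _ (by exact_mod_cast (levelValue_injective hn).ne hk)]
        simp [hk]
    rw [h1]
    exact Submodule.sum_mem _ fun j _ => Submodule.smul_mem _ _ (Submodule.subset_span ⟨j, rfl⟩)
  · intro h i hi
    induction h using Submodule.span_induction with
    | mem x hx =>
      obtain ⟨j, rfl⟩ := hx
      refine b.orthonormal.inner_eq_zero ?_
      rintro rfl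
      exact hi rfl
    | zero => exact inner_zero_right _
    | add x y _ _ hx hy => rw [inner_add_right, hx, hy, add_zero]
    | smul a x _ hx => rw [inner_smul_right, hx, mul_zero]

lemma toL2_mem_smoothQuasiPeriodic (v : smoothSpace τ n) : toL2 τ n v ∈ smoothQuasiPeriodic τ n :=
  ⟨v, v.2.1, v.2.2, coe_toL2 v⟩

end

end MagneticLattice

/-! ### Density, self-adjointness, spectrum and ground states. -/

theorem theorem5p2 (τ : UpperHalfPlane) (n : ℕ) (hn : 0 < n) :
    (MagneticLattice.smoothQuasiPeriodic τ n).topologicalClosure = ⊤ ∧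
    IsSelfAdjoint (MagneticLattice.magneticOperator τ n) ∧
    MagneticLattice.unboundedSpectrum (MagneticLattice.magneticOperator τ n) =
      {z : ℂ | ∃ k : ℕ, z = (2 * k + 1) * n} ∧
    Module.finrank ℂ (MagneticLattice.nullSpace (MagneticLattice.magneticOperator τ n) n) = n ∧
    (∀ c : ℤ → ℂ, MagneticLattice.ThetaRelation τ n c →
      (∀ z : ℂ, Summable (MagneticLattice.thetaTerm τ c z)) ∧
      MagneticLattice.IsQuasiPeriodic τ n (MagneticLattice.thetaSeries τ n c)) ∧
    ∀ ψ : MagneticLattice.CellL2 τ,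
      ψ ∈ MagneticLattice.nullSpace (MagneticLattice.magneticOperator τ n) n ↔
        ∃ c : ℤ → ℂ, MagneticLattice.ThetaRelation τ n c ∧
          ψ =ᵐ[volume.restrict (MagneticLattice.cell τ)]
            MagneticLattice.thetaSeries τ n c := by
  obtain ⟨b, hb, hspan⟩ := MagneticLattice.exists_hilbertBasis_level τ hn
  have hT : MagneticLattice.IsDiagonalIn (MagneticLattice.magneticOperator τ n) b
      fun i => MagneticLattice.levelValue n i.1 := by
    refine MagneticLattice.isDiagonalIn_magneticOperator b _ fun i => ?_
    rw [MagneticLattice.ofReal_levelValue]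
    exact MagneticLattice.exists_of_mem_level hn (hb i)
  have hnull : MagneticLattice.nullSpace (MagneticLattice.magneticOperator τ n) n =
      MagneticLattice.level τ hn 0 := by
    rw [← MagneticLattice.nullSpace_levelValue hn hspan hT 0, MagneticLattice.ofReal_levelValue]
    simp
  refine ⟨?_, hT.isSelfAdjoint, ?_, ?_, fun c hc => ⟨hc.summable hn, hc.isQuasiPeriodic⟩,
    fun ψ => ?_⟩
  -- The basis vectors are classes of smooth quasi-periodic functions, so completeness of the levels
  -- also gives density.
  · rw [← top_le_iff, ← b.dense_span]
    refine Submodule.topologicalClosure_mono (Submodule.span_le.2 ?_)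
    rintro _ ⟨i, rfl⟩
    obtain ⟨v, hv, -⟩ := MagneticLattice.exists_of_mem_level hn (hb i)
    rw [SetLike.mem_coe, ← hv]
    exact MagneticLattice.toL2_mem_smoothQuasiPeriodic v
  · ext z
    constructor
    · intro hz
      by_contra h
      obtain ⟨δ, hδ, hd⟩ := MagneticLattice.exists_dist_levelValue hn (z := z) fun m hm =>
        h ⟨m, by rw [← hm, MagneticLattice.ofReal_levelValue]⟩
      exact hz (hT.inResolventSet hδ fun i => hd i.1)
    · rintro ⟨k, rfl⟩
      -- Any basis vector of level k is an eigenvector; index 0 exists because n is positive.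
      have := hT.not_inResolventSet ⟨k, ⟨0, hn⟩⟩
      rwa [MagneticLattice.ofReal_levelValue] at this
  · rw [hnull, MagneticLattice.finrank_level]
  · rw [hnull]
    constructor
    · rintro ⟨c, rfl⟩
      exact ⟨c, c.2, MagneticLattice.coe_toL2 (MagneticLattice.theta hn c)⟩
    · rintro ⟨c, hc, h⟩
      exact ⟨⟨c, hc⟩, Lp.ext ((MagneticLattice.coe_toL2 (MagneticLattice.theta hn ⟨c, hc⟩)).trans
        h.symm)⟩
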